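/- \textbf{Setting.} Let $p\ge 0$ and let $F=(\sum_{i,j}\widehat B_i\otimes\widehat B_j\,C_{ij})/w$ be a planar NURBS map of degree $p$ on the unit square, with open knot vectors, coefficients $C_{ij}\in\mathbb R^2$, weight function $w=\sum_{i,j} w_{ij}\,\widehat B_i\otimes \widehat B_j$ and $w_{ij}>0$. Assume that $F$ is bi-Lipschitz. Put $\gamma(t)=F(t,0)$, $\Gamma=\gamma((0,1))$. Let $\rho$ be a measurable weight with $0<\rho_0\le\rho\le\rho_1$ on $\Gamma$, and set $\widehat\rho(t)=\rho(\gamma(t))\,|\gamma'(t)|/w(t,0)$ and $(u,v)_{\widehat\rho}=\int_0^1 uv\,\widehat\rho\,dt$. Let $\Xi$ be an open knot vector of degree $p$ on $[0,1]$ (knots repeated at most $p+1$ times) with B-splines $\widehat B_1,\dots,\widehat B_n$ and mesh size $h$ (the length of the longest element), and let $I=\{i_{\min},\dots,i_{\max}\}$ with $i_{\min}\in\{1,2\}$, $i_{\max}\in\{n-1,n\}$; the functions $\widehat B_i$, $i\in I$, are the B-spline trace basis. If $\widehat B_i$ is supported on $n_i$ elements, let $\phi_{i,0}=\widehat B_i$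 and let $\phi_{i,0},\dots,\phi_{i,n_i-1}$ be a basis of the span of the restrictions of $\widehat B_i$ to the single elements (each extended by zero). Together these functions form a basis $(\varphi_k)$ of the space $W_h^{-1}$ of broken polynomials of degree at most $p$, in which $\widehat B_i$ keeps the index $i$. Let $K$ be the set of extra indices, i.e. of all indices except those of $\widehat B_i$, $i\in I$. Let $(\widetilde\psi_k)\subset W_h^{-1}$ be the biorthogonal basis, $(\widetilde\psi_k,\varphi_l)_{\widehat\rho}=\delta_{kl}$. For each $k\in K$ choose $I_{\rm loc}(k)\subset I$ with $p+1$ elements, let $(p_l)_{l=1}^{p+1}$ be a basis of $\mathbb P_p$, put $z_{ki}=0$ for $i\notin I_{\rm loc}(k)$, and let the other $z_{ki}$ solve the local square system \[\sum_{i\in I_{\rm loc}(k)}(p_l,\widehat B_i)_{\widehat\rho}\,z_{ki}=(p_l,\varphi_k)_{\widehat\rho},\qquad l=1,\dots,p+1.\] Put $\widehat\psi_i=\widetilde\psi_i+\sum_{k\in K}z_{ki}\widetilde\psi_k$ for $i\in I$, $M_h=\operatorname{span}\{\widehat\psi_i\circ\gamma^{-1}: i\in I\}$ and $Qf=\sum_{i\in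 I}(f,\widehat B_i)_{\widehat\rho}\,\widehat\psi_i$. \textbf{Theorem.} Let $F,\rho$ be as above, and let $\theta,\kappa\in\mathbb R$, $r\in\mathbb N$. There is a constant $c>0$, depending only on $p,F,\rho,\theta,\kappa,r$, such that the following holds for all $\Xi$, $I$, $(\phi_{i,j})$, $I_{\rm loc}$ and $(p_l)$ as above for which the mesh is quasi-uniform ($h\le\theta|e|$ for every element $e$), the matrices of the change of basis between $(\phi_{i,j})_j$ and the restrictions of $\widehat B_i$, and back, have entries bounded by $\kappa$, the index sets are local ($|i-i'|\le r$ for $i\in I_{\rm loc}(k)$, where $\varphi_k$ belongs to the group $(\phi_{i',j})_j$), and the local square system has full rank for every $k\in K$. The functions $\widetilde\psi_k$ and the numbers $z_{ki}$ are well defined, and \begin{enumerate} \item $(\widehat B_i,\widehat\psi_j)_{\widehat\rho}=\delta_{ij}$ for all $i,j\in I$; \item $QP=P$ on $(0,1)$ for every polynomial $P$ of degree at most $p$; \item for every $\lambda$ on $\Gamma$ with $\lambda\circ\gamma\in H^{p+1}(0,1)$, \[\inf_{\mu_h\in M_h}\|\mu_h-\lambda\|_{L^2(\Gamma)}\le c\,h^{p+1}\|\lambda\circ\gamma\|_{H^{p+1}(0,1)};\]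 \item if $\gamma\in C^p(0,1)$, then for every $\lambda\in H^{p+1}(\Gamma)$ (weak derivatives with respect to arc length), \[\inf_{\mu_h\in M_h}\|\mu_h-\lambda\|_{L^2(\Gamma)}\le c\,h^{p+1}\|\lambda\|_{H^{p+1}(\Gamma)}.\] \end{enumerate} -/

import Mathlib

open scoped ContDiff

noncomputable section

namespace DualSpline

/-- The Euclidean plane, which contains the computational domain. -/
abbrev Plane : Type := EuclideanSpace ℝ (Fin 2)

/-! ### B-splines -/

/-- Cox-de Boor recursion: `bspline ξ p i` is the `i`-th B-spline of degree `p` for the knots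
`ξ 0 ≤ ξ 1 ≤ …`; it is right-continuous, and quotients `0 / 0` are zero, as usual. -/
def bspline (ξ : ℕ → ℝ) : ℕ → ℕ → ℝ → ℝ
  | 0, i, t => if ξ i ≤ t ∧ t < ξ (i + 1) then 1 else 0
  | q + 1, i, t =>
      (t - ξ i) / (ξ (i + q + 1) - ξ i) * bspline ξ q i t
        + (ξ (i + q + 2) - t) / (ξ (i + q + 2) - ξ (i + 1)) * bspline ξ q (i + 1) t

/-- `ξ 0, …, ξ (n + p)` is an open knot vector of degree `p` on `[0, 1]` with `n` B-splines: it is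
nondecreasing, starts with `p + 1` zeros, ends with `p + 1` ones, and no knot is repeated more than
`p + 1` times. The values of `ξ` beyond `n + p` play no role. -/
structure IsOpenKnotVector (p n : ℕ) (ξ : ℕ → ℝ) : Prop where
  lt_card : p < n
  le_succ : ∀ i < n + p, ξ i ≤ ξ (i + 1)
  first : ∀ i ≤ p, ξ i = 0
  last : ∀ i ≤ p, ξ (n + i) = 1
  mult_le : ∀ i < n, ξ i < ξ (i + p + 1)

/-! ### NURBS parametrization and the interface -/

/-- A planar NURBS map of degree `p` on the unit square, given by two open knot vectors, positive
weights, and the coefficients of the spline numerator. -/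
structure NurbsMap (p : ℕ) where
  n₁ : ℕ
  n₂ : ℕ
  knot₁ : ℕ → ℝ
  knot₂ : ℕ → ℝ
  isOpen₁ : IsOpenKnotVector p n₁ knot₁
  isOpen₂ : IsOpenKnotVector p n₂ knot₂
  w : ℕ → ℕ → ℝ
  w_pos : ∀ i < n₁, ∀ j < n₂, 0 < w i j
  coeff : ℕ → ℕ → Plane

namespace NurbsMap

variable {p : ℕ} (F : NurbsMap p)

/-- The weight function `∑ w i j B_i(s) B_j(t)` of the NURBS space. -/
def weight (x : ℝ × ℝ) : ℝ :=
  ∑ i ∈ Finset.range F.n₁, ∑ j ∈ Finset.range F.n₂,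
    F.w i j * (bspline F.knot₁ p i x.1 * bspline F.knot₂ p j x.2)

/-- The NURBS map: a vector-valued tensor-product spline divided by the weight function. -/
def map (x : ℝ × ℝ) : Plane :=
  (F.weight x)⁻¹ • ∑ i ∈ Finset.range F.n₁, ∑ j ∈ Finset.range F.n₂,
    (bspline F.knot₁ p i x.1 * bspline F.knot₂ p j x.2) • F.coeff i j

/-- The map is bi-Lipschitz (on the half-open square, where the right-continuous B-splines
represent the map; it then extends to the closed square). -/
def IsBiLipschitz : Prop :=
  ∃ K : ℝ, 0 < K ∧ ∀ x ∈ Set.Ico (0 : ℝ) 1 ×ˢ Set.Ico (0 : ℝ) 1,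
    ∀ y ∈ Set.Ico (0 : ℝ) 1 ×ˢ Set.Ico (0 : ℝ) 1,
      dist (F.map x) (F.map y) ≤ K * dist x y ∧ dist x y ≤ K * dist (F.map x) (F.map y)

/-- The parametrization `t ↦ F (t, 0)`, `0 < t < 1`, of the interface. -/
def trace (t : ℝ) : Plane := F.map (t, 0)

/-- The transformed weight `ρ ∘ F · |∂ₜ F| / w` on the parametric interface. -/
def rhoHat (ρ : Plane → ℝ) (t : ℝ) : ℝ :=
  ρ (F.trace t) * ‖deriv F.trace t‖ / F.weight (t, 0)

end NurbsMap

/-! ### Function spaces -/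

/-- The weighted `L²` product `∫₀¹ u v ρ`. -/
def pairing (ρ u v : ℝ → ℝ) : ℝ := ∫ t in (0 : ℝ)..1, u t * v t * ρ t

/-- `g 0 = f`, `g 1`, …, `g m` are the successive weak derivatives of `f` on `(0, 1)` with respect
to the variable `s` with `ds = a dt`, and they all are square integrable. With `a = 1` these are
the ordinary weak derivatives; if `f` is the pull-back of a function on a curve `γ` and
`a = ‖γ'‖`, they are the pull-backs of the weak derivatives with respect to arc length. -/
structure IsWeakJet (a : ℝ → ℝ) (m : ℕ) (f : ℝ → ℝ) (g : ℕ → ℝ → ℝ) : Prop where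
  zero : ∀ t ∈ Set.Ioo (0 : ℝ) 1, g 0 t = f t
  memLp : ∀ k ≤ m, MeasureTheory.MemLp (g k) 2
    (MeasureTheory.volume.restrict (Set.Ioo (0 : ℝ) 1))
  succ : ∀ k < m, ∀ φ : ℝ → ℝ, ContDiff ℝ ∞ φ → HasCompactSupport φ →
    tsupport φ ⊆ Set.Ioo (0 : ℝ) 1 →
      ∫ t in (0 : ℝ)..1, g k t * deriv φ t = -∫ t in (0 : ℝ)..1, g (k + 1) t * φ t * a t

/-- `f` belongs to the Sobolev space of order `m` on `(0, 1)` with respect to `ds = a dt`. -/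
def MemSobolev (a : ℝ → ℝ) (m : ℕ) (f : ℝ → ℝ) : Prop := ∃ g, IsWeakJet a m f g

open Classical in
/-- The Sobolev norm `(∑_{k ≤ m} ∫ |f⁽ᵏ⁾|² ds)^{1/2}` with `ds = a dt` (the weak derivatives are
unique almost everywhere). -/
def sobolevNorm (a : ℝ → ℝ) (m : ℕ) (f : ℝ → ℝ) : ℝ :=
  if h : MemSobolev a m f then
    √(∑ k ∈ Finset.range (m + 1), ∫ t in (0 : ℝ)..1, (h.choose k t) ^ 2 * a t)
  else 0

/-- Arc length density of a curve. -/
def speed (γ : ℝ → Plane) (t : ℝ) : ℝ := ‖deriv γ t‖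

/-- The norm of `L²(Γ)` for the curve `Γ = γ (0, 1)`, with respect to arc length. -/
def curveL2Norm (γ : ℝ → Plane) (u : Plane → ℝ) : ℝ :=
  √(∫ t in (0 : ℝ)..1, (u (γ t)) ^ 2 * speed γ t)

/-- `u ∈ H^m(Γ)` for the curve `Γ = γ (0, 1)`, with weak derivatives along arc length. -/
def CurveMemSobolev (γ : ℝ → Plane) (m : ℕ) (u : Plane → ℝ) : Prop :=
  MemSobolev (speed γ) m (fun t => u (γ t))

/-- The norm of `H^m(Γ)` for the curve `Γ = γ (0, 1)`. -/
def curveSobolevNorm (γ : ℝ → Plane) (m : ℕ) (u : Plane → ℝ) : ℝ :=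
  sobolevNorm (speed γ) m (fun t => u (γ t))

/-- The function `v ∘ γ⁻¹` on the curve `γ (0, 1)`. -/
def pushToCurve (γ : ℝ → Plane) (v : ℝ → ℝ) (x : Plane) : ℝ :=
  v (Function.invFunOn γ (Set.Ioo (0 : ℝ) 1) x)

/-! ### The trace splines and the broken basis -/

/-- A univariate spline space of degree `p` on the parametric interface together with the range
`lo ≤ i < hi` of the B-splines that span the trace space. With indices starting at zero, the first
(respectively last) B-spline is left out if the left (respectively right) end point of the
interface is a crosspoint, and all others are kept. -/
structure TraceSplines (p : ℕ) where
  n : ℕ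
  knot : ℕ → ℝ
  isOpen : IsOpenKnotVector p n knot
  lo : ℕ
  hi : ℕ
  lo_le : lo ≤ 1
  hi_le : hi ≤ n
  le_hi : n ≤ hi + 1

namespace TraceSplines

variable {p : ℕ} (S : TraceSplines p)

/-- The B-spline `B_i`, `i < n`. -/
def B (i : ℕ) : ℝ → ℝ := bspline S.knot p i

/-- The mesh size, i.e. the length of the longest element. -/
def h : ℝ := ⨆ j : Fin S.n, (S.knot (j + 1) - S.knot j)

/-- The ratio of the lengths of any two elements is at most `θ`. -/
def IsQuasiUniform (θ : ℝ) : Prop :=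
  ∀ j < S.n, S.knot j < S.knot (j + 1) → S.h ≤ θ * (S.knot (j + 1) - S.knot j)

/-- The broken polynomials: on every element (interval between two consecutive distinct knots),
`v` is a polynomial of degree at most `p`. -/
def IsBroken (v : ℝ → ℝ) : Prop :=
  ∀ j < S.n, S.knot j < S.knot (j + 1) → ∃ P : Polynomial ℝ, P.natDegree ≤ p ∧
    ∀ t ∈ Set.Ioo (S.knot j) (S.knot (j + 1)), v t = P.eval t

/-- The elements in the support of `B_i`, where `j` stands for the element
`(knot j, knot (j + 1))`. -/
def elements (i : ℕ) : Finset ℕ :=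
  (Finset.Icc i (i + p)).filter fun j => S.knot j < S.knot (j + 1)

/-- The restriction of `B_i` to the element `j`, extended by zero. -/
def piece (i j : ℕ) : ℝ → ℝ :=
  (Set.Ico (S.knot j) (S.knot (j + 1))).indicator (S.B i)

/-- Index set of the broken basis: `(i, j)` with `i < n` and `j < n_i`, where `n_i` is the number
of elements in the support of `B_i`. -/
def index : Finset (ℕ × ℕ) :=
  (Finset.range S.n ×ˢ Finset.range (p + 1)).filter fun k => k.2 < (S.elements k.1).card

/-- The indices `i` of the B-splines `B_i` in the trace space. -/
def bsp : Finset ℕ := Finset.Ico S.lo S.hi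

/-- The extra indices: all indices of the broken basis, except for those of the B-splines
in the trace space. -/
def extra : Finset (ℕ × ℕ) := S.index \ S.bsp.image fun i => (i, 0)

/-- `φ (i, 0) = B_i`, and `φ (i, 0), …, φ (i, n_i - 1)` is a basis of the span of the `n_i`
restrictions of `B_i` to the elements in its support. All entries of the two matrices of the change
of basis between the `φ (i, j)` and these restrictions are bounded by `κ`. -/
def IsLocalExtension (κ : ℝ) (φ : ℕ × ℕ → ℝ → ℝ) : Prop :=
  (∀ i < S.n, φ (i, 0) = S.B i) ∧
  ∃ α β : ℕ → ℕ → ℕ → ℝ,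
    (∀ i j e, |α i j e| ≤ κ ∧ |β i e j| ≤ κ) ∧
    (∀ i < S.n, ∀ j < (S.elements i).card,
      φ (i, j) = ∑ e ∈ S.elements i, α i j e • S.piece i e) ∧
    (∀ i < S.n, ∀ e ∈ S.elements i,
      S.piece i e = ∑ j ∈ Finset.range (S.elements i).card, β i e j • φ (i, j))

variable (ρ : ℝ → ℝ) (φ : ℕ × ℕ → ℝ → ℝ)

/-- Mass matrix of the broken basis. -/
def gram : Matrix S.index S.index ℝ :=
  Matrix.of fun k l => pairing ρ (φ k) (φ l)

/-- The broken polynomials `ψ̃_k` that are biorthogonal to the basis `φ`, computed with the inverse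
of the mass matrix. -/
def psiTilde (k : ℕ × ℕ) : ℝ → ℝ :=
  if hk : k ∈ S.index then ∑ l : S.index, (S.gram ρ φ)⁻¹ ⟨k, hk⟩ l • φ l else 0

variable (q : Module.Basis (Fin (p + 1)) ℝ (Polynomial.degreeLT ℝ (p + 1)))
  (Iloc : ℕ × ℕ → Finset ℕ)

/-- The matrix `((p_l, B_i))`, `i ∈ Iloc k`, of the local system for the extra index `k`. -/
def localMatrix (k : ℕ × ℕ) : Matrix (Fin (p + 1)) (Iloc k) ℝ :=
  Matrix.of fun l i => pairing ρ (fun t => (q l : Polynomial ℝ).eval t) (S.B i)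

/-- `z` vanishes outside `Iloc k` and solves the local system
`∑_{i ∈ Iloc k} (p_l, B_i) z_i = (p_l, φ_k)`. -/
def SolvesLocalSystem (k : ℕ × ℕ) (z : ℕ → ℝ) : Prop :=
  (∀ i ∉ Iloc k, z i = 0) ∧
  ∀ l : Fin (p + 1),
    ∑ i ∈ Iloc k, pairing ρ (fun t => (q l : Polynomial ℝ).eval t) (S.B i) * z i =
      pairing ρ (fun t => (q l : Polynomial ℝ).eval t) (φ k)

open Classical in
/-- The coefficients `z_{k i}`: the solution of the local system for `k`. -/
def zCoeff (k : ℕ × ℕ) : ℕ → ℝ :=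
  if h : ∃ z, S.SolvesLocalSystem ρ φ q Iloc k z then h.choose else 0

/-- The biorthogonal functions `ψ̂_i = ψ̃_i + ∑_{k extra} z_{k i} ψ̃_k`. -/
def psiHat (i : ℕ) : ℝ → ℝ :=
  S.psiTilde ρ φ (i, 0) + ∑ k ∈ S.extra, S.zCoeff ρ φ q Iloc k i • S.psiTilde ρ φ k

/-- The quasi-interpolant `Q f = ∑_i (f, B_i) ψ̂_i`. -/
def quasiInterp (f : ℝ → ℝ) : ℝ → ℝ :=
  ∑ i ∈ S.bsp, pairing ρ f (S.B i) • S.psiHat ρ φ q Iloc i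

/-- The space `M_h` on the curve `γ (0, 1)`, spanned by the functions `ψ̂_i ∘ γ⁻¹`. -/
def multiplierSpace (γ : ℝ → Plane) : Submodule ℝ (Plane → ℝ) :=
  Submodule.span ℝ ((fun i => pushToCurve γ (S.psiHat ρ φ q Iloc i)) '' (S.bsp : Set ℕ))

end TraceSplines

end DualSpline

end

open DualSpline

open scoped ContDiff

noncomputable section

namespace DualSpline

open MeasureTheory Set

/-! ### Local theory of B-splines -/

/-! Expand `Q f` in the biorthogonal functions `ψ̃_k`. The coefficient of `ψ̃_k` is `(f, B_i)` if
`φ_k` is the trace B-spline `B_i`, and the sum of `z_{ki} (f, B_i)` over the local index set if `k`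
is extra (`quasiInterp_eq`). If `f = P` is a polynomial of degree at most `p`, the local systems
make all these coefficients equal to `(P, φ_k)`, so `QP` is the biorthogonal expansion of the broken
polynomial `P`, which is `P` itself. Biorthogonality is immediate, because the extra `ψ̃_k` are
orthogonal to the trace B-splines.

The error estimates follow from `Qf - f = Q(f - P) - (f - P)` with a Taylor polynomial `P` near each
element, provided that `Q` is bounded locally and uniformly in the mesh. Two bounds are needed for
this.

The functions `ψ̃_k` are local and of size `1/h` (`abs_psiTilde_le`). The energy of `ψ̃_k` on an
element only involves its product with the piece of the one B-spline to which `k` belongs, and that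
product is at most `κ`. The stability of B-spline coefficients (`exists_coeff_le_integral`) turns
this into a pointwise bound.

The numbers `z_{ki}` are bounded independently of the mesh (`abs_le_zBound`), although full rank is
only a qualitative assumption. The spline `s = ∑ z_{ki} B_i` has at most `p + 1` nonzero
coefficients. By variation diminution (`Represents.alternates`, a consequence of knot insertion) it
has at most `p` sign changes, so some polynomial `P` of degree at most `p` with real roots nearby
makes `P s` of one sign (`Represents.exists_roots`). Testing the local system with `P` shows that
the integral of `|P| |s|` against the weight equals `|(P, φ_k)|`. Away from its roots `|P|` is at
least a constant times a power of `h`, and near the support of `φ_k` it is at most a constant times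
the same power. The powers cancel, and the stability of coefficients bounds `z_{ki}`.

For derivatives along arc length, the chain rule expresses the `t`-derivatives of `λ ∘ γ` by the
arc-length derivatives, with coefficients made of derivatives of the speed up to order `p`
(`exists_sobolevBound_mul`). Between knots `γ` is rational with a denominator bounded from below, so
these are bounded; the bi-Lipschitz property keeps the speed away from zero, and `γ ∈ C^p` excludes
jumps in the derivatives that have to be integrated. -/

lemma bspline_congr {ξ η : ℕ → ℝ} {q : ℕ} :
    ∀ {i : ℕ}, (∀ k, i ≤ k → k ≤ i + q + 1 → ξ k = η k) → bspline ξ q i = bspline η q i := by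
  induction q with
  | zero =>
    intro i h
    funext t
    simp only [bspline]
    rw [h i le_rfl (by omega), h (i + 1) (by omega) (by omega)]
  | succ q ih =>
    intro i h
    funext t
    simp only [bspline]
    rw [ih (i := i) fun k h1 h2 => h k h1 (by omega),
      ih (i := i + 1) fun k h1 h2 => h k (by omega) (by omega),
      h i le_rfl (by omega), h (i + 1) (by omega) (by omega), h (i + q + 1) (by omega) (by omega),
      h (i + q + 2) (by omega) (by omega)]

lemma measurable_bspline (ξ : ℕ → ℝ) (q : ℕ) : ∀ i, Measurable (bspline ξ q i) := by
  induction q with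
  | zero =>
    intro i
    have : bspline ξ 0 i = (Set.Ico (ξ i) (ξ (i + 1))).indicator 1 := by
      funext t
      simp [bspline, Set.indicator_apply]
    rw [this]
    exact measurable_one.indicator measurableSet_Ico
  | succ q ih =>
    intro i
    have h1 := ih i
    have h2 := ih (i + 1)
    have h3 : bspline ξ (q + 1) i = fun t => (t - ξ i) / (ξ (i + q + 1) - ξ i) * bspline ξ q i t
        + (ξ (i + q + 2) - t) / (ξ (i + q + 2) - ξ (i + 1)) * bspline ξ q (i + 1) t := rfl
    rw [h3]
    fun_prop

lemma bspline_eq_zero_of_lt {ξ : ℕ → ℝ} (hξ : Monotone ξ) {q : ℕ} : ∀ {i : ℕ} {t : ℝ}, t < ξ i → bspline ξ q i t = 0 := by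
  induction q with
  | zero =>
    intro i t h
    simp [bspline, not_le.2 h]
  | succ q ih =>
    intro i t h
    simp [bspline, ih h, ih (h.trans_le (hξ (Nat.le_succ i)))]

lemma bspline_eq_zero_of_le {ξ : ℕ → ℝ} (hξ : Monotone ξ) {q : ℕ} :
    ∀ {i : ℕ} {t : ℝ}, ξ (i + q + 1) ≤ t → bspline ξ q i t = 0 := by
  induction q with
  | zero =>
    intro i t h
    simp [bspline, not_lt.2 h]
  | succ q ih =>
    intro i t h
    have h1 : ξ (i + q + 1) ≤ t := (hξ (by omega)).trans h
    have h2 : ξ (i + 1 + q + 1) ≤ t := by convert h using 2; omega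
    simp [bspline, ih h1, ih h2]

lemma bspline_nonneg {ξ : ℕ → ℝ} (hξ : Monotone ξ) {q : ℕ} : ∀ (i : ℕ) (t : ℝ), 0 ≤ bspline ξ q i t := by
  induction q with
  | zero =>
    intro i t
    simp only [bspline]
    split_ifs <;> norm_num
  | succ q ih =>
    intro i t
    simp only [bspline]
    refine add_nonneg ?_ ?_
    · rcases lt_or_ge t (ξ i) with h | h
      · rw [bspline_eq_zero_of_lt hξ h, mul_zero]
      · exact mul_nonneg (div_nonneg (sub_nonneg.2 h) (sub_nonneg.2 (hξ (by omega)))) (ih _ _)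
    · rcases le_or_gt (ξ (i + 1 + q + 1)) t with h | h
      · rw [bspline_eq_zero_of_le hξ h, mul_zero]
      · have : i + 1 + q + 1 = i + q + 2 := by omega
        rw [this] at h
        exact mul_nonneg (div_nonneg (sub_nonneg.2 h.le) (sub_nonneg.2 (hξ (by omega)))) (ih _ _)

/-- One step of de Boor's algorithm on the element `[ξ (b + q + 1), ξ (b + q + 2))`. -/
lemma sum_bspline_succ {ξ : ℕ → ℝ} (hξ : Monotone ξ) {q b : ℕ} {t : ℝ} (h1 : ξ (b + q + 1) ≤ t) (h2 : t < ξ (b + q + 2))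
    (c : ℕ → ℝ) :
    ∑ i ∈ Finset.range (q + 2), c i * bspline ξ (q + 1) (b + i) t =
      ∑ i ∈ Finset.range (q + 1),
        ((t - ξ (b + i + 1)) / (ξ (b + i + q + 2) - ξ (b + i + 1)) * c (i + 1) +
          (ξ (b + i + q + 2) - t) / (ξ (b + i + q + 2) - ξ (b + i + 1)) * c i) *
            bspline ξ q (b + 1 + i) t := by
  have e1 : bspline ξ q b t = 0 := bspline_eq_zero_of_le hξ h1
  have e2 : bspline ξ q (b + (q + 1) + 1) t = 0 :=
    bspline_eq_zero_of_lt hξ (by convert h2 using 2; omega)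
  simp only [bspline, mul_add, Finset.sum_add_distrib, add_mul]
  congr 1
  · rw [Finset.sum_range_succ']
    simp only [add_zero, e1, mul_zero]
    refine Finset.sum_congr rfl fun i _ => ?_
    rw [show b + (i + 1) = b + i + 1 by omega, show b + 1 + i = b + i + 1 by omega,
      show b + i + 1 + q + 1 = b + i + q + 2 by omega]
    ring
  · rw [Finset.sum_range_succ]
    simp only [e2, mul_zero, add_zero]
    refine Finset.sum_congr rfl fun i _ => ?_
    rw [show b + 1 + i = b + i + 1 by omega]
    ring

/-- The two weights in a step of de Boor's algorithm add up to one, so the constant coefficient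
vector survives down to degree zero. -/
lemma sum_bspline_eq_one {ξ : ℕ → ℝ} (hξ : Monotone ξ) {q : ℕ} : ∀ {b : ℕ} {t : ℝ}, ξ (b + q) ≤ t → t < ξ (b + q + 1) →
    ∑ i ∈ Finset.range (q + 1), bspline ξ q (b + i) t = 1 := by
  induction q with
  | zero =>
    intro b t h1 h2
    simp only [add_zero] at h1 h2
    rw [zero_add, Finset.sum_range_one]
    simp [bspline, h1, h2]
  | succ q ih =>
    intro b t h1 h2
    have := sum_bspline_succ hξ (q := q) (b := b) h1 h2 (fun _ => 1)
    simp only [one_mul, mul_one] at this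
    rw [this, ← ih (b := b + 1) (t := t) (by convert h1 using 2; omega) (by convert h2 using 2; omega)]
    refine Finset.sum_congr rfl fun i hi => ?_
    have hi := Finset.mem_range.1 hi
    have h3 : ξ (b + i + 1) ≤ ξ (b + (q + 1)) := hξ (by omega)
    have h4 : ξ (b + (q + 1) + 1) ≤ ξ (b + i + q + 2) := hξ (by omega)
    have h5 : ξ (b + i + q + 2) - ξ (b + i + 1) ≠ 0 := by linarith
    field_simp
    ring

/-- The coefficients of `(t - y) ^ q` in Marsden's identity on the element
`[ξ (b + q), ξ (b + q + 1))`. -/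
def marsden (ξ : ℕ → ℝ) (q b : ℕ) (y : ℝ) (i : ℕ) : ℝ :=
  ∏ m ∈ Finset.range q, (ξ (b + i + 1 + m) - y)

/-- Neighbouring Marsden coefficients share all but one factor, and these two factors are the
distances of `y` from two knots. The de Boor weights interpolate them linearly to `t - y`, so each
step splits off one factor `t - y`. -/
lemma sum_marsden_mul_bspline {ξ : ℕ → ℝ} (hξ : Monotone ξ) (y : ℝ) {q : ℕ} :
    ∀ {b : ℕ} {t : ℝ}, ξ (b + q) ≤ t → t < ξ (b + q + 1) →
      ∑ i ∈ Finset.range (q + 1), marsden ξ q b y i * bspline ξ q (b + i) t = (t - y) ^ q := by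
  induction q with
  | zero =>
    intro b t h1 h2
    simp only [add_zero] at h1 h2
    rw [zero_add, Finset.sum_range_one]
    simp [bspline, marsden, h1, h2]
  | succ q ih =>
    intro b t h1 h2
    rw [sum_bspline_succ hξ h1 h2, pow_succ',
      ← ih (b := b + 1) (t := t) (by convert h1 using 2; omega) (by convert h2 using 2; omega),
      Finset.mul_sum]
    refine Finset.sum_congr rfl fun i hi => ?_
    have hi := Finset.mem_range.1 hi
    have h3 : ξ (b + i + 1) ≤ ξ (b + (q + 1)) := hξ (by omega)
    have h4 : ξ (b + (q + 1) + 1) ≤ ξ (b + i + q + 2) := hξ (by omega)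
    have h5 : ξ (b + i + q + 2) - ξ (b + i + 1) ≠ 0 := by linarith
    have e1 : marsden ξ (q + 1) b y (i + 1) =
        marsden ξ q (b + 1) y i * (ξ (b + i + q + 2) - y) := by
      simp only [marsden, Finset.prod_range_succ]
      congr 1
      · exact Finset.prod_congr rfl fun m _ => by congr 2; omega
      · congr 2; omega
    have e2 : marsden ξ (q + 1) b y i = marsden ξ q (b + 1) y i * (ξ (b + i + 1) - y) := by
      simp only [marsden, Finset.prod_range_succ']
      congr 1
      exact Finset.prod_congr rfl fun m _ => by congr 2; omega
    rw [e1, e2]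
    generalize marsden ξ q (b + 1) y i = N
    generalize bspline ξ q (b + 1 + i) t = N'
    field_simp
    ring

/-- Powers of translates are linearly independent. -/
lemma eq_zero_of_sum_sub_pow_eq_zero {q : ℕ} {y : Fin (q + 1) → ℝ} (hy : Function.Injective y)
    {a : Fin (q + 1) → ℝ} {s : Set ℝ} (hs : s.Infinite)
    (h : ∀ t ∈ s, ∑ l, a l * (t - y l) ^ q = 0) : a = 0 := by
  have hP : (∑ l, Polynomial.C (a l) * (Polynomial.X - Polynomial.C (y l)) ^ q) = 0 := by
    refine Polynomial.eq_zero_of_infinite_isRoot _ (hs.mono fun t ht => ?_)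
    simpa [Polynomial.eval_finsetSum] using h t ht
  -- The coefficient of `X ^ (q - k)` is a binomial coefficient times the `k`-th moment of `a` at
  -- the nodes `-y l`, so all moments vanish and Vandermonde applies.
  refine Matrix.eq_zero_of_forall_pow_sum_mul_pow_eq_zero
    (f := fun l => -y l) (neg_injective.comp hy) fun k => ?_
  have hk : (k : ℕ) ≤ q := Nat.lt_succ_iff.1 k.2
  have h1 := congrArg (fun P => Polynomial.coeff P (q - k)) hP
  simp only [Polynomial.finsetSum_coeff, Polynomial.coeff_C_mul, sub_eq_add_neg,
    ← Polynomial.C_neg, Polynomial.coeff_X_add_C_pow, Polynomial.coeff_zero] at h1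
  simp only [Nat.sub_sub_self hk] at h1
  have h2 : ((q.choose (q - k) : ℕ) : ℝ) ≠ 0 :=
    Nat.cast_ne_zero.2 (Nat.choose_pos (Nat.sub_le _ _)).ne'
  refine ((mul_eq_zero (a := ((q.choose (q - k) : ℕ) : ℝ))).1 ?_).resolve_left h2
  rw [← h1, Finset.mul_sum]
  exact Finset.sum_congr rfl fun l _ => by ring

/-- There are `q + 1` independent powers in a space of dimension `q + 1`. -/
lemma exists_eval_eq_sum_sub_pow {q : ℕ} {y : Fin (q + 1) → ℝ} (hy : Function.Injective y)
    {P : Polynomial ℝ} (hP : P.natDegree ≤ q) :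
    ∃ a : Fin (q + 1) → ℝ, ∀ t, P.eval t = ∑ l, a l * (t - y l) ^ q := by
  let T : (Fin (q + 1) → ℝ) →ₗ[ℝ] Polynomial ℝ :=
    Fintype.linearCombination ℝ fun l => (Polynomial.X - Polynomial.C (y l)) ^ q
  have hT : ∀ a t, (T a).eval t = ∑ l, a l * (t - y l) ^ q := fun a t => by
    simp [T, Fintype.linearCombination_apply, Polynomial.eval_finsetSum]
  have hmem : ∀ a, T a ∈ Polynomial.degreeLT ℝ (q + 1) := fun a => by
    simp only [T, Fintype.linearCombination_apply]
    refine Submodule.sum_mem _ fun l _ => Submodule.smul_mem _ _ ?_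
    rw [Polynomial.mem_degreeLT, Polynomial.degree_pow, Polynomial.degree_X_sub_C]
    simp only [nsmul_eq_mul, mul_one]
    exact_mod_cast Nat.lt_succ_self q
  have hinj : Function.Injective (T.codRestrict _ hmem) := by
    rw [← LinearMap.ker_eq_bot, LinearMap.ker_eq_bot']
    intro a ha
    refine eq_zero_of_sum_sub_pow_eq_zero hy Set.infinite_univ fun t _ => ?_
    rw [← hT]
    have : T a = 0 := congrArg Subtype.val ha
    simp [this]
  have hfin : Module.finrank ℝ (Fin (q + 1) → ℝ) =
      Module.finrank ℝ (Polynomial.degreeLT ℝ (q + 1)) :=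
    (Polynomial.degreeLTEquiv ℝ (q + 1)).finrank_eq.symm
  have : FiniteDimensional ℝ (Polynomial.degreeLT ℝ (q + 1)) :=
    Module.Finite.equiv (Polynomial.degreeLTEquiv ℝ (q + 1)).symm
  have hPm : P ∈ Polynomial.degreeLT ℝ (q + 1) := by
    rw [Polynomial.mem_degreeLT]
    exact (Polynomial.degree_le_of_natDegree_le hP).trans_lt (by exact_mod_cast Nat.lt_succ_self q)
  obtain ⟨a, ha⟩ :=
    (LinearMap.injective_iff_surjective_of_finrank_eq_finrank hfin).1 hinj ⟨P, hPm⟩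
  refine ⟨a, fun t => ?_⟩
  rw [← hT, show T a = P from congrArg Subtype.val ha]

/-- Every coefficient vector on an element is a combination of Marsden vectors. -/
lemma exists_eq_sum_marsden {ξ : ℕ → ℝ} (hξ : Monotone ξ) {q b : ℕ}
    (he : ξ (b + q) < ξ (b + q + 1)) {y : Fin (q + 1) → ℝ} (hy : Function.Injective y)
    (c : ℕ → ℝ) :
    ∃ a : Fin (q + 1) → ℝ, ∀ i ≤ q, c i = ∑ l, a l * marsden ξ q b (y l) i := by
  let M : (Fin (q + 1) → ℝ) →ₗ[ℝ] (Fin (q + 1) → ℝ) :=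
    Fintype.linearCombination ℝ fun l i => marsden ξ q b (y l) i
  have hM : ∀ a i, M a i = ∑ l, a l * marsden ξ q b (y l) i := fun a i => by
    simp [M, Fintype.linearCombination_apply, Finset.sum_apply]
  -- A vanishing combination of Marsden vectors yields, by Marsden's identity, a combination of
  -- powers that vanishes on the whole element; the system is square, so injectivity suffices.
  have hinj : Function.Injective M := by
    rw [← LinearMap.ker_eq_bot, LinearMap.ker_eq_bot']
    intro a ha
    refine eq_zero_of_sum_sub_pow_eq_zero hy (Set.Ico_infinite he) fun t ht => ?_
    calc ∑ l, a l * (t - y l) ^ q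
        = ∑ l, ∑ i ∈ Finset.range (q + 1), a l * marsden ξ q b (y l) i * bspline ξ q (b + i) t :=
          Finset.sum_congr rfl fun l _ => by
            rw [← sum_marsden_mul_bspline hξ (y l) ht.1 ht.2, Finset.mul_sum]
            exact Finset.sum_congr rfl fun i _ => by ring
      _ = ∑ i ∈ Finset.range (q + 1), (∑ l, a l * marsden ξ q b (y l) i) * bspline ξ q (b + i) t := by
          rw [Finset.sum_comm]
          simp only [Finset.sum_mul]
      _ = 0 := Finset.sum_eq_zero fun i hi => by
          have := hM a ⟨i, Finset.mem_range.1 hi⟩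
          rw [ha] at this
          simp only [Pi.zero_apply] at this
          rw [← this, zero_mul]
  obtain ⟨a, ha⟩ := LinearMap.injective_iff_surjective.1 hinj fun i => c i
  exact ⟨a, fun i hi => by rw [← hM a ⟨i, Nat.lt_succ_of_le hi⟩, ha]⟩

lemma sum_bspline_eq_of_marsden {ξ : ℕ → ℝ} (hξ : Monotone ξ) {q b : ℕ} {y : Fin (q + 1) → ℝ}
    {c : ℕ → ℝ} {a : Fin (q + 1) → ℝ} (h : ∀ i ≤ q, c i = ∑ l, a l * marsden ξ q b (y l) i)
    {t : ℝ} (h1 : ξ (b + q) ≤ t) (h2 : t < ξ (b + q + 1)) :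
    ∑ i ∈ Finset.range (q + 1), c i * bspline ξ q (b + i) t = ∑ l, a l * (t - y l) ^ q := by
  calc _ = ∑ i ∈ Finset.range (q + 1), ∑ l, a l * marsden ξ q b (y l) i * bspline ξ q (b + i) t :=
        Finset.sum_congr rfl fun i hi => by
          rw [h i (Nat.lt_succ_iff.1 (Finset.mem_range.1 hi)), Finset.sum_mul]
    _ = _ := by
        rw [Finset.sum_comm]
        refine Finset.sum_congr rfl fun l _ => ?_
        rw [← sum_marsden_mul_bspline hξ (y l) h1 h2, Finset.mul_sum]
        exact Finset.sum_congr rfl fun i _ => by ring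

lemma natCast_fin_injective (q : ℕ) : Function.Injective fun l : Fin (q + 1) => ((l : ℕ) : ℝ) :=
  fun _ _ h => Fin.ext (Nat.cast_injective h)

/-- On an element, a spline is a polynomial. -/
lemma exists_polynomial_sum_bspline {ξ : ℕ → ℝ} (hξ : Monotone ξ) {q b : ℕ}
    (he : ξ (b + q) < ξ (b + q + 1)) (c : ℕ → ℝ) :
    ∃ P : Polynomial ℝ, P.natDegree ≤ q ∧ ∀ t, ξ (b + q) ≤ t → t < ξ (b + q + 1) →
      ∑ i ∈ Finset.range (q + 1), c i * bspline ξ q (b + i) t = P.eval t := by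
  obtain ⟨a, ha⟩ := exists_eq_sum_marsden hξ he (natCast_fin_injective q) c
  refine ⟨∑ l : Fin (q + 1), Polynomial.C (a l) *
    (Polynomial.X - Polynomial.C ((l : ℕ) : ℝ)) ^ q, ?_, fun t h1 h2 => ?_⟩
  · refine Polynomial.natDegree_sum_le_of_forall_le _ _ fun l _ => ?_
    refine (Polynomial.natDegree_C_mul_le _ _).trans ?_
    rw [Polynomial.natDegree_pow, Polynomial.natDegree_X_sub_C, mul_one]
  · rw [sum_bspline_eq_of_marsden hξ ha h1 h2]
    simp [Polynomial.eval_finsetSum]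

/-! ### Stability of the coefficients, by compactness of the unit sphere and scaling -/

lemma exists_abs_le_integral_sum_sub_pow (q : ℕ) :
    ∃ C : ℝ, 0 < C ∧ ∀ (a : Fin (q + 1) → ℝ) (l : Fin (q + 1)),
      |a l| ≤ C * ∫ x in (0 : ℝ)..1, |∑ l : Fin (q + 1), a l * (x - ((l : ℕ) : ℝ)) ^ q| := by
  set f : (Fin (q + 1) → ℝ) → ℝ := fun a =>
    ∫ x in (0 : ℝ)..1, |∑ l : Fin (q + 1), a l * (x - ((l : ℕ) : ℝ)) ^ q| with hf
  have hcont : Continuous f := by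
    refine intervalIntegral.continuous_parametric_intervalIntegral_of_continuous' ?_ 0 1
    unfold Function.uncurry
    fun_prop
  have hhom : ∀ (r : ℝ) a, f (r • a) = |r| * f a := fun r a => by
    simp only [hf, ← intervalIntegral.integral_const_mul]
    refine intervalIntegral.integral_congr fun x _ => ?_
    simp only [← abs_mul, Finset.mul_sum, Pi.smul_apply, smul_eq_mul, mul_assoc]
  have hpos : ∀ a, a ≠ 0 → 0 < f a := fun a ha => by
    by_contra hle
    have hc : Continuous fun x : ℝ => |∑ l : Fin (q + 1), a l * (x - ((l : ℕ) : ℝ)) ^ q| := by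
      fun_prop
    refine ha (eq_zero_of_sum_sub_pow_eq_zero (natCast_fin_injective q)
      (Set.Icc_infinite zero_lt_one) fun t ht => ?_)
    by_contra hne
    exact hle (intervalIntegral.integral_pos zero_lt_one hc.continuousOn
      (fun x _ => abs_nonneg _) ⟨t, ht, abs_pos.2 hne⟩)
  obtain ⟨a₀, ha₀, hmin⟩ := (isCompact_sphere (0 : Fin (q + 1) → ℝ) 1).exists_isMinOn
    (NormedSpace.sphere_nonempty.2 zero_le_one) hcont.continuousOn
  have ha₀' : ‖a₀‖ = 1 := by simpa using ha₀
  have hm : 0 < f a₀ := hpos a₀ fun h => by simp [h] at ha₀'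
  refine ⟨(f a₀)⁻¹, inv_pos.2 hm, fun a l => ?_⟩
  change |a l| ≤ (f a₀)⁻¹ * f a
  rcases eq_or_ne a 0 with rfl | ha
  · have : 0 ≤ f 0 := by simpa using (hhom 0 0).ge
    simpa using mul_nonneg (inv_pos.2 hm).le this
  · have hn : 0 < ‖a‖ := norm_pos_iff.2 ha
    have h1 : f a₀ ≤ f (‖a‖⁻¹ • a) := hmin (by
      simp [norm_smul, hn.ne'])
    rw [hhom, abs_of_pos (inv_pos.2 hn), inv_mul_eq_div, le_div_iff₀ hn] at h1
    calc |a l| ≤ ‖a‖ := norm_le_pi_norm a l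
      _ ≤ (f a₀)⁻¹ * f a := by
        rw [inv_mul_eq_div, le_div_iff₀ hm]
        linarith

/-- Stability of the B-spline coefficients on an interval inside of an element. -/
theorem exists_coeff_le_integral (q : ℕ) {R : ℝ} (hR : 0 ≤ R) :
    ∃ C : ℝ, 0 < C ∧ ∀ ξ : ℕ → ℝ, Monotone ξ → ∀ (b : ℕ) (α δ : ℝ), 0 < δ → ξ (b + q) ≤ α →
      α + δ ≤ ξ (b + q + 1) → (∀ k, b + 1 ≤ k → k ≤ b + 2 * q → |ξ k - α| ≤ R * δ) →
      ∀ (c : ℕ → ℝ), ∀ i ≤ q, |c i| ≤ C / δ *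
        ∫ t in α..α + δ, |∑ i ∈ Finset.range (q + 1), c i * bspline ξ q (b + i) t| := by
  obtain ⟨C, hC, hCa⟩ := exists_abs_le_integral_sum_sub_pow q
  -- The first term bounds `q + 1` Marsden vectors with entries up to `(R + q) ^ q * δ ^ q`; the
  -- second only makes positivity evident.
  refine ⟨(q + 1) * (R + q) ^ q * C + C, by positivity, fun ξ hξ b α δ hδ h1 h2 hR c i hi => ?_⟩
  -- The affine map from `[0, 1]` to `[α, α + δ]` takes the reference nodes `0, …, q` to these
  -- nodes, so one compactness constant serves all intervals.
  have hy : Function.Injective fun l : Fin (q + 1) => α + δ * ((l : ℕ) : ℝ) := fun l l' h => by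
    refine natCast_fin_injective q (mul_left_cancel₀ hδ.ne' (add_left_cancel (a := α) ?_))
    exact h
  obtain ⟨a, ha⟩ := exists_eq_sum_marsden hξ (by linarith : ξ (b + q) < ξ (b + q + 1)) hy c
  set I := ∫ t in α..α + δ, |∑ i ∈ Finset.range (q + 1), c i * bspline ξ q (b + i) t| with hI
  have hIeq : I = δ * ∫ x in (0 : ℝ)..1,
      |∑ l : Fin (q + 1), (δ ^ q * a l) * (x - ((l : ℕ) : ℝ)) ^ q| := by
    have e1 : I = ∫ t in α..α + δ, |∑ l : Fin (q + 1), a l * (t - (α + δ * ((l : ℕ) : ℝ))) ^ q| := by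
      rw [hI, intervalIntegral.integral_of_le (by linarith),
        intervalIntegral.integral_of_le (by linarith), MeasureTheory.integral_Ioc_eq_integral_Ioo,
        MeasureTheory.integral_Ioc_eq_integral_Ioo]
      refine MeasureTheory.setIntegral_congr_fun measurableSet_Ioo fun t ht => ?_
      rw [sum_bspline_eq_of_marsden hξ ha (h1.trans ht.1.le) (ht.2.trans_le h2)]
    have e2 := intervalIntegral.smul_integral_comp_mul_add (a := 0) (b := 1)
      (fun t => |∑ l : Fin (q + 1), a l * (t - (α + δ * ((l : ℕ) : ℝ))) ^ q|) δ α
    rw [smul_eq_mul] at e2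
    rw [e1, show α + δ = δ * 1 + α by ring, show (∫ t in α..δ * 1 + α,
      |∑ l : Fin (q + 1), a l * (t - (α + δ * ((l : ℕ) : ℝ))) ^ q|) = ∫ t in δ * 0 + α..δ * 1 + α,
      |∑ l : Fin (q + 1), a l * (t - (α + δ * ((l : ℕ) : ℝ))) ^ q| by simp, ← e2]
    congr 1
    refine intervalIntegral.integral_congr fun x _ => ?_
    congr 1
    refine Finset.sum_congr rfl fun l _ => ?_
    rw [show δ * x + α - (α + δ * ((l : ℕ) : ℝ)) = δ * (x - ((l : ℕ) : ℝ)) by ring, mul_pow]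
    ring
  have hal : ∀ l, δ ^ q * |a l| ≤ C / δ * I := fun l => by
    have := hCa (fun l => δ ^ q * a l) l
    rw [abs_mul, abs_of_pos (pow_pos hδ q)] at this
    rw [hIeq, ← mul_assoc, div_mul_cancel₀ _ hδ.ne']
    exact this
  -- Only the knots with indices from `b + 1` to `b + 2 * q` enter the Marsden coefficients of this
  -- element; this is why the hypothesis concerns just these.
  have hmar : ∀ l : Fin (q + 1), |marsden ξ q b (α + δ * ((l : ℕ) : ℝ)) i| ≤
      (R + q) ^ q * δ ^ q := fun l => by
    rw [marsden, Finset.abs_prod, ← mul_pow]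
    refine (Finset.prod_le_prod (g := fun _ => (R + q) * δ) (fun _ _ => abs_nonneg _)
      fun m hm => ?_).trans (by simp)
    have hm := Finset.mem_range.1 hm
    have h3 := abs_le.1 (hR (b + i + 1 + m) (by omega) (by omega))
    have h4 : ((l : ℕ) : ℝ) ≤ q := by exact_mod_cast Nat.lt_succ_iff.1 l.2
    have h5 : (0 : ℝ) ≤ ((l : ℕ) : ℝ) := Nat.cast_nonneg _
    rw [abs_le]
    constructor <;> nlinarith
  have hI0 : 0 ≤ I := intervalIntegral.integral_nonneg (by linarith) fun _ _ => abs_nonneg _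
  have hCI : 0 ≤ C / δ * I := by positivity
  calc |c i| ≤ ∑ l : Fin (q + 1), |a l| * |marsden ξ q b (α + δ * ((l : ℕ) : ℝ)) i| := by
        rw [ha i hi]
        simpa only [abs_mul] using Finset.abs_sum_le_sum_abs
          (fun l : Fin (q + 1) => a l * marsden ξ q b (α + δ * ((l : ℕ) : ℝ)) i) Finset.univ
    _ ≤ ∑ l : Fin (q + 1), (R + q) ^ q * (C / δ * I) := Finset.sum_le_sum fun l _ => by
        calc _ ≤ |a l| * ((R + q) ^ q * δ ^ q) := by gcongr; exact hmar l
          _ = (R + q) ^ q * (δ ^ q * |a l|) := by ring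
          _ ≤ _ := by exact mul_le_mul_of_nonneg_left (hal l) (by positivity)
    _ = (q + 1) * (R + q) ^ q * C / δ * I := by
        rw [Finset.sum_const, Finset.card_univ, Fintype.card_fin, nsmul_eq_mul]
        push_cast
        ring
    _ ≤ _ := by
        rw [add_div ((q + 1) * (R + q) ^ q * C), add_mul _ (C / δ)]
        exact le_add_of_nonneg_right hCI

/-! ### Strict alternation -/

/-- There are `u 0 < ⋯ < u k` in `s` at which `f` is nonzero with alternating signs, where
`f (u 0)` has the sign of `σ`. -/
def Alternates {ι : Type*} [LT ι] (f : ι → ℝ) (s : Set ι) (k : ℕ) (σ : ℝ) : Prop :=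
  ∃ u : ℕ → ι, (∀ l ≤ k, u l ∈ s) ∧ (∀ l < k, u l < u (l + 1)) ∧
    ∀ l ≤ k, 0 < σ * (-1) ^ l * f (u l)

lemma alternates_cons {ι : Type*} [LT ι] {f : ι → ℝ} {s : Set ι} {k : ℕ} {σ : ℝ} {x : ι}
    {u : ℕ → ι} (hx : x ∈ s) (hxf : 0 < σ * f x) (hxu : x < u 0) (hu : ∀ l ≤ k, u l ∈ s)
    (hlt : ∀ l < k, u l < u (l + 1)) (hf : ∀ l ≤ k, 0 < -σ * (-1) ^ l * f (u l)) :
    Alternates f s (k + 1) σ := by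
  refine ⟨fun l => Nat.casesOn l x u, fun l hl => ?_, fun l hl => ?_, fun l hl => ?_⟩
  · cases l with
    | zero => exact hx
    | succ l => exact hu l (by omega)
  · cases l with
    | zero => exact hxu
    | succ l => exact hlt l (by omega)
  · cases l with
    | zero => simpa using hxf
    | succ l =>
      have := hf l (by omega)
      simp only [pow_succ]
      linarith

/-- Given two alternations with opposite initial signs, the one that starts later can be extended on
the left by the first point of the other. The first points differ since `f` has opposite signs
there. -/
lemma exists_not_alternates_neg {f : ℝ → ℝ} {s : Set ℝ} {k : ℕ}
    (h1 : ¬ Alternates f s (k + 1) 1) (h2 : ¬ Alternates f s (k + 1) (-1)) :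
    ∃ σ : ℝ, |σ| = 1 ∧ ¬ Alternates f s k (-σ) := by
  by_contra! h
  obtain ⟨u, hu, hult, huf⟩ := h (-1) (by simp)
  obtain ⟨v, hv, hvlt, hvf⟩ := h 1 (by simp)
  have hu0 := huf 0 (Nat.zero_le _)
  have hv0 := hvf 0 (Nat.zero_le _)
  rw [neg_neg] at hu0
  simp only [pow_zero, mul_one] at hu0 hv0
  rcases lt_trichotomy (u 0) (v 0) with hlt | heq | hlt
  · exact h1 (alternates_cons (hu 0 (Nat.zero_le _)) hu0 hlt hv hvlt hvf)
  · rw [heq] at hu0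
    linarith
  · exact h2 (alternates_cons (hv 0 (Nat.zero_le _)) hv0 hlt hu hult huf)

/-- A function without long alternations has the sign of a polynomial with few real roots. -/
lemma exists_roots_of_not_alternates {f : ℝ → ℝ} (m : ℕ) :
    ∀ {σ A B : ℝ}, ¬ Alternates f (Set.Ioo A B) m (-σ) →
      ∃ L : List ℝ, L.length ≤ m ∧ (∀ τ ∈ L, A ≤ τ ∧ τ ≤ B) ∧
        ∀ t ∈ Set.Ioo A B, 0 ≤ σ * f t * (L.map fun τ => τ - t).prod := by
  induction m with
  | zero =>
    intro σ A B h
    refine ⟨[], by simp, by simp, fun t ht => ?_⟩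
    by_contra hneg
    refine h ⟨fun _ => t, fun _ _ => ht, fun l hl => absurd hl (Nat.not_lt_zero _), fun l hl => ?_⟩
    rw [Nat.le_zero.1 hl]
    simp at hneg ⊢
    linarith
  | succ m ih =>
    intro σ A B h
    by_cases hne : ∃ t ∈ Set.Ioo A B, 0 < -σ * f t
    -- The first root is the infimum of the points with the wrong sign. Left of it the sign is `σ`;
    -- to its right every alternation can be extended by a point of `N`, so one alternation fewer is
    -- possible there.
    · set N := {t | t ∈ Set.Ioo A B ∧ 0 < -σ * f t} with hN
      have hbdd : BddBelow N := ⟨A, fun t ht => ht.1.1.le⟩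
      have hnon : N.Nonempty := hne.imp fun t ht => ht
      have hA : A ≤ sInf N := le_csInf hnon fun t ht => ht.1.1.le
      obtain ⟨L, hL, hLm, hLf⟩ := ih (σ := -σ) (A := sInf N) (B := B) (by
        rintro ⟨u, hu, hult, huf⟩
        obtain ⟨x, hx, hxu⟩ := exists_lt_of_csInf_lt hnon (hu 0 (Nat.zero_le _)).1
        exact h (alternates_cons hx.1 hx.2 hxu
          (fun l hl => ⟨hA.trans_lt (hu l hl).1, (hu l hl).2⟩) hult huf))
      refine ⟨sInf N :: L, by simpa using hL, ?_, fun t ht => ?_⟩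
      · intro τ hτ
        rcases List.mem_cons.1 hτ with rfl | hτ
        · obtain ⟨t, ht⟩ := hnon
          exact ⟨hA, (csInf_le hbdd ht).trans ht.1.2.le⟩
        · exact ⟨hA.trans (hLm τ hτ).1, (hLm τ hτ).2⟩
      · simp only [List.map_cons, List.prod_cons]
        rcases lt_trichotomy t (sInf N) with hlt | heq | hlt
        · have h1 : 0 ≤ σ * f t := by
            by_contra hc
            exact absurd (csInf_le hbdd (show t ∈ N from ⟨ht, by linarith⟩)) (not_le.2 hlt)
          refine mul_nonneg h1 (mul_nonneg (sub_nonneg.2 hlt.le) (List.prod_nonneg fun x hx => ?_))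
          obtain ⟨τ, hτ, rfl⟩ := List.mem_map.1 hx
          exact sub_nonneg.2 (hlt.le.trans (hLm τ hτ).1)
        · simp [heq]
        · have := mul_nonneg (hLf t ⟨hlt, ht.2⟩) (sub_nonneg.2 hlt.le)
          linarith
    · push Not at hne
      refine ⟨[], by simp, by simp, fun t ht => ?_⟩
      have := hne t ht
      simp
      linarith

/-- Convex combinations of neighbours do not create alternations. -/
lemma Alternates.of_convex {c w : ℕ → ℝ} {b k : ℕ} {σ : ℝ} (hw : ∀ i, 0 ≤ w i ∧ w i ≤ 1)
    (hwb : w b = 1)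
    (h : Alternates (fun i => w i * c i + (1 - w i) * c (i - 1)) (Set.Ici b) k σ) :
    Alternates c (Set.Ici b) k σ := by
  obtain ⟨u, hu, hlt, hf⟩ := h
  -- A convex combination can only have a sign that one of its two entries has, so `v l` is either
  -- `u l` or `u l - 1`.
  have hex : ∀ l, ∃ v, l ≤ k → (v ≤ u l ∧ u l ≤ v + 1 ∧ b ≤ v ∧ 0 < σ * (-1) ^ l * c v) := by
    intro l
    by_cases hl : l ≤ k
    · have h1 : 0 < σ * (-1) ^ l * (w (u l) * c (u l) + (1 - w (u l)) * c (u l - 1)) := hf l hl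
      have h2 := hu l hl
      simp only [Set.mem_Ici] at h2
      by_cases h3 : 0 < σ * (-1) ^ l * c (u l)
      · exact ⟨u l, fun _ => ⟨le_rfl, by omega, h2, h3⟩⟩
      -- At `b` the weight is one, so the entry `b - 1` outside of the range is never needed.
      · have hub : u l ≠ b := by
          intro hub
          rw [hub, hwb] at h1
          rw [hub] at h3
          simp only [one_mul, sub_self, zero_mul, add_zero] at h1
          exact h3 h1
        refine ⟨u l - 1, fun _ => ⟨by omega, by omega, by omega, ?_⟩⟩
        by_contra h4
        have := hw (u l)
        nlinarith [mul_nonneg this.1 (neg_nonneg.2 (not_lt.1 h3)),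
          mul_nonneg (sub_nonneg.2 this.2) (neg_nonneg.2 (not_lt.1 h4))]
    · exact ⟨0, fun h => absurd h hl⟩
  choose v hv using hex
  refine ⟨v, fun l hl => (hv l hl).2.2.1, fun l hl => ?_, fun l hl => (hv l hl).2.2.2⟩
  have h1 := hv l hl.le
  have h2 := hv (l + 1) hl
  have h3 := hlt l hl
  -- Moving left by at most one preserves weak order, and equality is impossible because consecutive
  -- entries have opposite signs.
  refine lt_of_le_of_ne (by omega) fun heq => ?_
  have h4 := h1.2.2.2
  have h5 := h2.2.2.2
  rw [← heq, pow_succ] at h5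
  linarith

/-- The number of alternations is less than the number of nonzero entries. -/
lemma not_alternates_of_card_le {c : ℕ → ℝ} {T : Finset ℕ} (hc : ∀ i ∉ T, c i = 0) {s : Set ℕ}
    {k : ℕ} (hT : T.card ≤ k) (σ : ℝ) : ¬ Alternates c s k σ := by
  rintro ⟨u, -, hlt, hf⟩
  have hmono : ∀ l m, l < m → m ≤ k → u l < u m := by
    intro l m hlm
    induction m, hlm using Nat.le_induction with
    | base => exact fun h => hlt l h
    | succ m _ ih => exact fun h => (ih (by omega)).trans (hlt m h)
  have hinj : Set.InjOn u (Finset.range (k + 1)) := by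
    intro l hl m hm h
    have hl := Finset.mem_range.1 hl
    have hm := Finset.mem_range.1 hm
    rcases lt_trichotomy l m with h1 | h1 | h1
    · exact absurd h (hmono l m h1 (by omega)).ne
    · exact h1
    · exact absurd h (hmono m l h1 (by omega)).ne'
  have hmaps : ∀ l ∈ Finset.range (k + 1), u l ∈ T := by
    intro l hl
    by_contra hn
    have := hf l (by have := Finset.mem_range.1 hl; omega)
    rw [hc _ hn] at this
    simp at this
  have := Finset.card_le_card_of_injOn u hmaps hinj
  rw [Finset.card_range] at this
  omega

/-! ### Knot insertion -/

/-- The sum of the B-splines that are active on the element `[ξ (b + q), ξ (b + q + 1))`. -/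
def activeSum (ξ : ℕ → ℝ) (q b : ℕ) (c : ℕ → ℝ) (t : ℝ) : ℝ :=
  ∑ i ∈ Finset.range (q + 1), c (b + i) * bspline ξ q (b + i) t

/-- On `[lo, hi)`, the function `s` is the spline with the coefficients `c`. -/
def Represents (ξ : ℕ → ℝ) (q : ℕ) (c : ℕ → ℝ) (lo hi : ℝ) (s : ℝ → ℝ) : Prop :=
  ∀ b t, lo ≤ t → t < hi → ξ (b + q) ≤ t → t < ξ (b + q + 1) → activeSum ξ q b c t = s t

lemma activeSum_congr {ξ : ℕ → ℝ} {q b : ℕ} {c d : ℕ → ℝ}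
    (h : ∀ i, b ≤ i → i ≤ b + q → c i = d i) (t : ℝ) :
    activeSum ξ q b c t = activeSum ξ q b d t :=
  Finset.sum_congr rfl fun i hi => by
    rw [h (b + i) (by omega) (by have := Finset.mem_range.1 hi; omega)]

/-- Marsden's coefficients, with global indices. -/
def dualPoly (ξ : ℕ → ℝ) (q : ℕ) (y : ℝ) (k : ℕ) : ℝ :=
  ∏ m ∈ Finset.range q, (ξ (k + 1 + m) - y)

lemma exists_eq_sum_dualPoly {ξ : ℕ → ℝ} (hξ : Monotone ξ) {q b : ℕ}
    (he : ξ (b + q) < ξ (b + q + 1)) (c : ℕ → ℝ) :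
    ∃ a : Fin (q + 1) → ℝ, ∀ i, b ≤ i → i ≤ b + q →
      c i = ∑ l : Fin (q + 1), a l * dualPoly ξ q ((l : ℕ) : ℝ) i := by
  obtain ⟨a, ha⟩ := exists_eq_sum_marsden hξ he (natCast_fin_injective q) fun i => c (b + i)
  refine ⟨a, fun i h1 h2 => ?_⟩
  have := ha (i - b) (by omega)
  rw [Nat.add_sub_cancel' h1] at this
  rw [this]
  refine Finset.sum_congr rfl fun l _ => ?_
  rw [marsden, Nat.add_sub_cancel' h1, dualPoly]

lemma activeSum_dualPoly {ξ : ℕ → ℝ} (hξ : Monotone ξ) {q b : ℕ} (a : Fin (q + 1) → ℝ)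
    {t : ℝ} (h1 : ξ (b + q) ≤ t) (h2 : t < ξ (b + q + 1)) :
    activeSum ξ q b (fun i => ∑ l : Fin (q + 1), a l * dualPoly ξ q ((l : ℕ) : ℝ) i) t =
      ∑ l : Fin (q + 1), a l * (t - ((l : ℕ) : ℝ)) ^ q :=
  sum_bspline_eq_of_marsden (c := fun i => ∑ l : Fin (q + 1), a l *
    dualPoly ξ q ((l : ℕ) : ℝ) (b + i)) hξ (fun _ _ => rfl) h1 h2

/-- At a knot of multiplicity `q`, a spline of degree `q` takes the value of a coefficient. -/
lemma activeSum_eq_coeff {ξ : ℕ → ℝ} (hξ : Monotone ξ) {q b : ℕ} {t : ℝ}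
    (h1 : ∀ k, b + 1 ≤ k → k ≤ b + q → ξ k = t) (h2 : ξ (b + q) ≤ t) (h3 : t < ξ (b + q + 1))
    (c : ℕ → ℝ) : activeSum ξ q b c t = c b := by
  obtain ⟨a, ha⟩ := exists_eq_sum_dualPoly hξ (h2.trans_lt h3) c
  rw [activeSum_congr ha, activeSum_dualPoly hξ a h2 h3, ha b le_rfl (by omega)]
  refine Finset.sum_congr rfl fun l _ => ?_
  rw [dualPoly, Finset.prod_congr rfl fun m hm => by
    rw [h1 (b + 1 + m) (by omega) (by have := Finset.mem_range.1 hm; omega)]]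
  simp

/-- The knot `x` is inserted behind the knot with index `j`. -/
def insertKnot (ξ : ℕ → ℝ) (j : ℕ) (x : ℝ) (k : ℕ) : ℝ :=
  if k ≤ j then ξ k else if k = j + 1 then x else ξ (k - 1)

/-- The weights in Boehm's algorithm. -/
def insertWeight (ξ : ℕ → ℝ) (q j : ℕ) (x : ℝ) (i : ℕ) : ℝ :=
  if i + q ≤ j then 1 else if i ≤ j then (x - ξ i) / (ξ (i + q) - ξ i) else 0

/-- The coefficients after the insertion of a knot. -/
def insertCoeff (ξ : ℕ → ℝ) (q j : ℕ) (x : ℝ) (c : ℕ → ℝ) (i : ℕ) : ℝ :=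
  insertWeight ξ q j x i * c i + (1 - insertWeight ξ q j x i) * c (i - 1)

lemma insertKnot_of_le {ξ : ℕ → ℝ} {j k : ℕ} {x : ℝ} (h : k ≤ j) : insertKnot ξ j x k = ξ k :=
  if_pos h

lemma insertKnot_self (ξ : ℕ → ℝ) (j : ℕ) (x : ℝ) : insertKnot ξ j x (j + 1) = x := by
  simp [insertKnot]

lemma insertKnot_of_lt {ξ : ℕ → ℝ} {j k : ℕ} {x : ℝ} (h : j < k) :
    insertKnot ξ j x (k + 1) = ξ k := by
  simp [insertKnot, show ¬ k + 1 ≤ j by omega, h.ne']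

lemma monotone_insertKnot {ξ : ℕ → ℝ} (hξ : Monotone ξ) {j : ℕ} {x : ℝ} (h1 : ξ j ≤ x)
    (h2 : x ≤ ξ (j + 1)) : Monotone (insertKnot ξ j x) := by
  refine monotone_nat_of_le_succ fun k => ?_
  rcases lt_trichotomy k j with h | h | h
  · rw [insertKnot_of_le h.le, insertKnot_of_le h]
    exact hξ (Nat.le_succ k)
  · rw [h, insertKnot_of_le le_rfl, insertKnot_self]
    exact h1
  · rw [insertKnot_of_lt h]
    rcases Nat.exists_eq_add_of_lt h with ⟨d, rfl⟩
    cases d with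
    | zero => rw [add_zero, insertKnot_self]; exact h2
    | succ d =>
      rw [insertKnot_of_lt (by omega)]
      exact hξ (by omega)

lemma insertWeight_mem {ξ : ℕ → ℝ} (hξ : Monotone ξ) {q j : ℕ} {x : ℝ} (h1 : ξ j ≤ x)
    (h2 : x ≤ ξ (j + 1)) (i : ℕ) :
    0 ≤ insertWeight ξ q j x i ∧ insertWeight ξ q j x i ≤ 1 := by
  unfold insertWeight
  split_ifs with h3 h4
  · simp
  · have h5 : ξ i ≤ x := (hξ h4).trans h1
    have h6 : x ≤ ξ (i + q) := h2.trans (hξ (by omega))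
    exact ⟨div_nonneg (by linarith) (by linarith), div_le_one_of_le₀ (by linarith) (by linarith)⟩
  · simp

/-- Two neighbouring products share all factors but `ξ (i + q) - y` and `ξ i - y`, and Boehm's
weight interpolates these two to `x - y`, the factor of the new knot. Since Marsden vectors span all
coefficient vectors on an element, this is all that is needed for knot insertion. -/
lemma insertCoeff_dualPoly {ξ : ℕ → ℝ} (hξ : Monotone ξ) {q j : ℕ} {x : ℝ} (h1 : ξ j ≤ x)
    (h2 : x ≤ ξ (j + 1)) (hq : q ≤ j) (y : ℝ) (i : ℕ) :
    insertCoeff ξ q j x (dualPoly ξ q y) i = dualPoly (insertKnot ξ j x) q y i := by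
  unfold insertCoeff insertWeight
  split_ifs with h3 h4
  · simp only [one_mul, sub_self, zero_mul, add_zero, dualPoly]
    refine Finset.prod_congr rfl fun m hm => ?_
    rw [insertKnot_of_le (by have := Finset.mem_range.1 hm; omega)]
  · obtain ⟨d, rfl⟩ := Nat.exists_eq_add_of_le h4
    obtain ⟨e, rfl⟩ : ∃ e, q = d + e + 1 := ⟨q - d - 1, by omega⟩
    obtain ⟨i, rfl⟩ : ∃ i', i = i' + 1 := ⟨i - 1, by omega⟩
    set N := ∏ m ∈ Finset.range (d + e), (ξ (i + 1 + 1 + m) - y) with hN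
    have e1 : dualPoly ξ (d + e + 1) y (i + 1) = N * (ξ (i + 1 + (d + e + 1)) - y) := by
      rw [dualPoly, Finset.prod_range_succ]
      congr 3
      omega
    have e2 : dualPoly ξ (d + e + 1) y (i + 1 - 1) = N * (ξ (i + 1) - y) := by
      rw [dualPoly, Finset.prod_range_succ']
      congr 1
      exact Finset.prod_congr rfl fun m _ => by congr 2; omega
    have e3 : dualPoly (insertKnot ξ (i + 1 + d) x) (d + e + 1) y (i + 1) = N * (x - y) := by
      rw [dualPoly, show d + e + 1 = d + (e + 1) by omega, Finset.prod_range_add _ d (e + 1),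
        Finset.prod_range_succ', hN, Finset.prod_range_add, mul_assoc]
      congr 1
      · refine Finset.prod_congr rfl fun m hm => ?_
        rw [insertKnot_of_le (by have := Finset.mem_range.1 hm; omega)]
      · congr 1
        · refine Finset.prod_congr rfl fun m hm => ?_
          rw [show i + 1 + 1 + (d + (m + 1)) = (i + 1 + 1 + (d + m)) + 1 by omega,
            insertKnot_of_lt (by omega)]
        · rw [show i + 1 + 1 + (d + 0) = i + 1 + d + 1 by omega, insertKnot_self]
    rw [e1, e2, e3]
    have h5 : ξ (i + 1) ≤ x := (hξ (by omega)).trans h1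
    have h6 : x ≤ ξ (i + 1 + (d + e + 1)) := h2.trans (hξ (by omega))
    -- If the two outer knots coincide, they coincide with `x`, both neighbouring coefficients
    -- agree, and the value of the weight `0 / 0` does not matter.
    by_cases h7 : ξ (i + 1 + (d + e + 1)) - ξ (i + 1) = 0
    · rw [h7, show ξ (i + 1) = x by linarith]
      simp
    · field_simp
      ring
  · obtain ⟨i, rfl⟩ : ∃ i', i = i' + 1 := ⟨i - 1, by omega⟩
    simp only [zero_mul, sub_zero, one_mul, zero_add, dualPoly, Nat.add_sub_cancel]
    refine Finset.prod_congr rfl fun m hm => ?_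
    rw [show i + 1 + 1 + m = (i + 1 + m) + 1 by omega, insertKnot_of_lt (by omega)]

lemma insertCoeff_sum {ξ : ℕ → ℝ} {q j : ℕ} {x : ℝ} {ι : Type*} (s : Finset ι) (a : ι → ℝ)
    (g : ι → ℕ → ℝ) (i : ℕ) :
    insertCoeff ξ q j x (fun i => ∑ l ∈ s, a l * g l i) i =
      ∑ l ∈ s, a l * insertCoeff ξ q j x (g l) i := by
  simp only [insertCoeff, Finset.mul_sum, ← Finset.sum_add_distrib]
  exact Finset.sum_congr rfl fun l _ => by ring

lemma exists_element {ξ : ℕ → ℝ} {q N : ℕ} {t : ℝ} (h1 : ξ q ≤ t) (h2 : t < ξ N)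
    (hξ : Monotone ξ) : ∃ b, ξ (b + q) ≤ t ∧ t < ξ (b + q + 1) := by
  classical
  have hex : ∃ b, t < ξ (b + q + 1) := ⟨N, h2.trans_le (hξ (by omega))⟩
  refine ⟨Nat.find hex, ?_, Nat.find_spec hex⟩
  rcases h : Nat.find hex with _ | b
  · simpa using h1
  · have := Nat.find_min hex (m := b) (by omega)
    rw [not_lt] at this
    rwa [show b + 1 + q = b + q + 1 by omega]

/-- Boehm's knot insertion. -/
lemma Represents.insert {ξ : ℕ → ℝ} (hξ : Monotone ξ) {q j N : ℕ} {x lo hi : ℝ} (h1 : ξ j ≤ x)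
    (h2 : x ≤ ξ (j + 1)) (hq : q ≤ j) (hlo : ξ q ≤ lo) (hhi : hi ≤ ξ N) {c : ℕ → ℝ} {s : ℝ → ℝ}
    (hs : Represents ξ q c lo hi s) :
    Represents (insertKnot ξ j x) q (insertCoeff ξ q j x c) lo hi s := by
  intro b' t hlt hth hb1 hb2
  obtain ⟨b, hb3, hb4⟩ := exists_element (hlo.trans hlt) (hth.trans_le hhi) hξ
  have hξ' := monotone_insertKnot hξ h1 h2
  -- Let `b` be the index of the old element containing `t`. The new element has the same index if
  -- it lies left of the inserted knot, and is shifted by one if it lies to the right.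
  have hbb : (b' = b ∧ b + q ≤ j) ∨ (b' = b + 1 ∧ j ≤ b + q) := by
    have hle : ∀ k, ξ k ≤ t → k ≤ b + q := fun k hk => by
      by_contra hc
      exact absurd ((hξ (show b + q + 1 ≤ k by omega)).trans hk) (not_le.2 hb4)
    have hge : ∀ k, t < ξ k → b + q + 1 ≤ k := fun k hk => by
      by_contra hc
      exact absurd (hb3.trans' (hξ (show k ≤ b + q by omega))) (not_le.2 hk)
    rcases lt_trichotomy (b' + q) j with h | h | h
    · rw [insertKnot_of_le h.le] at hb1
      rw [insertKnot_of_le h] at hb2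
      have := hle _ hb1
      have := hge _ hb2
      omega
    · rw [insertKnot_of_le h.le] at hb1
      rw [h, insertKnot_self] at hb2
      have := hle _ hb1
      have := hge _ (hb2.trans_le h2)
      omega
    · rw [insertKnot_of_lt h] at hb2
      have h5 := hge _ hb2
      obtain ⟨k, hk⟩ : ∃ k, b' + q = k + 1 := ⟨b' + q - 1, by omega⟩
      rw [hk] at hb1
      rcases Nat.lt_or_ge j k with h6 | h6
      · rw [insertKnot_of_lt h6] at hb1
        have := hle _ hb1
        omega
      · obtain rfl : k = j := by omega
        rw [insertKnot_self] at hb1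
        have := hle _ (h1.trans hb1)
        omega
  obtain ⟨a, ha⟩ := exists_eq_sum_dualPoly hξ (hb3.trans_lt hb4) c
  -- Both splines are the same combination of powers, by Marsden's identity for the old and for the
  -- new knots.
  rw [← hs b t hlt hth hb3 hb4, activeSum_congr ha, activeSum_dualPoly hξ a hb3 hb4,
    ← activeSum_dualPoly hξ' a hb1 hb2]
  refine activeSum_congr (fun i hi1 hi2 => ?_) t
  calc insertCoeff ξ q j x c i
      = insertCoeff ξ q j x (fun i => ∑ l : Fin (q + 1), a l * dualPoly ξ q ((l : ℕ) : ℝ) i) i := by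
        -- The representation by `a` is known for the indices from `b` to `b + q` only; the
        -- neighbour outside of this range has weight zero.
        unfold insertCoeff
        rcases hbb with ⟨rfl, h⟩ | ⟨rfl, h⟩
        · rw [ha i hi1 hi2]
          rcases hi1.eq_or_lt with rfl | hlt
          · rw [insertWeight, if_pos h]
            simp
          · rw [ha (i - 1) (by omega) (by omega)]
        · rw [ha (i - 1) (by omega) (by omega)]
          rcases hi2.eq_or_lt with rfl | hlt
          · have : insertWeight ξ q j x (b + 1 + q) = 0 := by
              rw [insertWeight, if_neg (by omega), if_neg (by omega)]
            rw [this]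
            simp
          · rw [ha i (by omega) (by omega)]
    _ = _ := by
        rw [insertCoeff_sum]
        simp only [insertCoeff_dualPoly hξ h1 h2 hq]

/-- Insertion of a knot with multiplicity `m`. -/
lemma Represents.exists_insert {q j b : ℕ} {x lo hi : ℝ} {s : ℝ → ℝ} (hb : b + q ≤ j) (m : ℕ) :
    ∀ {ξ c : ℕ → ℝ} {N : ℕ}, Monotone ξ → ξ j ≤ x → x < ξ (j + 1) → ξ q ≤ lo → hi ≤ ξ N →
      Represents ξ q c lo hi s →
      ∃ (ξ' c' : ℕ → ℝ) (N' : ℕ), Monotone ξ' ∧ (∀ k, k ≤ j → ξ' k = ξ k) ∧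
        (∀ k, j < k → k ≤ j + m → ξ' k = x) ∧ x < ξ' (j + m + 1) ∧ ξ' q ≤ lo ∧ hi ≤ ξ' N' ∧
        Represents ξ' q c' lo hi s ∧
        ∀ k σ, Alternates c' (Set.Ici b) k σ → Alternates c (Set.Ici b) k σ := by
  induction m with
  | zero =>
    intro ξ c N h1 h2 h3 h4 h5 h6
    exact ⟨ξ, c, N, h1, fun _ _ => rfl, fun k h h' => absurd h' (by omega), h3, h4, h5, h6,
      fun _ _ h => h⟩
  | succ m ih =>
    intro ξ c N h1 h2 h3 h4 h5 h6
    obtain ⟨ξ', c', N', g1, g2, g3, g4, g5, g6, g7, g8⟩ := ih h1 h2 h3 h4 h5 h6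
    have hle : ξ' (j + m) ≤ x := by
      rcases Nat.eq_zero_or_pos m with rfl | hm
      · rw [add_zero, g2 j le_rfl]; exact h2
      · exact (g3 _ (by omega) le_rfl).le
    have hmono := monotone_insertKnot g1 hle g4.le
    refine ⟨insertKnot ξ' (j + m) x, insertCoeff ξ' q (j + m) x c', N' + 1, hmono,
      fun k hk => ?_, fun k hk hk' => ?_, ?_, ?_, ?_,
      g7.insert g1 hle g4.le (by omega) g5 g6, fun k σ h => g8 k σ ?_⟩
    · rw [insertKnot_of_le (by omega), g2 k hk]
    · rcases hk'.eq_or_lt with rfl | h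
      · exact insertKnot_self _ _ _
      · rw [insertKnot_of_le (by omega), g3 k hk (by omega)]
    · rw [show j + (m + 1) + 1 = (j + m + 1) + 1 by omega, insertKnot_of_lt (by omega)]
      exact g4
    · rwa [insertKnot_of_le (by omega)]
    · rcases Nat.lt_or_ge (j + m) N' with h | h
      · rwa [insertKnot_of_lt h]
      · exact (g6.trans (insertKnot_of_le h).ge).trans (hmono (Nat.le_succ _))
    · refine Alternates.of_convex (insertWeight_mem g1 hle g4.le) ?_ h
      rw [insertWeight, if_pos (by omega)]

/-- Variation diminution: alternations of a spline come from alternations of its coefficients. -/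
theorem Represents.alternates {q : ℕ} {hi : ℝ} {s : ℝ → ℝ} (k : ℕ) :
    ∀ {ξ c : ℕ → ℝ} {b N : ℕ} {lo σ : ℝ}, Monotone ξ → ξ (b + q) ≤ lo → hi ≤ ξ N →
      Represents ξ q c lo hi s → Alternates s (Set.Ico lo hi) k σ →
      Alternates c (Set.Ici b) k σ := by
  induction k with
  | zero =>
    intro ξ c b N lo σ h1 h2 h3 h4 h5
    obtain ⟨u, hu, -, hf⟩ := h5
    have hu0 := hu 0 le_rfl
    obtain ⟨b', hb1, hb2⟩ := exists_element ((h1 (by omega : q ≤ b + q)).trans (h2.trans hu0.1))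
      (hu0.2.trans_le h3) h1
    have hbb : b ≤ b' := by
      by_contra hc
      exact absurd ((h1 (by omega : b' + q + 1 ≤ b + q)).trans (h2.trans hu0.1)) (not_le.2 hb2)
    -- After the point `u 0` has been inserted `q` times, the value `s (u 0)` is itself a
    -- coefficient, with index `b' + q`.
    obtain ⟨ξ', c', N', g1, g2, g3, g4, g5, g6, g7, g8⟩ :=
      h4.exists_insert (b := b) (j := b' + q) (by omega) q h1 hb1 hb2
        ((h1 (by omega : q ≤ b + q)).trans h2) h3
    have hle : ξ' (b' + q + q) ≤ u 0 := by
      rcases Nat.eq_zero_or_pos q with rfl | hq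
      · rw [add_zero, g2 _ le_rfl]; exact hb1
      · exact (g3 _ (by omega) le_rfl).le
    have hs := g7 (b' + q) (u 0) hu0.1 hu0.2 hle g4
    rw [activeSum_eq_coeff g1 (fun k hk hk' => g3 k (by omega) hk') hle g4] at hs
    refine g8 0 σ ⟨fun _ => b' + q, fun _ _ => by simp; omega, by simp, fun l hl => ?_⟩
    rw [hs, Nat.le_zero.1 hl]
    exact hf 0 le_rfl
  | succ k ih =>
    intro ξ c b N lo σ h1 h2 h3 h4 h5
    obtain ⟨u, hu, hlt, hf⟩ := h5
    have hu0 := hu 0 (Nat.zero_le _)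
    obtain ⟨b', hb1, hb2⟩ := exists_element ((h1 (by omega : q ≤ b + q)).trans (h2.trans hu0.1))
      (hu0.2.trans_le h3) h1
    have hbb : b ≤ b' := by
      by_contra hc
      exact absurd ((h1 (by omega : b' + q + 1 ≤ b + q)).trans (h2.trans hu0.1)) (not_le.2 hb2)
    obtain ⟨ξ', c', N', g1, g2, g3, g4, g5, g6, g7, g8⟩ :=
      h4.exists_insert (b := b) (j := b' + q) (by omega) q h1 hb1 hb2
        ((h1 (by omega : q ≤ b + q)).trans h2) h3
    have hle : ξ' (b' + q + q) ≤ u 0 := by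
      rcases Nat.eq_zero_or_pos q with rfl | hq
      · rw [add_zero, g2 _ le_rfl]; exact hb1
      · exact (g3 _ (by omega) le_rfl).le
    have hs := g7 (b' + q) (u 0) hu0.1 hu0.2 hle g4
    rw [activeSum_eq_coeff g1 (fun k hk hk' => g3 k (by omega) hk') hle g4] at hs
    have hmono : ∀ l ≤ k + 1, u 0 ≤ u l := by
      intro l
      induction l with
      | zero => exact fun _ => le_rfl
      | succ l ihl => exact fun h => (ihl (by omega)).trans (hlt l (by omega)).le
    -- On the right of `u 0` only coefficients with index at least `b' + q` are active. The
    -- remaining alternation starts there with the opposite sign.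
    obtain ⟨v, hv, hvlt, hvf⟩ := ih (ξ := ξ') (c := c') (b := b' + q) (N := N') (lo := u 0)
      (σ := -σ) g1 hle g6 (fun b t ht => g7 b t (hu0.1.trans ht))
      ⟨fun l => u (l + 1), fun l hl => ⟨hmono _ (by omega), (hu (l + 1) (by omega)).2⟩,
        fun l hl => hlt (l + 1) (by omega), fun l hl => by
          have := hf (l + 1) (by omega)
          rw [pow_succ] at this
          linarith⟩
    have hf0 := hf 0 (Nat.zero_le _)
    rw [pow_zero, mul_one, ← hs] at hf0
    have hv0 := hvf 0 (Nat.zero_le _)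
    -- The coefficient `s (u 0)` is put in front of the alternation. Its index cannot be `v 0` since
    -- the signs differ. Finally `g8` carries the alternation back to the coefficients before the
    -- insertions.
    refine g8 (k + 1) σ (alternates_cons (x := b' + q) (u := v) (by simp; omega) hf0
      (lt_of_le_of_ne (hv 0 (Nat.zero_le _)) fun heq => ?_)
      (fun l hl => (show b ≤ b' + q by omega).trans (hv l hl)) hvlt hvf)
    rw [← heq, pow_zero, mul_one] at hv0
    linarith

/-- A spline with at most `q + 1` nonzero coefficients has the sign of a polynomial of degree at
most `q` with real roots. -/
theorem Represents.exists_roots {ξ c : ℕ → ℝ} {q N : ℕ} {hi : ℝ} {s : ℝ → ℝ} (hξ : Monotone ξ)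
    (hhi : hi ≤ ξ N) (hs : Represents ξ q c (ξ q) hi s) {T : Finset ℕ}
    (hc : ∀ i ∉ T, c i = 0) (hT : T.card ≤ q + 1) {A B : ℝ} (hA : ξ q ≤ A) (hB : B ≤ hi) :
    ∃ (σ : ℝ) (L : List ℝ), |σ| = 1 ∧ L.length ≤ q ∧ (∀ τ ∈ L, A ≤ τ ∧ τ ≤ B) ∧
      ∀ t ∈ Set.Ioo A B, 0 ≤ σ * s t * (L.map fun τ => τ - t).prod := by
  have hno : ∀ σ, ¬ Alternates s (Set.Ioo A B) (q + 1) σ := by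
    rintro σ ⟨u, hu, hlt, hf⟩
    refine not_alternates_of_card_le hc hT σ (Represents.alternates (b := 0) (q + 1) hξ
      (by rw [zero_add]) hhi hs ⟨u, fun l hl => ?_, hlt, hf⟩)
    exact ⟨hA.trans (hu l hl).1.le, (hu l hl).2.trans_le hB⟩
  obtain ⟨σ, hσ, h⟩ := exists_not_alternates_neg (hno 1) (hno (-1))
  obtain ⟨L, hL⟩ := exists_roots_of_not_alternates q h
  exact ⟨σ, L, hσ, hL⟩

/-! ### Primitives of integrable functions and weak derivatives -/


/-- Lebesgue measure on `(0, 1)`. -/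
abbrev unitMeasure : Measure ℝ := volume.restrict (Ioo (0 : ℝ) 1)

lemma intervalIntegral_eq_unitMeasure (f : ℝ → ℝ) :
    ∫ t in (0 : ℝ)..1, f t = ∫ t, f t ∂unitMeasure := by
  rw [intervalIntegral.integral_of_le zero_le_one, integral_Ioc_eq_integral_Ioo]

lemma intervalIntegrable_of_unitMeasure {f : ℝ → ℝ} (hf : Integrable f unitMeasure) {s t : ℝ}
    (hs : s ∈ Icc (0 : ℝ) 1) (ht : t ∈ Icc (0 : ℝ) 1) : IntervalIntegrable f volume s t := by
  have h : IntervalIntegrable f volume 0 1 :=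
    (intervalIntegrable_iff_integrableOn_Ioo_of_le zero_le_one).2 hf
  refine h.mono_set ?_
  rw [uIcc_of_le zero_le_one]
  exact ordConnected_Icc.uIcc_subset hs ht

lemma uIoc_subset_Ioo {s t : ℝ} (hs : s ∈ Ioo (0 : ℝ) 1) (ht : t ∈ Ioo (0 : ℝ) 1) :
    uIoc s t ⊆ Ioo (0 : ℝ) 1 :=
  uIoc_subset_uIcc.trans (ordConnected_Ioo.uIcc_subset hs ht)

/-- `v` is integrable on `(0, 1)` and `u` is a primitive of `v`. -/
structure IsPrimitive (u v : ℝ → ℝ) : Prop where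
  integrable : Integrable v unitMeasure
  eq : ∀ s ∈ Ioo (0 : ℝ) 1, ∀ t ∈ Ioo (0 : ℝ) 1, u t - u s = ∫ x in s..t, v x

lemma half_mem : (1 / 2 : ℝ) ∈ Ioo (0 : ℝ) 1 := by norm_num

namespace IsPrimitive

variable {u v c d : ℝ → ℝ}

lemma congr_right (h : IsPrimitive u v) (hvd : v =ᵐ[unitMeasure] d) : IsPrimitive u d where
  integrable := h.integrable.congr hvd
  eq s hs t ht := by
    rw [h.eq s hs t ht]
    refine intervalIntegral.integral_congr_ae ?_
    filter_upwards [(ae_restrict_iff' measurableSet_Ioo).1 hvd] with x hx hxs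
    exact hx (uIoc_subset_Ioo hs ht hxs)

lemma continuousOn (h : IsPrimitive u v) : ContinuousOn u (Ioo 0 1) := by
  have h1 := intervalIntegral.continuousOn_primitive_interval' (a := 1 / 2)
    (intervalIntegrable_of_unitMeasure h.integrable (left_mem_Icc.2 zero_le_one)
      (right_mem_Icc.2 zero_le_one)) (by rw [uIcc_of_le zero_le_one]; exact Ioo_subset_Icc_self half_mem)
  rw [uIcc_of_le zero_le_one] at h1
  refine ((h1.mono Ioo_subset_Icc_self).add (continuousOn_const (c := u (1 / 2)))).congr
    fun t ht => ?_
  have := h.eq _ half_mem t ht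
  simp only [Pi.add_apply]
  linarith

lemma aestronglyMeasurable (h : IsPrimitive u v) : AEStronglyMeasurable u unitMeasure :=
  h.continuousOn.aestronglyMeasurable measurableSet_Ioo

lemma abs_sub_le (h : IsPrimitive u v) {s t : ℝ} (hs : s ∈ Ioo (0 : ℝ) 1)
    (ht : t ∈ Ioo (0 : ℝ) 1) : |u t - u s| ≤ ∫ x, |v x| ∂unitMeasure := by
  rw [h.eq s hs t ht]
  refine (intervalIntegral.norm_integral_le_integral_norm_uIoc (f := v) (μ := volume)).trans ?_
  exact setIntegral_mono_set h.integrable.norm (Filter.Eventually.of_forall fun x => norm_nonneg _)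
    (uIoc_subset_Ioo hs ht).eventuallyLE

lemma exists_bound (h : IsPrimitive u v) : ∃ C, ∀ t ∈ Ioo (0 : ℝ) 1, |u t| ≤ C := by
  refine ⟨|u (1 / 2)| + ∫ x, |v x| ∂unitMeasure, fun t ht => ?_⟩
  have := h.abs_sub_le half_mem ht
  have h2 := abs_add_le (u (1 / 2)) (u t - u (1 / 2))
  rw [add_sub_cancel] at h2
  linarith

lemma integrable_mul (h : IsPrimitive u v) (hd : Integrable d unitMeasure) :
    Integrable (fun t => u t * d t) unitMeasure := by
  obtain ⟨C, hC⟩ := h.exists_bound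
  exact hd.bdd_mul (c := C) h.aestronglyMeasurable
    ((ae_restrict_iff' measurableSet_Ioo).2 (Filter.Eventually.of_forall hC))

lemma exists_absolutelyContinuous (h : IsPrimitive u v) {s t : ℝ} (hs : s ∈ Ioo (0 : ℝ) 1)
    (ht : t ∈ Ioo (0 : ℝ) 1) :
    ∃ U : ℝ → ℝ, AbsolutelyContinuousOnInterval U s t ∧ (∀ x ∈ uIcc s t, U x = u x) ∧
      ∀ᵐ x, x ∈ uIoc s t → deriv U x = v x := by
  have hint : IntervalIntegrable v volume s t :=
    intervalIntegrable_of_unitMeasure h.integrable (Ioo_subset_Icc_self hs) (Ioo_subset_Icc_self ht)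
  have hc : AbsolutelyContinuousOnInterval (fun _ => u s) s t :=
    ((LipschitzWith.const (u s)).lipschitzOnWith (s := uIcc s t)).absolutelyContinuousOnInterval
  refine ⟨fun x => u s + ∫ y in s..x, v y,
    hc.add (hint.absolutelyContinuousOnInterval_intervalIntegral left_mem_uIcc), fun x hx => ?_, ?_⟩
  · have := h.eq s hs x (ordConnected_Ioo.uIcc_subset hs ht hx)
    linarith
  · filter_upwards [hint.ae_hasDerivAt_integral] with x hx hxs
    exact ((hx (uIoc_subset_uIcc hxs) s left_mem_uIcc).const_add (u s)).deriv

/-- On compact subintervals of `(0, 1)` primitives are absolutely continuous, so integration by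
parts holds. -/
lemma mul (hc : IsPrimitive c d) (hu : IsPrimitive u v) :
    IsPrimitive (fun t => c t * u t) (fun t => d t * u t + c t * v t) where
  integrable := by
    refine Integrable.add ?_ (hc.integrable_mul hu.integrable)
    exact (hu.integrable_mul hc.integrable).congr
      (Filter.Eventually.of_forall fun t => mul_comm _ _)
  eq s hs t ht := by
    obtain ⟨C, hC, hCc, hCd⟩ := hc.exists_absolutelyContinuous hs ht
    obtain ⟨U, hU, hUu, hUv⟩ := hu.exists_absolutelyContinuous hs ht
    have := hC.integral_deriv_mul_eq_sub hU
    rw [hCc t right_mem_uIcc, hCc s left_mem_uIcc, hUu t right_mem_uIcc, hUu s left_mem_uIcc] at this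
    rw [← this]
    refine intervalIntegral.integral_congr_ae ?_
    filter_upwards [hCd, hUv] with x h1 h2 hx
    rw [h1 hx, h2 hx, hCc x (uIoc_subset_uIcc hx), hUu x (uIoc_subset_uIcc hx)]

end IsPrimitive

lemma exists_tsupport_subset_Icc {K : Set ℝ} (hK : IsCompact K) (hK1 : K ⊆ Ioo 0 1) :
    ∃ α β : ℝ, 0 < α ∧ α ≤ β ∧ β < 1 ∧ K ⊆ Icc α β := by
  -- The point `1 / 2` is added because `K` may be empty.
  have hK' : IsCompact (insert (1 / 2) K) := hK.insert _
  have hsub : insert (1 / 2) K ⊆ Ioo (0 : ℝ) 1 := insert_subset half_mem hK1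
  obtain ⟨α, hα, hαm⟩ := hK'.exists_isLeast ⟨_, mem_insert _ _⟩
  obtain ⟨β, hβ, hβm⟩ := hK'.exists_isGreatest ⟨_, mem_insert _ _⟩
  exact ⟨α, β, (hsub hα).1, hαm hβ, (hsub hβ).2,
    fun x hx => ⟨hαm (mem_insert_of_mem _ hx), hβm (mem_insert_of_mem _ hx)⟩⟩

/-- A test function with vanishing integral is the derivative of a test function. -/
lemma exists_test_primitive {ψ : ℝ → ℝ} (hψ : ContDiff ℝ ∞ ψ) (hc : HasCompactSupport ψ)
    (hs : tsupport ψ ⊆ Ioo 0 1) (h0 : ∫ t in (0 : ℝ)..1, ψ t = 0) :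
    ∃ φ : ℝ → ℝ, ContDiff ℝ ∞ φ ∧ HasCompactSupport φ ∧ tsupport φ ⊆ Ioo 0 1 ∧ deriv φ = ψ := by
  obtain ⟨α, β, hα, hαβ, hβ, hK⟩ := exists_tsupport_subset_Icc hc hs
  have hz : ∀ t, t ∉ Icc α β → ψ t = 0 := fun t ht => by
    by_contra hne
    exact ht (hK (subset_tsupport _ hne))
  have hcont := hψ.continuous
  set φ : ℝ → ℝ := fun t => ∫ x in (0 : ℝ)..t, ψ x with hφ
  have hd : ∀ t, HasDerivAt φ (ψ t) t := fun t =>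
    (hcont.integral_hasStrictDerivAt 0 t).hasDerivAt
  have hderiv : deriv φ = ψ := funext fun t => (hd t).deriv
  have hint : ∀ a b, IntervalIntegrable ψ volume a b := fun a b => hcont.intervalIntegrable a b
  have hφ0 : ∀ t, t ∉ Icc α β → φ t = 0 := by
    intro t ht
    rcases lt_or_ge t α with h | h
    · simp only [hφ]
      rw [intervalIntegral.integral_congr (g := fun _ => 0) fun x hx => hz x fun hx' => ?_]
      · simp
      · have : x ≤ max 0 t := hx.2
        exact absurd (hx'.1.trans this) (not_le.2 (max_lt hα h))
    · have hbt : β < t := by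
        by_contra hle
        exact ht ⟨h, not_lt.1 hle⟩
      simp only [hφ]
      rw [← intervalIntegral.integral_add_adjacent_intervals (hint 0 1) (hint 1 t), h0, zero_add,
        intervalIntegral.integral_congr (g := fun _ => 0) fun x hx => hz x fun hx' => ?_]
      · simp
      · have : min 1 t ≤ x := hx.1
        exact absurd (this.trans hx'.2) (not_le.2 (lt_min hβ hbt))
  have hts : tsupport φ ⊆ Icc α β := closure_minimal (fun t ht => by
    by_contra hn
    exact ht (hφ0 t hn)) isClosed_Icc
  refine ⟨φ, ?_, HasCompactSupport.of_support_subset_isCompact isCompact_Icc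
    ((subset_tsupport _).trans hts), hts.trans fun t ht => ⟨hα.trans_le ht.1, ht.2.trans_lt hβ⟩,
    hderiv⟩
  rw [contDiff_infty_iff_deriv, hderiv]
  exact ⟨fun t => (hd t).differentiableAt, hψ⟩

/-- The lemma of du Bois-Reymond. -/
lemma ae_eq_const_of_integral_mul_deriv_eq_zero {w : ℝ → ℝ} (hw : Integrable w unitMeasure)
    (h : ∀ φ : ℝ → ℝ, ContDiff ℝ ∞ φ → HasCompactSupport φ → tsupport φ ⊆ Ioo (0 : ℝ) 1 →
      ∫ t in (0 : ℝ)..1, w t * deriv φ t = 0) :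
    ∃ C, ∀ᵐ t ∂unitMeasure, w t = C := by
  let χ₀ : ContDiffBump (1 / 2 : ℝ) := ⟨1 / 8, 1 / 4, by norm_num, by norm_num⟩
  set χ : ℝ → ℝ := χ₀.normed volume with hχ
  have hχc : ContDiff ℝ ∞ χ := χ₀.contDiff_normed
  have hχs : HasCompactSupport χ := χ₀.hasCompactSupport_normed
  have hχt : tsupport χ ⊆ Ioo 0 1 := by
    rw [hχ, χ₀.tsupport_normed_eq, Real.closedBall_eq_Icc]
    intro t ht
    change t ∈ Icc (1 / 2 - 1 / 4 : ℝ) (1 / 2 + 1 / 4) at ht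
    constructor <;> linarith [ht.1, ht.2]
  have key : ∀ {ψ : ℝ → ℝ}, tsupport ψ ⊆ Ioo 0 1 → ∫ t in (0 : ℝ)..1, ψ t = ∫ t, ψ t := by
    intro ψ hψ
    rw [intervalIntegral_eq_unitMeasure]
    exact setIntegral_eq_integral_of_forall_compl_eq_zero fun t ht => by
      by_contra hne
      exact ht (hψ (subset_tsupport _ hne))
  have hχ1 : ∫ t in (0 : ℝ)..1, χ t = 1 := by rw [key hχt]; exact χ₀.integral_normed
  have hwψ : ∀ {ψ : ℝ → ℝ}, Continuous ψ → HasCompactSupport ψ →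
      Integrable (fun t => w t * ψ t) unitMeasure := by
    intro ψ hψ hψc
    obtain ⟨C, hC⟩ := hψc.exists_bound_of_continuous hψ
    exact hw.mul_bdd (c := C) hψ.aestronglyMeasurable (Filter.Eventually.of_forall hC)
  set C := ∫ t in (0 : ℝ)..1, w t * χ t with hCdef
  refine ⟨C, ?_⟩
  have hloc : LocallyIntegrableOn (fun t => w t - C) (Ioo (0 : ℝ) 1) volume :=
    IntegrableOn.locallyIntegrableOn (hw.sub (integrable_const C))
  rw [ae_restrict_iff' measurableSet_Ioo]
  have := isOpen_Ioo.ae_eq_zero_of_integral_contDiff_smul_eq_zero hloc ?_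
  · filter_upwards [this] with t ht htm
    linarith [ht htm]
  intro ψ hψ hψc hψt
  set J := ∫ t in (0 : ℝ)..1, ψ t with hJ
  have e0 : ∫ t, ψ t • (w t - C) = ∫ t in (0 : ℝ)..1, ψ t • (w t - C) := by
    refine (key ?_).symm
    refine (closure_mono fun t ht => ?_).trans hψt
    intro h0
    exact ht (by simp [h0])
  have hsub : tsupport (fun t => ψ t - J * χ t) ⊆ Ioo 0 1 := by
    refine (closure_minimal (t := tsupport ψ ∪ tsupport χ) (fun t ht => ?_)
      ((isClosed_tsupport _).union (isClosed_tsupport _))).trans (union_subset hψt hχt)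
    by_contra hn
    rw [mem_union, not_or] at hn
    exact ht (by simp [image_eq_zero_of_notMem_tsupport hn.1,
      image_eq_zero_of_notMem_tsupport hn.2])
  have hcs : HasCompactSupport (fun t => ψ t - J * χ t) := by
    have := hψc.sub (hχs.mul_left (f := fun _ => J))
    exact this
  -- Subtracting `J` times the normalized bump removes the mean of `ψ`, which makes the difference
  -- the derivative of a test function.
  obtain ⟨φ, h1, h2, h3, h4⟩ := exists_test_primitive (ψ := fun t => ψ t - J * χ t)
    (hψ.sub (contDiff_const.mul hχc)) hcs hsub (by
      rw [intervalIntegral.integral_sub (hψ.continuous.intervalIntegrable _ _)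
        ((hχc.continuous.intervalIntegrable _ _).const_mul J),
        intervalIntegral.integral_const_mul, hχ1, mul_one, hJ, sub_self])
  have h5 := h φ h1 h2 h3
  rw [h4] at h5
  have i1 := hwψ hψ.continuous hψc
  have i2 := hwψ hχc.continuous hχs
  have i3 : Integrable ψ unitMeasure :=
    (hψ.continuous.integrable_of_hasCompactSupport hψc).mono_measure Measure.restrict_le_self
  rw [e0]
  rw [intervalIntegral_eq_unitMeasure] at h5 hJ hCdef ⊢
  have e1 : ∫ t, w t * (ψ t - J * χ t) ∂unitMeasure = (∫ t, w t * ψ t ∂unitMeasure) - J * C := by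
    rw [hCdef, ← integral_const_mul, ← integral_sub i1 (i2.const_mul J)]
    exact integral_congr_ae (Filter.Eventually.of_forall fun t => by simp only; ring)
  have e2 : ∫ t, ψ t • (w t - C) ∂unitMeasure = (∫ t, w t * ψ t ∂unitMeasure) - C * J := by
    rw [hJ, ← integral_const_mul, ← integral_sub i1 (i3.const_mul C)]
    exact integral_congr_ae (Filter.Eventually.of_forall fun t => by simp only [smul_eq_mul]; ring)
  rw [e2, mul_comm C J, ← e1, h5]

/-- A function with an integrable weak derivative is a primitive, up to a null set. -/
lemma exists_isPrimitive_of_weak_deriv {g v : ℝ → ℝ} (hg : Integrable g unitMeasure)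
    (hv : Integrable v unitMeasure)
    (h : ∀ φ : ℝ → ℝ, ContDiff ℝ ∞ φ → HasCompactSupport φ → tsupport φ ⊆ Ioo (0 : ℝ) 1 →
      ∫ t in (0 : ℝ)..1, g t * deriv φ t = -∫ t in (0 : ℝ)..1, v t * φ t) :
    ∃ u, u =ᵐ[unitMeasure] g ∧ IsPrimitive u v := by
  have hint : ∀ {s t : ℝ}, s ∈ Icc (0 : ℝ) 1 → t ∈ Icc (0 : ℝ) 1 → IntervalIntegrable v volume s t :=
    fun hs ht => intervalIntegrable_of_unitMeasure hv hs ht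
  have h0 : (0 : ℝ) ∈ Icc (0 : ℝ) 1 := left_mem_Icc.2 zero_le_one
  have hh1 : (1 : ℝ) ∈ Icc (0 : ℝ) 1 := right_mem_Icc.2 zero_le_one
  set V : ℝ → ℝ := fun t => ∫ x in (0 : ℝ)..t, v x with hV
  have hprim : IsPrimitive V v := ⟨hv, fun s hs t ht =>
    intervalIntegral.integral_interval_sub_left (hint h0 (Ioo_subset_Icc_self ht))
      (hint h0 (Ioo_subset_Icc_self hs))⟩
  have hVi : Integrable V unitMeasure := by
    simpa using hprim.integrable_mul (integrable_const 1)
  have hVac : AbsolutelyContinuousOnInterval V 0 1 :=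
    (hint h0 hh1).absolutelyContinuousOnInterval_intervalIntegral left_mem_uIcc
  -- The primitive `V` has the weak derivative `v`, so `g - V` has weak derivative zero and is
  -- constant almost everywhere.
  obtain ⟨C, hC⟩ := ae_eq_const_of_integral_mul_deriv_eq_zero (hg.sub hVi) fun φ h1 h2 h3 => by
    have hd : Continuous (deriv φ) := (contDiff_infty_iff_deriv.1 h1).2.continuous
    have hz : ∀ t, t ∉ Ioo (0 : ℝ) 1 → φ t = 0 := fun t ht => by
      by_contra hne
      exact ht (h3 (subset_tsupport _ hne))
    have hφac : AbsolutelyContinuousOnInterval φ 0 1 :=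
      ContDiffOn.absolutelyContinuousOnInterval (h1.of_le (by exact_mod_cast le_top)).contDiffOn
    have e1 := hVac.integral_mul_deriv_eq_deriv_mul hφac
    rw [hz 0 (by simp), hz 1 (by simp)] at e1
    have e2 : ∫ t in (0 : ℝ)..1, deriv V t * φ t = ∫ t in (0 : ℝ)..1, v t * φ t := by
      refine intervalIntegral.integral_congr_ae ?_
      filter_upwards [(hint h0 hh1).ae_hasDerivAt_integral] with x hx hxs
      rw [(hx (uIoc_subset_uIcc hxs) 0 left_mem_uIcc).deriv]
    obtain ⟨D, hD⟩ := h2.deriv.exists_bound_of_continuous hd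
    have i1 : ∀ {f : ℝ → ℝ}, Integrable f unitMeasure →
        IntervalIntegrable (fun t => f t * deriv φ t) volume 0 1 := fun hf =>
      intervalIntegrable_of_unitMeasure
        (hf.mul_bdd (c := D) hd.aestronglyMeasurable (Filter.Eventually.of_forall hD)) h0 hh1
    simp only [Pi.sub_apply, sub_mul]
    rw [intervalIntegral.integral_sub (i1 hg) (i1 hVi), h φ h1 h2 h3, e1, e2]
    ring
  refine ⟨fun t => V t + C, ?_, hv, fun s hs t ht => ?_⟩
  · filter_upwards [hC] with t ht
    simp only [Pi.sub_apply] at ht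
    linarith
  · rw [← hprim.eq s hs t ht]
    ring

/-! ### Functions with bounded, piecewise continuous derivatives -/

/-- `c` has `m` successive derivatives on `(0, 1)` off the exceptional set `s`; all are bounded and
all but the last are continuous. -/
def BddSmooth (s : Set ℝ) : ℕ → (ℝ → ℝ) → Prop
  | 0, c => AEStronglyMeasurable c unitMeasure ∧ ∃ C, ∀ t ∈ Ioo (0 : ℝ) 1 \ s, |c t| ≤ C
  | m + 1, c => ContinuousOn c (Ioo 0 1) ∧ (∃ C, ∀ t ∈ Ioo (0 : ℝ) 1 \ s, |c t| ≤ C) ∧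
      ∃ d, (∀ t ∈ Ioo (0 : ℝ) 1 \ s, HasDerivAt c (d t) t) ∧ BddSmooth s m d

namespace BddSmooth

variable {s : Set ℝ} {m : ℕ} {c d : ℝ → ℝ}

lemma exists_bound (h : BddSmooth s m c) : ∃ C, ∀ t ∈ Ioo (0 : ℝ) 1 \ s, |c t| ≤ C := by
  cases m with
  | zero => exact h.2
  | succ m => exact h.2.1

lemma aestronglyMeasurable (h : BddSmooth s m c) : AEStronglyMeasurable c unitMeasure := by
  cases m with
  | zero => exact h.1
  | succ m => exact h.1.aestronglyMeasurable measurableSet_Ioo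

lemma zero_of (h : BddSmooth s m c) : BddSmooth s 0 c := ⟨h.aestronglyMeasurable, h.exists_bound⟩

lemma of_succ : ∀ {m : ℕ} {c : ℝ → ℝ}, BddSmooth s (m + 1) c → BddSmooth s m c
  | 0, _, h => h.zero_of
  | _ + 1, _, ⟨h1, h2, d, h3, h4⟩ => ⟨h1, h2, d, h3, of_succ h4⟩

lemma of_le {k : ℕ} (h : BddSmooth s m c) (hk : k ≤ m) : BddSmooth s k c := by
  induction m, hk using Nat.le_induction with
  | base => exact h
  | succ m _ ih => exact ih h.of_succ

lemma const (r : ℝ) : ∀ m, BddSmooth s m fun _ => r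
  | 0 => ⟨aestronglyMeasurable_const, |r|, fun _ _ => le_rfl⟩
  | m + 1 => ⟨continuousOn_const, ⟨|r|, fun _ _ => le_rfl⟩, fun _ => 0,
      fun t _ => hasDerivAt_const t r, const 0 m⟩

lemma add : ∀ {m : ℕ} {c d : ℝ → ℝ}, BddSmooth s m c → BddSmooth s m d →
    BddSmooth s m fun t => c t + d t
  | 0, _, _, ⟨h1, C, hC⟩, ⟨h2, D, hD⟩ => ⟨h1.add h2, C + D, fun t ht =>
      (abs_add_le _ _).trans (add_le_add (hC t ht) (hD t ht))⟩
  | _ + 1, _, _, ⟨h1, ⟨C, hC⟩, _, h2, h3⟩, ⟨g1, ⟨D, hD⟩, _, g2, g3⟩ =>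
      ⟨h1.add g1, ⟨C + D, fun t ht => (abs_add_le _ _).trans (add_le_add (hC t ht) (hD t ht))⟩,
        _, fun t ht => (h2 t ht).add (g2 t ht), add h3 g3⟩

lemma mul : ∀ {m : ℕ} {c d : ℝ → ℝ}, BddSmooth s m c → BddSmooth s m d →
    BddSmooth s m fun t => c t * d t
  | 0, c, d, ⟨h1, C, hC⟩, ⟨h2, D, hD⟩ => ⟨h1.mul h2, |C| * |D|, fun t ht => by
      rw [abs_mul]
      exact mul_le_mul ((hC t ht).trans (le_abs_self C)) ((hD t ht).trans (le_abs_self D))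
        (abs_nonneg _) (abs_nonneg _)⟩
  | m + 1, c, d, hc, hd => by
      have hb := (mul hc.zero_of hd.zero_of).2
      have hc₁ := hc.of_succ
      have hd₁ := hd.of_succ
      obtain ⟨h1, -, c', h2, h3⟩ := hc
      obtain ⟨g1, -, d', g2, g3⟩ := hd
      exact ⟨h1.mul g1, hb, _, fun t ht => (h2 t ht).mul (g2 t ht), (mul h3 hd₁).add (mul hc₁ g3)⟩

lemma inv {r : ℝ} (hr : 0 < r) : ∀ {m : ℕ} {c : ℝ → ℝ}, BddSmooth s m c →
    (∀ t ∈ Ioo (0 : ℝ) 1, r ≤ c t) → BddSmooth s m fun t => (c t)⁻¹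
  | 0, c, hc, hrc => ⟨hc.aestronglyMeasurable.aemeasurable.inv.aestronglyMeasurable, r⁻¹,
      fun t ht => by
        rw [abs_inv, abs_of_pos (hr.trans_le (hrc t ht.1))]
        exact inv_anti₀ hr (hrc t ht.1)⟩
  | m + 1, c, hc, hrc => by
      have h0 : ∀ t ∈ Ioo (0 : ℝ) 1, c t ≠ 0 := fun t ht => (hr.trans_le (hrc t ht)).ne'
      have ih := inv hr hc.of_succ hrc
      have hb := (inv hr hc.zero_of hrc).2
      obtain ⟨h1, -, c', h2, h3⟩ := hc
      refine ⟨h1.inv₀ h0, hb, fun t => -1 * (c' t * ((c t)⁻¹ * (c t)⁻¹)),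
        fun t ht => ?_, (const (-1) m).mul (h3.mul (ih.mul ih))⟩
      refine ((h2 t ht).fun_inv (h0 t ht.1)).congr_deriv ?_
      rw [div_eq_mul_inv, sq, mul_inv]
      ring

lemma sqrt {r : ℝ} (hr : 0 < r) : ∀ {m : ℕ} {c : ℝ → ℝ}, BddSmooth s m c →
    (∀ t ∈ Ioo (0 : ℝ) 1, r ≤ c t) → BddSmooth s m fun t => √(c t)
  | 0, c, hc, _ => by
      obtain ⟨C, hC⟩ := hc.exists_bound
      refine ⟨(Real.continuous_sqrt.comp_aestronglyMeasurable hc.aestronglyMeasurable), √C,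
        fun t ht => ?_⟩
      rw [abs_of_nonneg (Real.sqrt_nonneg _)]
      exact Real.sqrt_le_sqrt ((le_abs_self _).trans (hC t ht))
  | m + 1, c, hc, hrc => by
      have h0 : ∀ t ∈ Ioo (0 : ℝ) 1, c t ≠ 0 := fun t ht => (hr.trans_le (hrc t ht)).ne'
      have ih := inv (Real.sqrt_pos.2 hr) (sqrt hr hc.of_succ hrc)
        fun t ht => Real.sqrt_le_sqrt (hrc t ht)
      have hb := (sqrt hr hc.zero_of hrc).2
      obtain ⟨h1, -, c', h2, h3⟩ := hc
      refine ⟨h1.sqrt, hb, fun t => 2⁻¹ * (c' t * (√(c t))⁻¹),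
        fun t ht => ?_, (const 2⁻¹ m).mul (h3.mul ih)⟩
      convert (h2 t ht).sqrt (h0 t ht.1) using 1
      field_simp

lemma ae_bound (hs : s.Countable) (h : BddSmooth s m c) :
    ∃ C, 0 ≤ C ∧ ∀ᵐ t ∂unitMeasure, |c t| ≤ C := by
  obtain ⟨C, hC⟩ := h.exists_bound
  refine ⟨|C|, abs_nonneg C, ?_⟩
  rw [ae_restrict_iff' measurableSet_Ioo]
  filter_upwards [hs.ae_notMem volume] with t ht htm
  exact (hC t ⟨htm, ht⟩).trans (le_abs_self C)

lemma integrable_mul (hs : s.Countable) (h : BddSmooth s m c) {f : ℝ → ℝ}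
    (hf : Integrable f unitMeasure) : Integrable (fun t => c t * f t) unitMeasure := by
  obtain ⟨C, -, hC⟩ := h.ae_bound hs
  exact hf.bdd_mul (c := C) h.aestronglyMeasurable hC

/-- The fundamental theorem of calculus allows a countable exceptional set if the function is
continuous; this is how derivatives with jumps at the knots are admitted. -/
lemma isPrimitive (hs : s.Countable) (hc : ContinuousOn c (Ioo 0 1))
    (hd : ∀ t ∈ Ioo (0 : ℝ) 1 \ s, HasDerivAt c (d t) t) (h : BddSmooth s m d) :
    IsPrimitive c d := by
  have hi : Integrable d unitMeasure := by
    simpa using h.integrable_mul hs (integrable_const 1)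
  refine ⟨hi, fun x hx y hy => (MeasureTheory.integral_eq_of_hasDerivAt_off_countable c d hs
    (hc.mono (ordConnected_Ioo.uIcc_subset hx hy)) (fun t ht => hd t ⟨?_, ht.2⟩)
    (intervalIntegrable_of_unitMeasure hi (Ioo_subset_Icc_self hx) (Ioo_subset_Icc_self hy))).symm⟩
  exact ⟨(lt_min hx.1 hy.1).trans ht.1.1, ht.1.2.trans (max_lt hx.2 hy.2)⟩

end BddSmooth

/-! ### Sobolev functions of one variable -/

/-- `f` has `m` successive derivatives in the sense of primitives, and the square of the last one
has integral at most `M`. -/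
def SobolevBound : ℕ → (ℝ → ℝ) → ℝ → Prop
  | 0, f, M => MemLp f 2 unitMeasure ∧ ∫ t, f t ^ 2 ∂unitMeasure ≤ M
  | m + 1, f, M => ∃ d, IsPrimitive f d ∧ SobolevBound m d M

lemma MemLp.integrable_unit {f : ℝ → ℝ} (hf : MemLp f 2 unitMeasure) : Integrable f unitMeasure :=
  hf.integrable (by norm_num)

lemma IsPrimitive.add {u v u' v' : ℝ → ℝ} (h : IsPrimitive u v) (h' : IsPrimitive u' v') :
    IsPrimitive (fun t => u t + u' t) fun t => v t + v' t where
  integrable := h.integrable.add h'.integrable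
  eq s hs t ht := by
    have hs' := Ioo_subset_Icc_self hs
    have ht' := Ioo_subset_Icc_self ht
    rw [intervalIntegral.integral_add (intervalIntegrable_of_unitMeasure h.integrable hs' ht')
      (intervalIntegrable_of_unitMeasure h'.integrable hs' ht'), ← h.eq s hs t ht,
      ← h'.eq s hs t ht]
    ring

lemma SobolevBound.add : ∀ {m : ℕ} {f g : ℝ → ℝ} {M N : ℝ}, SobolevBound m f M →
    SobolevBound m g N → SobolevBound m (fun t => f t + g t) (2 * (M + N))
  | 0, f, g, M, N, ⟨hf, hM⟩, ⟨hg, hN⟩ => by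
      refine ⟨hf.add hg, ?_⟩
      calc ∫ t, (f t + g t) ^ 2 ∂unitMeasure
          ≤ ∫ t, (2 * f t ^ 2 + 2 * g t ^ 2) ∂unitMeasure :=
            integral_mono (hf.add hg).integrable_sq
              ((hf.integrable_sq.const_mul 2).add (hg.integrable_sq.const_mul 2))
              fun t => by simp only; nlinarith [sq_nonneg (f t - g t)]
        _ = 2 * ∫ t, f t ^ 2 ∂unitMeasure + 2 * ∫ t, g t ^ 2 ∂unitMeasure := by
            rw [integral_add (hf.integrable_sq.const_mul 2) (hg.integrable_sq.const_mul 2),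
              integral_const_mul, integral_const_mul]
        _ ≤ _ := by linarith
  | _ + 1, _, _, _, _, ⟨d, h1, h2⟩, ⟨e, g1, g2⟩ => ⟨_, h1.add g1, SobolevBound.add h2 g2⟩

/-- Products of smooth coefficients with the derivatives in a weighted jet. -/
lemma exists_sobolevBound_mul {s : Set ℝ} (hs : s.Countable) {p : ℕ} {a : ℝ → ℝ}
    (ha : BddSmooth s p a) (m : ℕ) : m ≤ p + 1 → ∀ {c : ℝ → ℝ}, BddSmooth s m c →
      ∃ C : ℝ, 0 ≤ C ∧ ∀ (g : ℕ → ℝ → ℝ) (N : ℝ),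
        (∀ k ≤ p, IsPrimitive (g k) fun t => g (k + 1) t * a t) →
        (∀ k ≤ p + 1, MemLp (g k) 2 unitMeasure ∧ ∫ t, g k t ^ 2 ∂unitMeasure ≤ N) →
        ∀ l, l + m ≤ p + 1 → SobolevBound m (fun t => c t * g l t) (C * N) := by
  induction m with
  | zero =>
    intro _ c hc
    obtain ⟨C, hC0, hC⟩ := hc.ae_bound hs
    refine ⟨C ^ 2, sq_nonneg C, fun g N _ hg l hl => ?_⟩
    obtain ⟨h1, h2⟩ := hg l hl
    have h3 : MemLp (fun t => c t * g l t) 2 unitMeasure :=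
      h1.of_le_mul (c := C) (hc.aestronglyMeasurable.mul h1.aestronglyMeasurable)
        (hC.mono fun t ht => by
          rw [norm_mul]
          exact mul_le_mul_of_nonneg_right ht (norm_nonneg _))
    refine ⟨h3, ?_⟩
    calc ∫ t, (c t * g l t) ^ 2 ∂unitMeasure ≤ ∫ t, C ^ 2 * g l t ^ 2 ∂unitMeasure := by
          refine integral_mono_ae h3.integrable_sq (h1.integrable_sq.const_mul _)
            (hC.mono fun t ht => ?_)
          simp only
          rw [mul_pow]
          exact mul_le_mul_of_nonneg_right (sq_le_sq' (abs_le.1 ht).1 (abs_le.1 ht).2)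
            (sq_nonneg _)
      _ = C ^ 2 * ∫ t, g l t ^ 2 ∂unitMeasure := integral_const_mul _ _
      _ ≤ C ^ 2 * N := mul_le_mul_of_nonneg_left h2 (sq_nonneg C)
  | succ m ih =>
    intro hm c hc
    have hcm := hc.of_succ
    obtain ⟨h1, -, d, h2, h3⟩ := hc
    obtain ⟨C, hC0, hC⟩ := ih (by omega) h3
    obtain ⟨D, hD0, hD⟩ := ih (by omega) (hcm.mul (ha.of_le (show m ≤ p by omega)))
    refine ⟨2 * (C + D), by positivity, fun g N hg hgN l hl => ?_⟩
    -- Product rule: `(c g_l)' = c' g_l + (c a) g_{l+1}`. Both new coefficients have order `m`; here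
    -- `m ≤ p`, so order `p` of `a` is enough.
    refine ⟨_, (BddSmooth.isPrimitive hs h1 h2 h3).mul (hg l (by omega)), ?_⟩
    have := (hC g N hg hgN l (by omega)).add (hD g N hg hgN (l + 1) (by omega))
    convert this using 1
    · funext t
      ring
    · ring

lemma exists_polynomial_derivative (P : Polynomial ℝ) {m : ℕ} (hP : P.natDegree ≤ m) :
    ∃ Q : Polynomial ℝ, Q.natDegree ≤ m + 1 ∧ Polynomial.derivative Q = P := by
  refine ⟨P.sum fun n a => Polynomial.monomial (n + 1) (a / (n + 1)), ?_, ?_⟩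
  · refine Polynomial.natDegree_sum_le_of_forall_le _ _ fun n hn => ?_
    exact (Polynomial.natDegree_monomial_le _).trans
      (Nat.succ_le_succ ((Polynomial.le_natDegree_of_mem_supp n hn).trans hP))
  · rw [Polynomial.sum_def, Polynomial.derivative_sum]
    conv_rhs => rw [P.as_sum_support]
    refine Finset.sum_congr rfl fun n _ => ?_
    rw [Polynomial.derivative_monomial]
    congr 1
    push_cast
    have : (n : ℝ) + 1 ≠ 0 := by positivity
    field_simp

/-- Taylor approximation on subintervals. -/
lemma SobolevBound.exists_polynomial : ∀ {m : ℕ} {f : ℝ → ℝ} {M : ℝ}, SobolevBound (m + 1) f M →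
    ∃ v : ℝ → ℝ, MemLp v 2 unitMeasure ∧ ∫ t, v t ^ 2 ∂unitMeasure ≤ M ∧
      ∀ A B : ℝ, 0 ≤ A → A < B → B ≤ 1 → ∃ P : Polynomial ℝ, P.natDegree ≤ m ∧
        ∀ t ∈ Ioo A B, |f t - P.eval t| ≤ (B - A) ^ m * ∫ x in A..B, |v x|
  | 0, f, M, ⟨v, hv, hv2, hvM⟩ => by
      refine ⟨v, hv2, hvM, fun A B hA hAB hB => ⟨Polynomial.C (f ((A + B) / 2)), by simp,
        fun t ht => ?_⟩⟩
      have hmid : (A + B) / 2 ∈ Ioo A B := ⟨by linarith, by linarith⟩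
      have hsub : Ioo A B ⊆ Ioo 0 1 := Ioo_subset_Ioo hA hB
      rw [Polynomial.eval_C, hv.eq _ (hsub hmid) _ (hsub ht), pow_zero, one_mul,
        intervalIntegral.integral_of_le hAB.le]
      refine (intervalIntegral.norm_integral_le_integral_norm_uIoc (f := v) (μ := volume)).trans ?_
      refine setIntegral_mono_set ?_ (Filter.Eventually.of_forall fun x => norm_nonneg _)
        (LE.le.eventuallyLE ?_)
      · exact ((intervalIntegrable_of_unitMeasure hv.integrable ⟨hA, by linarith⟩
          ⟨by linarith, hB⟩).norm).1
      · exact uIoc_subset_uIcc.trans ((ordConnected_Ioo.uIcc_subset hmid ht).trans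
          Ioo_subset_Ioc_self)
  | m + 1, f, M, ⟨d, hd, hdM⟩ => by
      obtain ⟨v, hv, hvM, hP⟩ := hdM.exists_polynomial
      refine ⟨v, hv, hvM, fun A B hA hAB hB => ?_⟩
      obtain ⟨P, hPm, hPd⟩ := hP A B hA hAB hB
      obtain ⟨Q, hQm, rfl⟩ := exists_polynomial_derivative P hPm
      have hmid : (A + B) / 2 ∈ Ioo A B := ⟨by linarith, by linarith⟩
      have hsub : Ioo A B ⊆ Ioo 0 1 := Ioo_subset_Ioo hA hB
      set x₀ := (A + B) / 2 with hx₀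
      -- The constant makes the error vanish at the midpoint. Integrating the error of the
      -- derivative from there costs one factor `B - A`.
      refine ⟨Q + Polynomial.C (f x₀ - Q.eval x₀), ?_, fun t ht => ?_⟩
      · exact (Polynomial.natDegree_add_le _ _).trans (max_le hQm (by simp))
      have e1 : ∫ x in x₀..t, Q.derivative.eval x = Q.eval t - Q.eval x₀ :=
        intervalIntegral.integral_eq_sub_of_hasDerivAt (fun x _ => Q.hasDerivAt x)
          (Q.derivative.continuous.intervalIntegrable _ _)
      have e2 : f t - (Q + Polynomial.C (f x₀ - Q.eval x₀)).eval t =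
          ∫ x in x₀..t, (d x - Q.derivative.eval x) := by
        rw [intervalIntegral.integral_sub (intervalIntegrable_of_unitMeasure hd.integrable
          (Ioo_subset_Icc_self (hsub hmid)) (Ioo_subset_Icc_self (hsub ht)))
          (Q.derivative.continuous.intervalIntegrable _ _), e1, ← hd.eq _ (hsub hmid) _ (hsub ht)]
        simp only [Polynomial.eval_add, Polynomial.eval_C]
        ring
      rw [e2]
      have h1 := intervalIntegral.norm_integral_le_of_norm_le_const (a := x₀) (b := t)
        (f := fun x => d x - Q.derivative.eval x) fun x hx =>
          hPd x (ordConnected_Ioo.uIcc_subset hmid ht (uIoc_subset_uIcc hx))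
      refine h1.trans ?_
      have h2 : |t - x₀| ≤ B - A := by
        rw [abs_le]
        constructor <;> linarith [ht.1, ht.2, hmid.1, hmid.2]
      have h3 : 0 ≤ ∫ x in A..B, |v x| :=
        intervalIntegral.integral_nonneg hAB.le fun _ _ => abs_nonneg _
      have h4 : 0 ≤ B - A := by linarith
      calc _ ≤ ((B - A) ^ m * ∫ x in A..B, |v x|) * (B - A) := by gcongr
        _ = _ := by ring

/-- Local polynomial approximation of Sobolev functions with respect to `ds = a dt`. -/
theorem exists_polynomial_approx {s : Set ℝ} (hs : s.Countable) {p : ℕ} {a : ℝ → ℝ}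
    (ha : BddSmooth s p a) {a₀ : ℝ} (ha₀ : 0 < a₀) (hlb : ∀ᵐ t ∂unitMeasure, a₀ ≤ a t) :
    ∃ C : ℝ, 0 ≤ C ∧ ∀ f : ℝ → ℝ, MemSobolev a (p + 1) f → MemLp f 2 unitMeasure ∧
      ∃ v : ℝ → ℝ, MemLp v 2 unitMeasure ∧
        ∫ t, v t ^ 2 ∂unitMeasure ≤ C * sobolevNorm a (p + 1) f ^ 2 ∧
        ∀ A B : ℝ, 0 ≤ A → A < B → B ≤ 1 → ∃ P : Polynomial ℝ, P.natDegree ≤ p ∧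
          ∀ᵐ t, t ∈ Ioo A B → |f t - P.eval t| ≤ (B - A) ^ p * ∫ x in A..B, |v x| := by
  -- With the coefficient `1` and `l = 0` this concerns the function itself, with its full `p + 1`
  -- derivatives.
  obtain ⟨C, hC0, hC⟩ := exists_sobolevBound_mul hs ha (p + 1) le_rfl (BddSmooth.const 1 (p + 1))
  refine ⟨C * a₀⁻¹, by positivity, fun f hf => ?_⟩
  -- The jet has to be the one selected in the definition of `sobolevNorm`.
  obtain ⟨g, hg, hnorm⟩ : ∃ g, IsWeakJet a (p + 1) f g ∧ sobolevNorm a (p + 1) f ^ 2 =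
      ∑ k ∈ Finset.range (p + 1 + 1), ∫ t in (0 : ℝ)..1, (g k t) ^ 2 * a t := by
    refine ⟨hf.choose, hf.choose_spec, ?_⟩
    rw [sobolevNorm, dif_pos hf, Real.sq_sqrt]
    refine Finset.sum_nonneg fun k _ => ?_
    rw [intervalIntegral_eq_unitMeasure]
    exact integral_nonneg_of_ae (hlb.mono fun t ht =>
      mul_nonneg (sq_nonneg _) (ha₀.le.trans ht))
  have hga : ∀ k ≤ p + 1, Integrable (fun t => g k t * a t) unitMeasure := fun k hk => by
    simpa only [mul_comm] using ha.integrable_mul hs (MemLp.integrable_unit (hg.memLp k hk))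
  have hg2a : ∀ k ≤ p + 1, Integrable (fun t => g k t ^ 2 * a t) unitMeasure := fun k hk => by
    simpa only [mul_comm] using ha.integrable_mul hs (hg.memLp k hk).integrable_sq
  -- Each derivative of order at most `p` is replaced by its continuous representative; the one of
  -- order `p + 1` stays as it is.
  have hex : ∀ k, ∃ u, (k ≤ p → u =ᵐ[unitMeasure] g k ∧ IsPrimitive u fun t => g (k + 1) t * a t) ∧
      (k = p + 1 → u = g k) := by
    intro k
    rcases le_or_gt k p with hk | hk
    · obtain ⟨u, h1, h2⟩ := exists_isPrimitive_of_weak_deriv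
        (MemLp.integrable_unit (hg.memLp k (by omega))) (hga (k + 1) (by omega))
        fun φ h1 h2 h3 => by
          rw [hg.succ k (by omega) φ h1 h2 h3]
          congr 1
          exact intervalIntegral.integral_congr fun t _ => by ring
      exact ⟨u, fun _ => ⟨h1, h2⟩, fun h => by omega⟩
    · exact ⟨g k, fun h => by omega, fun _ => rfl⟩
  choose u hu hu' using hex
  have huae : ∀ k ≤ p + 1, u k =ᵐ[unitMeasure] g k := fun k hk => by
    rcases hk.lt_or_eq with h | h
    · exact (hu k (by omega)).1
    · rw [hu' k h]
  have hprim : ∀ k ≤ p, IsPrimitive (u k) fun t => u (k + 1) t * a t := fun k hk =>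
    (hu k hk).2.congr_right ((huae (k + 1) (by omega)).mono fun t ht => by simp only [ht])
  have hbound : ∀ k ≤ p + 1, MemLp (u k) 2 unitMeasure ∧
      ∫ t, u k t ^ 2 ∂unitMeasure ≤ a₀⁻¹ * sobolevNorm a (p + 1) f ^ 2 := fun k hk => by
    refine ⟨(hg.memLp k hk).ae_eq (huae k hk).symm, ?_⟩
    have h1 : ∫ t, u k t ^ 2 ∂unitMeasure = ∫ t, g k t ^ 2 ∂unitMeasure :=
      integral_congr_ae ((huae k hk).mono fun t ht => by simp only [ht])
    have h2 : a₀ * ∫ t, g k t ^ 2 ∂unitMeasure ≤ ∫ t, g k t ^ 2 * a t ∂unitMeasure := by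
      rw [← integral_const_mul]
      refine integral_mono_ae ((hg.memLp k hk).integrable_sq.const_mul _) (hg2a k hk)
        (hlb.mono fun t ht => ?_)
      simp only
      rw [mul_comm]
      exact mul_le_mul_of_nonneg_left ht (sq_nonneg _)
    have h3 : ∫ t, g k t ^ 2 * a t ∂unitMeasure ≤ sobolevNorm a (p + 1) f ^ 2 := by
      rw [hnorm, ← intervalIntegral_eq_unitMeasure]
      refine Finset.single_le_sum (f := fun k => ∫ t in (0 : ℝ)..1, (g k t) ^ 2 * a t)
        (fun l _ => ?_) (Finset.mem_range.2 (by omega))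
      rw [intervalIntegral_eq_unitMeasure]
      exact integral_nonneg_of_ae (hlb.mono fun t ht =>
        mul_nonneg (sq_nonneg _) (ha₀.le.trans ht))
    rw [h1, inv_mul_eq_div, le_div_iff₀ ha₀]
    linarith
  have hfu : ∀ᵐ t ∂unitMeasure, u 0 t = f t := by
    filter_upwards [huae 0 (by omega), ae_restrict_mem measurableSet_Ioo] with t ht htm
    rw [ht, hg.zero t htm]
  refine ⟨((hbound 0 (by omega)).1).ae_eq hfu, ?_⟩
  obtain ⟨v, hv, hvM, hP⟩ := (hC u _ hprim hbound 0 (by omega)).exists_polynomial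
  refine ⟨v, hv, by rwa [mul_assoc], fun A B hA hAB hB => ?_⟩
  obtain ⟨P, hPp, hPt⟩ := hP A B hA hAB hB
  refine ⟨P, hPp, ?_⟩
  filter_upwards [(ae_restrict_iff' measurableSet_Ioo).1 hfu] with t ht htm
  have := hPt t htm
  rwa [one_mul, ht (Ioo_subset_Ioo hA hB htm)] at this

/-! ### Open knot vectors -/

/-- The knots, continued by the last knot. -/
def clamp (ξ : ℕ → ℝ) (N i : ℕ) : ℝ := ξ (min i N)

lemma clamp_of_le {ξ : ℕ → ℝ} {N i : ℕ} (h : i ≤ N) : clamp ξ N i = ξ i := by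
  rw [clamp, min_eq_left h]

lemma sum_range_eq_activeSum {ξ : ℕ → ℝ} (hξ : Monotone ξ) {q b n : ℕ} (hb : b + q < n) {t : ℝ}
    (h1 : ξ (b + q) ≤ t) (h2 : t < ξ (b + q + 1)) (c : ℕ → ℝ) :
    ∑ i ∈ Finset.range n, c i * bspline ξ q i t = activeSum ξ q b c t := by
  have h3 : (Finset.range (q + 1)).image (fun i => b + i) ⊆ Finset.range n := fun i hi => by
    simp only [Finset.mem_image, Finset.mem_range] at hi ⊢
    omega
  rw [activeSum, ← Finset.sum_subset h3 fun i _ hi => ?_,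
    Finset.sum_image fun i _ j _ h => by simpa using h]
  have hi' : i < b ∨ b + q < i := by
    by_contra hc
    push Not at hc
    exact hi (Finset.mem_image.2 ⟨i - b, by simp; omega, by omega⟩)
  rcases hi' with h | h
  · rw [bspline_eq_zero_of_le hξ ((hξ (show i + q + 1 ≤ b + q by omega)).trans h1), mul_zero]
  · rw [bspline_eq_zero_of_lt hξ (h2.trans_le (hξ (show b + q + 1 ≤ i by omega))), mul_zero]

namespace IsOpenKnotVector

variable {p n : ℕ} {ξ : ℕ → ℝ}

lemma monotone_clamp (h : IsOpenKnotVector p n ξ) : Monotone (clamp ξ (n + p)) := by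
  refine monotone_nat_of_le_succ fun k => ?_
  rcases lt_or_ge k (n + p) with hk | hk
  · rw [clamp_of_le hk.le, clamp_of_le hk]
    exact h.le_succ k hk
  · rw [clamp, clamp, min_eq_right hk, min_eq_right (by omega)]

lemma clamp_first (h : IsOpenKnotVector p n ξ) {i : ℕ} (hi : i ≤ p) : clamp ξ (n + p) i = 0 := by
  rw [clamp_of_le (by omega), h.first i hi]

lemma clamp_last (h : IsOpenKnotVector p n ξ) {i : ℕ} (hi : n ≤ i) : clamp ξ (n + p) i = 1 := by
  rcases le_or_gt i (n + p) with h' | h'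
  · obtain ⟨j, rfl⟩ := Nat.exists_eq_add_of_le hi
    rw [clamp_of_le h', h.last j (by omega)]
  · rw [clamp, min_eq_right h'.le, h.last p le_rfl]

lemma clamp_mem (h : IsOpenKnotVector p n ξ) (i : ℕ) : clamp ξ (n + p) i ∈ Icc (0 : ℝ) 1 := by
  constructor
  · rw [← h.clamp_first (Nat.zero_le p)]
    exact h.monotone_clamp (Nat.zero_le i)
  · rw [← h.clamp_last (le_max_left n i)]
    exact h.monotone_clamp (le_max_right n i)

/-- The knots that enter have indices at most `i + p + 1 ≤ n + p`. Replacing the unconstrained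
values beyond gives a monotone sequence, as the local theory requires. -/
lemma bspline_clamp (_h : IsOpenKnotVector p n ξ) {i : ℕ} (hi : i < n) :
    bspline ξ p i = bspline (clamp ξ (n + p)) p i :=
  bspline_congr fun k _ h2 => (clamp_of_le (by omega)).symm

lemma exists_element (h : IsOpenKnotVector p n ξ) {t : ℝ} (ht : t ∈ Ico (0 : ℝ) 1) :
    ∃ b, b + p < n ∧ clamp ξ (n + p) (b + p) ≤ t ∧ t < clamp ξ (n + p) (b + p + 1) := by
  obtain ⟨b, h1, h2⟩ := DualSpline.exists_element (q := p) (N := n) (t := t)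
    (ξ := clamp ξ (n + p)) (by rw [h.clamp_first le_rfl]; exact ht.1)
    (by rw [h.clamp_last le_rfl]; exact ht.2) h.monotone_clamp
  refine ⟨b, ?_, h1, h2⟩
  by_contra hc
  rw [h.clamp_last (not_lt.1 hc)] at h1
  exact absurd h1 (not_le.2 ht.2)

lemma index_of_lt (h : IsOpenKnotVector p n ξ) {k : ℕ}
    (hk : clamp ξ (n + p) k < clamp ξ (n + p) (k + 1)) : p ≤ k ∧ k < n := by
  constructor
  · by_contra hc
    rw [h.clamp_first (by omega), h.clamp_first (by omega)] at hk
    exact lt_irrefl _ hk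
  · by_contra hc
    rw [h.clamp_last (by omega), h.clamp_last (by omega)] at hk
    exact lt_irrefl _ hk

lemma sum_eq_activeSum (h : IsOpenKnotVector p n ξ) {b : ℕ} (hb : b + p < n) {t : ℝ}
    (h1 : clamp ξ (n + p) (b + p) ≤ t) (h2 : t < clamp ξ (n + p) (b + p + 1)) (c : ℕ → ℝ) :
    ∑ i ∈ Finset.range n, c i * bspline ξ p i t = activeSum (clamp ξ (n + p)) p b c t := by
  rw [← sum_range_eq_activeSum h.monotone_clamp hb h1 h2]
  exact Finset.sum_congr rfl fun i hi => by rw [h.bspline_clamp (Finset.mem_range.1 hi)]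

lemma sum_bspline (h : IsOpenKnotVector p n ξ) {t : ℝ} (ht : t ∈ Ico (0 : ℝ) 1) :
    ∑ i ∈ Finset.range n, bspline ξ p i t = 1 := by
  obtain ⟨b, hb, h1, h2⟩ := h.exists_element ht
  have := h.sum_eq_activeSum hb h1 h2 fun _ => 1
  simp only [one_mul, activeSum] at this
  rw [this, sum_bspline_eq_one h.monotone_clamp h1 h2]

lemma bspline_nonneg (h : IsOpenKnotVector p n ξ) {i : ℕ} (hi : i < n) (t : ℝ) :
    0 ≤ bspline ξ p i t := by
  rw [h.bspline_clamp hi]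
  exact DualSpline.bspline_nonneg h.monotone_clamp i t

end IsOpenKnotVector

/-! ### Piecewise rational functions -/

/-- On every element, `f` is a quotient of polynomials with a denominator bounded from below. -/
def PiecewiseRational (x : ℕ → ℝ) (f : ℝ → ℝ) : Prop :=
  ∀ k, x k < x (k + 1) → ∃ N W : Polynomial ℝ, (∃ r, 0 < r ∧ ∀ t ∈ Ioo (x k) (x (k + 1)),
    r ≤ W.eval t) ∧ ∀ t ∈ Ioo (x k) (x (k + 1)), f t = N.eval t / W.eval t

namespace PiecewiseRational

variable {x : ℕ → ℝ} {f : ℝ → ℝ}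

lemma hasDerivAt_aux {N W : Polynomial ℝ} {A B r : ℝ} (hr : 0 < r)
    (hW : ∀ t ∈ Ioo A B, r ≤ W.eval t) (hf : ∀ t ∈ Ioo A B, f t = N.eval t / W.eval t) {t : ℝ}
    (ht : t ∈ Ioo A B) : HasDerivAt f
      ((N.derivative * W - N * W.derivative).eval t / (W ^ 2).eval t) t := by
  have h1 := (N.hasDerivAt t).div (W.hasDerivAt t) (hr.trans_le (hW t ht)).ne'
  have h2 : f =ᶠ[nhds t] fun s => N.eval s / W.eval s :=
    Filter.eventually_of_mem (isOpen_Ioo.mem_nhds ht) hf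
  refine (h1.congr_of_eventuallyEq h2).congr_deriv ?_
  simp

lemma deriv (h : PiecewiseRational x f) : PiecewiseRational x (_root_.deriv f) := by
  intro k hk
  obtain ⟨N, W, ⟨r, hr, hW⟩, hf⟩ := h k hk
  refine ⟨_, _, ⟨r ^ 2, by positivity, fun t ht => ?_⟩, fun t ht =>
    (hasDerivAt_aux hr hW hf ht).deriv⟩
  rw [Polynomial.eval_pow]
  exact pow_le_pow_left₀ hr.le (hW t ht) 2

lemma exists_mem_Ioo (hx : Monotone x) {n : ℕ} (h0 : x 0 = 0) (hn : x n = 1) {t : ℝ}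
    (ht : t ∈ Ioo (0 : ℝ) 1 \ range x) : ∃ k < n, t ∈ Ioo (x k) (x (k + 1)) := by
  obtain ⟨k, h1, h2⟩ := DualSpline.exists_element (q := 0) (N := n) (t := t) (by rw [h0]; exact ht.1.1.le)
    (by rw [hn]; exact ht.1.2) hx
  refine ⟨k, ?_, lt_of_le_of_ne h1 fun h => ht.2 ⟨k, h⟩, h2⟩
  by_contra hc
  have := hx (not_lt.1 hc)
  rw [add_zero] at h1
  linarith [ht.1.2]

lemma hasDerivAt (h : PiecewiseRational x f) (hx : Monotone x) {n : ℕ} (h0 : x 0 = 0)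
    (hn : x n = 1) {t : ℝ} (ht : t ∈ Ioo (0 : ℝ) 1 \ range x) :
    HasDerivAt f (_root_.deriv f t) t := by
  obtain ⟨k, -, hk⟩ := exists_mem_Ioo hx h0 hn ht
  obtain ⟨N, W, ⟨r, hr, hW⟩, hf⟩ := h k (hk.1.trans hk.2)
  exact (hasDerivAt_aux hr hW hf hk).differentiableAt.hasDerivAt

lemma exists_bound (h : PiecewiseRational x f) (hx : Monotone x) {n : ℕ} (h0 : x 0 = 0)
    (hn : x n = 1) : ∃ C, ∀ t ∈ Ioo (0 : ℝ) 1 \ range x, |f t| ≤ C := by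
  have hex : ∀ k, ∃ C, 0 ≤ C ∧ ∀ t ∈ Ioo (x k) (x (k + 1)), |f t| ≤ C := by
    intro k
    by_cases hk : x k < x (k + 1)
    · obtain ⟨N, W, ⟨r, hr, hW⟩, hf⟩ := h k hk
      obtain ⟨D, hD⟩ := isCompact_Icc.exists_bound_of_continuousOn (s := Icc (x k) (x (k + 1)))
        N.continuous.continuousOn
      have hD0 : 0 ≤ D := (norm_nonneg _).trans (hD _ (left_mem_Icc.2 hk.le))
      refine ⟨D / r, by positivity, fun t ht => ?_⟩
      rw [hf t ht, abs_div, abs_of_pos (hr.trans_le (hW t ht))]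
      exact div_le_div₀ hD0 (hD t (Ioo_subset_Icc_self ht)) hr (hW t ht)
    · exact ⟨0, le_rfl, fun t ht => absurd (ht.1.trans ht.2) hk⟩
  choose C hC0 hC using hex
  refine ⟨∑ k ∈ Finset.range n, C k, fun t ht => ?_⟩
  obtain ⟨k, hkn, hk⟩ := exists_mem_Ioo hx h0 hn ht
  exact (hC k t hk).trans (Finset.single_le_sum (fun k _ => hC0 k) (Finset.mem_range.2 hkn))

/-- The rational form gives boundedness and the derivatives off the breakpoints; only continuity
across the breakpoints has to be assumed. -/
lemma bddSmooth (hx : Monotone x) {n : ℕ} (h0 : x 0 = 0) (hn : x n = 1) (m : ℕ) :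
    ∀ {f : ℝ → ℝ}, PiecewiseRational x f → Measurable f →
      (∀ k < m, ContinuousOn (_root_.deriv^[k] f) (Ioo 0 1)) → BddSmooth (range x) m f := by
  induction m with
  | zero => exact fun h hf _ => ⟨hf.aestronglyMeasurable, h.exists_bound hx h0 hn⟩
  | succ m ih =>
    intro f h hf hc
    exact ⟨hc 0 (Nat.succ_pos m), h.exists_bound hx h0 hn, _root_.deriv f,
      fun t ht => h.hasDerivAt hx h0 hn ht,
      ih h.deriv (measurable_deriv f) fun k hk => hc (k + 1) (by omega)⟩

end PiecewiseRational

lemma BddSmooth.congr {s : Set ℝ} : ∀ {m : ℕ} {c d : ℝ → ℝ}, BddSmooth s m c →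
    (∀ t ∈ Ioo (0 : ℝ) 1, d t = c t) → BddSmooth s m d
  | 0, c, d, ⟨h1, C, hC⟩, h => ⟨h1.congr (by
      filter_upwards [ae_restrict_mem measurableSet_Ioo] with t ht using (h t ht).symm), C,
      fun t ht => by rw [h t ht.1]; exact hC t ht⟩
  | m + 1, c, d, ⟨h1, ⟨C, hC⟩, c', h2, h3⟩, h => ⟨h1.congr h, ⟨C, fun t ht => by
      rw [h t ht.1]; exact hC t ht⟩, c', fun t ht => (h2 t ht).congr_of_eventuallyEq
        (Filter.eventually_of_mem (isOpen_Ioo.mem_nhds ht.1) h), h3⟩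

/-! ### The parametrization of the interface -/

namespace NurbsMap

variable {p : ℕ} (F : NurbsMap p)

/-- The knots in the first direction. -/
def knots : ℕ → ℝ := clamp F.knot₁ (F.n₁ + p)

lemma zero_mem_Ico : (0 : ℝ) ∈ Ico (0 : ℝ) 1 := by norm_num

/-- By the partition of unity, the weight function is a convex combination of the finitely many
positive numbers `w i j`. -/
lemma exists_weight_bounds :
    ∃ w₀ w₁ : ℝ, 0 < w₀ ∧ 0 < w₁ ∧ ∀ t ∈ Ico (0 : ℝ) 1,
      w₀ ≤ F.weight (t, 0) ∧ F.weight (t, 0) ≤ w₁ := by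
  have hne : (Finset.range F.n₁ ×ˢ Finset.range F.n₂).Nonempty :=
    ⟨(0, 0), by simp [(Nat.zero_le p).trans_lt F.isOpen₁.lt_card,
      (Nat.zero_le p).trans_lt F.isOpen₂.lt_card]⟩
  obtain ⟨k, hk, hmin⟩ := Finset.exists_min_image _ (fun k => F.w k.1 k.2) hne
  obtain ⟨l, hl, hmax⟩ := Finset.exists_max_image _ (fun k => F.w k.1 k.2) hne
  simp only [Finset.mem_product, Finset.mem_range, Prod.forall] at hk hl hmin hmax
  refine ⟨_, _, F.w_pos _ hk.1 _ hk.2, F.w_pos _ hl.1 _ hl.2, fun t ht => ?_⟩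
  have h1 : ∀ r : ℝ, r = ∑ i ∈ Finset.range F.n₁, ∑ j ∈ Finset.range F.n₂,
      r * (bspline F.knot₁ p i t * bspline F.knot₂ p j 0) := fun r => by
    simp only [← Finset.mul_sum, F.isOpen₂.sum_bspline zero_mem_Ico, mul_one,
      F.isOpen₁.sum_bspline ht]
  constructor
  · rw [h1 (F.w k.1 k.2), weight]
    refine Finset.sum_le_sum fun i hi => Finset.sum_le_sum fun j hj => ?_
    have hi := Finset.mem_range.1 hi
    have hj := Finset.mem_range.1 hj
    exact mul_le_mul_of_nonneg_right (hmin i j ⟨hi, hj⟩)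
      (mul_nonneg (F.isOpen₁.bspline_nonneg hi _) (F.isOpen₂.bspline_nonneg hj _))
  · rw [h1 (F.w l.1 l.2), weight]
    refine Finset.sum_le_sum fun i hi => Finset.sum_le_sum fun j hj => ?_
    have hi := Finset.mem_range.1 hi
    have hj := Finset.mem_range.1 hj
    exact mul_le_mul_of_nonneg_right (hmax i j ⟨hi, hj⟩)
      (mul_nonneg (F.isOpen₁.bspline_nonneg hi _) (F.isOpen₂.bspline_nonneg hj _))

lemma weight_eq (t : ℝ) : F.weight (t, 0) = ∑ i ∈ Finset.range F.n₁,
    (∑ j ∈ Finset.range F.n₂, F.w i j * bspline F.knot₂ p j 0) * bspline F.knot₁ p i t := by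
  simp only [weight, Finset.sum_mul]
  exact Finset.sum_congr rfl fun i _ => Finset.sum_congr rfl fun j _ => by ring

lemma trace_apply (t : ℝ) (l : Fin 2) : F.trace t l = (∑ i ∈ Finset.range F.n₁,
    (∑ j ∈ Finset.range F.n₂, bspline F.knot₂ p j 0 * F.coeff i j l) * bspline F.knot₁ p i t) /
      F.weight (t, 0) := by
  simp only [trace, map, PiLp.smul_apply, WithLp.ofLp_sum, Finset.sum_apply, smul_eq_mul,
    Finset.sum_mul]
  rw [inv_mul_eq_div]
  congr 1
  exact Finset.sum_congr rfl fun i _ => Finset.sum_congr rfl fun j _ => by ring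

lemma measurable_weight : Measurable fun t => F.weight (t, 0) := by
  simp only [weight_eq]
  exact Finset.measurable_sum _ fun i _ => (measurable_bspline _ _ _).const_mul _

lemma measurable_trace_apply (l : Fin 2) : Measurable fun t => F.trace t l := by
  simp only [trace_apply]
  exact (Finset.measurable_sum _ fun i _ => (measurable_bspline _ _ _).const_mul _).div
    F.measurable_weight

lemma measurable_trace : Measurable F.trace := by
  have h : Measurable fun t => (fun l => F.trace t l : Fin 2 → ℝ) :=
    measurable_pi_lambda _ F.measurable_trace_apply
  exact (PiLp.continuous_toLp 2 _).measurable.comp h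

lemma piecewiseRational_trace (l : Fin 2) : PiecewiseRational F.knots fun t => F.trace t l := by
  intro k hk
  obtain ⟨h1, h2⟩ := F.isOpen₁.index_of_lt hk
  obtain ⟨b, rfl⟩ : ∃ b, k = b + p := ⟨k - p, by omega⟩
  obtain ⟨w₀, w₁, hw₀, -, hw⟩ := F.exists_weight_bounds
  have key : ∀ c : ℕ → ℝ, ∃ P : Polynomial ℝ, ∀ t ∈ Ioo (F.knots (b + p)) (F.knots (b + p + 1)),
      ∑ i ∈ Finset.range F.n₁, c i * bspline F.knot₁ p i t = P.eval t := fun c => by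
    obtain ⟨P, -, hP⟩ := exists_polynomial_sum_bspline F.isOpen₁.monotone_clamp hk
      fun i => c (b + i)
    exact ⟨P, fun t ht => by
      rw [F.isOpen₁.sum_eq_activeSum h2 ht.1.le ht.2]
      exact hP t ht.1.le ht.2⟩
  obtain ⟨N, hN⟩ := key fun i => ∑ j ∈ Finset.range F.n₂, bspline F.knot₂ p j 0 * F.coeff i j l
  obtain ⟨W, hW⟩ := key fun i => ∑ j ∈ Finset.range F.n₂, F.w i j * bspline F.knot₂ p j 0
  refine ⟨N, W, ⟨w₀, hw₀, fun t ht => ?_⟩, fun t ht => ?_⟩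
  · rw [← hW t ht, ← weight_eq]
    exact (hw t ⟨(F.isOpen₁.clamp_mem _).1.trans ht.1.le,
      ht.2.trans_le (F.isOpen₁.clamp_mem _).2⟩).1
  · simp only
    rw [trace_apply, ← hW t ht, ← hN t ht, ← weight_eq]

lemma monotone_knots : Monotone F.knots := F.isOpen₁.monotone_clamp

lemma knots_zero : F.knots 0 = 0 := F.isOpen₁.clamp_first (Nat.zero_le p)

lemma knots_last : F.knots F.n₁ = 1 := F.isOpen₁.clamp_last le_rfl

lemma countable_knots : (range F.knots).Countable := countable_range _

lemma differentiableAt_trace {t : ℝ} (ht : t ∈ Ioo (0 : ℝ) 1 \ range F.knots) :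
    DifferentiableAt ℝ F.trace t := by
  rw [differentiableAt_euclidean]
  exact fun l => ((F.piecewiseRational_trace l).hasDerivAt F.monotone_knots F.knots_zero
    F.knots_last ht).differentiableAt

variable {F}

lemma IsBiLipschitz.exists_dist (hF : F.IsBiLipschitz) :
    ∃ K : ℝ, 0 < K ∧ ∀ s ∈ Ico (0 : ℝ) 1, ∀ t ∈ Ico (0 : ℝ) 1,
      dist (F.trace s) (F.trace t) ≤ K * |s - t| ∧ |s - t| ≤ K * dist (F.trace s) (F.trace t) := by
  obtain ⟨K, hK, h⟩ := hF
  refine ⟨K, hK, fun s hs t ht => ?_⟩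
  have := h (s, 0) ⟨hs, zero_mem_Ico⟩ (t, 0) ⟨ht, zero_mem_Ico⟩
  rwa [Prod.dist_eq, dist_self, max_eq_left dist_nonneg, Real.dist_eq] at this

lemma IsBiLipschitz.injOn_trace (hF : F.IsBiLipschitz) : InjOn F.trace (Ioo 0 1) := by
  obtain ⟨K, -, h⟩ := hF.exists_dist
  intro s hs t ht hst
  have := (h s (Ioo_subset_Ico_self hs) t (Ioo_subset_Ico_self ht)).2
  rw [hst, dist_self, mul_zero] at this
  exact sub_eq_zero.1 (abs_eq_zero.1 (le_antisymm this (abs_nonneg _)))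

/-- The norms of the difference quotients of the curve lie between `K⁻¹` and `K`, hence so does
their limit. -/
lemma IsBiLipschitz.exists_speed_bounds (hF : F.IsBiLipschitz) :
    ∃ K : ℝ, 0 < K ∧ ∀ t ∈ Ioo (0 : ℝ) 1, DifferentiableAt ℝ F.trace t →
      K⁻¹ ≤ speed F.trace t ∧ speed F.trace t ≤ K := by
  obtain ⟨K, hK, h⟩ := hF.exists_dist
  refine ⟨K, hK, fun t ht hd => ?_⟩
  have hnhds : ∀ᶠ s in nhds t, s ∈ Ioo (0 : ℝ) 1 := isOpen_Ioo.mem_nhds ht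
  constructor
  · have h1 := hd.hasDerivAt.tendsto_slope.norm
    refine ge_of_tendsto h1 ?_
    filter_upwards [hnhds.filter_mono nhdsWithin_le_nhds, self_mem_nhdsWithin] with s hs hne
    have h2 := (h s (Ioo_subset_Ico_self hs) t (Ioo_subset_Ico_self ht)).2
    have h3 : 0 < |s - t| := abs_pos.2 (sub_ne_zero.2 hne)
    rw [slope_def_module, norm_smul, norm_inv, Real.norm_eq_abs, ← dist_eq_norm]
    rw [inv_mul_eq_div, le_div_iff₀ h3, inv_mul_eq_div, div_le_iff₀ hK]
    linarith
  · refine norm_deriv_le_of_lip' hK.le ?_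
    filter_upwards [hnhds] with s hs
    rw [← dist_eq_norm]
    exact (h s (Ioo_subset_Ico_self hs) t (Ioo_subset_Ico_self ht)).1

variable (F) in
lemma ae_differentiableAt_trace : ∀ᵐ t ∂unitMeasure, DifferentiableAt ℝ F.trace t := by
  rw [ae_restrict_iff' measurableSet_Ioo]
  filter_upwards [F.countable_knots.ae_notMem volume] with t ht htm
  exact F.differentiableAt_trace ⟨htm, ht⟩

variable (F) in
lemma measurable_speed : Measurable (speed F.trace) :=
  (measurable_deriv F.trace).norm

lemma IsBiLipschitz.ae_speed_bounds (hF : F.IsBiLipschitz) :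
    ∃ K : ℝ, 0 < K ∧ ∀ᵐ t ∂unitMeasure, K⁻¹ ≤ speed F.trace t ∧ speed F.trace t ≤ K := by
  obtain ⟨K, hK, h⟩ := hF.exists_speed_bounds
  refine ⟨K, hK, ?_⟩
  filter_upwards [F.ae_differentiableAt_trace, ae_restrict_mem measurableSet_Ioo] with t h1 h2
    using h t h2 h1

lemma measurable_rhoHat {ρ : Plane → ℝ} (hρ : Measurable ρ) : Measurable (F.rhoHat ρ) :=
  ((hρ.comp F.measurable_trace).mul F.measurable_speed).div F.measurable_weight

lemma IsBiLipschitz.ae_rhoHat_bounds (hF : F.IsBiLipschitz) {ρ : Plane → ℝ} {ρ₀ ρ₁ : ℝ}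
    (hρ₀ : 0 < ρ₀)
    (hρ : ∀ t ∈ Ioo (0 : ℝ) 1, ρ₀ ≤ ρ (F.trace t) ∧ ρ (F.trace t) ≤ ρ₁) :
    ∃ a₀ a₁ : ℝ, 0 < a₀ ∧ 0 < a₁ ∧ ∀ᵐ t ∂unitMeasure,
      a₀ ≤ F.rhoHat ρ t ∧ F.rhoHat ρ t ≤ a₁ := by
  obtain ⟨K, hK, h⟩ := hF.ae_speed_bounds
  obtain ⟨w₀, w₁, hw₀, hw₁, hw⟩ := F.exists_weight_bounds
  have hρ₁ : 0 < ρ₁ := by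
    have := hρ _ half_mem
    linarith
  refine ⟨ρ₀ * K⁻¹ / w₁, ρ₁ * K / w₀, by positivity, by positivity, ?_⟩
  filter_upwards [h, ae_restrict_mem measurableSet_Ioo] with t h1 h2
  obtain ⟨h3, h4⟩ := hρ t h2
  obtain ⟨h5, h6⟩ := hw t (Ioo_subset_Ico_self h2)
  have h7 : 0 < F.weight (t, 0) := hw₀.trans_le h5
  have h8 : 0 < K⁻¹ := inv_pos.2 hK
  have h9 : 0 < ρ (F.trace t) := hρ₀.trans_le h3
  constructor
  · exact div_le_div₀ (mul_nonneg h9.le (norm_nonneg _))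
      (mul_le_mul h3 h1.1 h8.le h9.le) h7 h6
  · exact div_le_div₀ (by positivity) (mul_le_mul h4 h1.2 (norm_nonneg _) hρ₁.le) hw₀ h5

/-- The components of `γ'` are piecewise rational with continuous derivatives of order less than
`p`. The speed is the root of their sum of squares, and the root is smooth away from zero. -/
lemma IsBiLipschitz.bddSmooth_speed (hF : F.IsBiLipschitz)
    (hc : ContDiffOn ℝ p F.trace (Ioo 0 1)) : BddSmooth (range F.knots) p (speed F.trace) := by
  obtain ⟨K, hK, hspeed⟩ := hF.exists_speed_bounds
  -- For `p = 0` the hypothesis gives no differentiability at the knots, but then a bound off the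
  -- knots suffices.
  rcases Nat.eq_zero_or_pos p with hp | hp
  · have h0 : BddSmooth (range F.knots) 0 (speed F.trace) :=
      ⟨F.measurable_speed.aestronglyMeasurable, K, fun t ht => by
        rw [speed, abs_of_nonneg (norm_nonneg _)]
        exact (hspeed t ht.1 (F.differentiableAt_trace ht)).2⟩
    exact hp ▸ h0
  have hdiff : ∀ t ∈ Ioo (0 : ℝ) 1, DifferentiableAt ℝ F.trace t := fun t ht =>
    (hc.differentiableOn (by exact_mod_cast hp.ne')).differentiableAt (isOpen_Ioo.mem_nhds ht)
  have hcomp : ∀ l : Fin 2, BddSmooth (range F.knots) p (deriv fun t => F.trace t l) := by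
    intro l
    refine PiecewiseRational.bddSmooth F.monotone_knots F.knots_zero F.knots_last p
      (F.piecewiseRational_trace l).deriv (measurable_deriv _) fun k hk => ?_
    have hcl : ContDiffOn ℝ p (fun t => F.trace t l) (Ioo 0 1) :=
      (contDiffOn_euclidean.1 hc) l
    have h1 := hcl.continuousOn_iteratedDerivWithin (m := k + 1) (by exact_mod_cast hk)
      isOpen_Ioo.uniqueDiffOn
    refine h1.congr fun t ht => ?_
    rw [iteratedDerivWithin_of_isOpen isOpen_Ioo ht, iteratedDeriv_eq_iterate,
      Function.iterate_succ_apply]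
  have heq : ∀ t ∈ Ioo (0 : ℝ) 1, speed F.trace t =
      √((deriv (fun t => F.trace t 0) t) * (deriv (fun t => F.trace t 0) t) +
        (deriv (fun t => F.trace t 1) t) * (deriv (fun t => F.trace t 1) t)) := by
    intro t ht
    have h1 : ∀ l : Fin 2, (deriv F.trace t) l = deriv (fun t => F.trace t l) t := fun l =>
      (((EuclideanSpace.proj (𝕜 := ℝ) l).hasFDerivAt.comp_hasDerivAt t
        (hdiff t ht).hasDerivAt).deriv).symm
    rw [speed, EuclideanSpace.norm_eq, Fin.sum_univ_two, h1, h1]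
    simp [sq]
  refine BddSmooth.congr (BddSmooth.sqrt (r := K⁻¹ ^ 2) (by positivity)
    (((hcomp 0).mul (hcomp 0)).add ((hcomp 1).mul (hcomp 1))) fun t ht => ?_) heq
  have h1 := (hspeed t ht (hdiff t ht)).1
  rw [heq t ht] at h1
  exact (Real.le_sqrt' (inv_pos.2 hK)).1 h1

end NurbsMap

/-! ### The weighted product -/

/-- A measurable weight that is bounded from above and from below. -/
structure IsWeight (a₀ a₁ : ℝ) (ρ : ℝ → ℝ) : Prop where
  pos : 0 < a₀
  pos' : 0 < a₁
  measurable : Measurable ρ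
  bounds : ∀ᵐ t ∂unitMeasure, a₀ ≤ ρ t ∧ ρ t ≤ a₁

/-- Measurable and bounded on `(0, 1)`. -/
def Nice (u : ℝ → ℝ) : Prop := Measurable u ∧ ∃ C, ∀ t ∈ Ioo (0 : ℝ) 1, |u t| ≤ C

namespace Nice

variable {u v : ℝ → ℝ}

lemma ae_bound (h : Nice u) : ∃ C, ∀ᵐ t ∂unitMeasure, ‖u t‖ ≤ C := by
  obtain ⟨C, hC⟩ := h.2
  exact ⟨C, (ae_restrict_iff' measurableSet_Ioo).2 (Filter.Eventually.of_forall hC)⟩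

lemma integrable (h : Nice u) : Integrable u unitMeasure := by
  obtain ⟨C, hC⟩ := h.ae_bound
  exact Integrable.of_bound h.1.aestronglyMeasurable C hC

lemma add (hu : Nice u) (hv : Nice v) : Nice (u + v) := by
  obtain ⟨C, hC⟩ := hu.2
  obtain ⟨D, hD⟩ := hv.2
  exact ⟨hu.1.add hv.1, C + D, fun t ht =>
    (abs_add_le _ _).trans (add_le_add (hC t ht) (hD t ht))⟩

lemma smul (r : ℝ) (hu : Nice u) : Nice (r • u) := by
  obtain ⟨C, hC⟩ := hu.2
  refine ⟨hu.1.const_smul r, |r| * C, fun t ht => ?_⟩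
  rw [Pi.smul_apply, smul_eq_mul, abs_mul]
  exact mul_le_mul_of_nonneg_left (hC t ht) (abs_nonneg r)

lemma zero : Nice 0 := ⟨measurable_zero, 0, fun t _ => by simp⟩

lemma sum {ι : Type*} {s : Finset ι} {f : ι → ℝ → ℝ} (h : ∀ i ∈ s, Nice (f i)) :
    Nice (∑ i ∈ s, f i) :=
  Finset.sum_induction _ Nice (fun _ _ => add) zero h

lemma eval (P : Polynomial ℝ) : Nice fun t => P.eval t := by
  obtain ⟨C, hC⟩ := (isCompact_Icc (a := (0 : ℝ)) (b := 1)).exists_bound_of_continuousOn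
    P.continuous.continuousOn
  exact ⟨P.continuous.measurable, C, fun t ht => hC t (Ioo_subset_Icc_self ht)⟩

lemma indicator {s : Set ℝ} (hs : MeasurableSet s) (h : Nice u) : Nice (s.indicator u) := by
  obtain ⟨C, hC⟩ := h.2
  refine ⟨h.1.indicator hs, C, fun t ht => ?_⟩
  exact (norm_indicator_le_norm_self u t).trans (hC t ht)

end Nice

section Pairing

variable {a₀ a₁ : ℝ} {ρ : ℝ → ℝ}

lemma IsWeight.nonneg_ae (hρ : IsWeight a₀ a₁ ρ) : ∀ᵐ t ∂unitMeasure, 0 ≤ ρ t :=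
  hρ.bounds.mono fun _ ht => hρ.pos.le.trans ht.1

lemma IsWeight.integrable (hρ : IsWeight a₀ a₁ ρ) {f : ℝ → ℝ} (hf : Integrable f unitMeasure) :
    Integrable (fun t => f t * ρ t) unitMeasure :=
  hf.mul_bdd (c := a₁) hρ.measurable.aestronglyMeasurable (by
    filter_upwards [hρ.bounds, hρ.nonneg_ae] with t h1 h2
    rw [Real.norm_of_nonneg h2]
    exact h1.2)

lemma IsWeight.integrable_mul (hρ : IsWeight a₀ a₁ ρ) {f v : ℝ → ℝ}
    (hf : Integrable f unitMeasure) (hv : Nice v) :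
    Integrable (fun t => f t * v t * ρ t) unitMeasure := by
  obtain ⟨C, hC⟩ := hv.ae_bound
  exact hρ.integrable (hf.mul_bdd (c := C) hv.1.aestronglyMeasurable hC)

lemma pairing_eq (ρ u v : ℝ → ℝ) : pairing ρ u v = ∫ t, u t * v t * ρ t ∂unitMeasure :=
  intervalIntegral_eq_unitMeasure _

lemma pairing_comm (ρ u v : ℝ → ℝ) : pairing ρ u v = pairing ρ v u := by
  simp only [pairing, mul_comm (u _)]

lemma pairing_sub_left (hρ : IsWeight a₀ a₁ ρ) {u u' v : ℝ → ℝ} (hu : Integrable u unitMeasure)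
    (hu' : Integrable u' unitMeasure) (hv : Nice v) :
    pairing ρ (u - u') v = pairing ρ u v - pairing ρ u' v := by
  rw [pairing_eq, pairing_eq, pairing_eq,
    ← integral_sub (hρ.integrable_mul hu hv) (hρ.integrable_mul hu' hv)]
  exact integral_congr_ae (Filter.Eventually.of_forall fun t => by
    simp only [Pi.sub_apply]; ring)

lemma pairing_sum_left (hρ : IsWeight a₀ a₁ ρ) {ι : Type*} (s : Finset ι) (c : ι → ℝ)
    {f : ι → ℝ → ℝ} {v : ℝ → ℝ} (hf : ∀ i ∈ s, Nice (f i)) (hv : Nice v) :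
    pairing ρ (∑ i ∈ s, c i • f i) v = ∑ i ∈ s, c i * pairing ρ (f i) v := by
  simp only [pairing_eq, ← integral_const_mul]
  rw [← integral_finsetSum _ fun i hi => (hρ.integrable_mul (hf i hi).integrable hv).const_mul (c i)]
  refine integral_congr_ae (Filter.Eventually.of_forall fun t => ?_)
  simp only [Finset.sum_apply, Pi.smul_apply, smul_eq_mul, Finset.sum_mul]
  exact Finset.sum_congr rfl fun i _ => by ring

lemma pairing_sum_right (hρ : IsWeight a₀ a₁ ρ) {ι : Type*} (s : Finset ι) (c : ι → ℝ)
    {f : ι → ℝ → ℝ} {v : ℝ → ℝ} (hf : ∀ i ∈ s, Nice (f i)) (hv : Nice v) :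
    pairing ρ v (∑ i ∈ s, c i • f i) = ∑ i ∈ s, c i * pairing ρ v (f i) := by
  rw [pairing_comm, pairing_sum_left hρ s c hf hv]
  exact Finset.sum_congr rfl fun i _ => by rw [pairing_comm]

lemma integral_indicator_unitMeasure {A B : ℝ} (hA : 0 ≤ A) (hAB : A ≤ B) (hB : B ≤ 1)
    (f : ℝ → ℝ) : ∫ t, (Ico A B).indicator f t ∂unitMeasure = ∫ t in A..B, f t := by
  rw [integral_indicator measurableSet_Ico, Measure.restrict_restrict measurableSet_Ico,
    intervalIntegral.integral_of_le hAB]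
  refine setIntegral_congr_set ?_
  have h1 : (Ico A B ∩ Ioo 0 1 : Set ℝ) =ᵐ[volume] (Ico A B ∩ Icc 0 1 : Set ℝ) :=
    (ae_eq_refl _).inter Ioo_ae_eq_Icc
  refine h1.trans ?_
  have h2 : Ico A B ⊆ Icc 0 1 := fun t ht => ⟨hA.trans ht.1, ht.2.le.trans hB⟩
  rw [inter_eq_left.2 h2]
  exact Ico_ae_eq_Ioc

/-- The Cauchy-Schwarz inequality on an interval. -/
lemma sq_integral_abs_le {A B : ℝ} (hAB : A < B) {u : ℝ → ℝ}
    (hu : IntervalIntegrable u volume A B)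
    (hu2 : IntervalIntegrable (fun t => u t ^ 2) volume A B) :
    (∫ t in A..B, |u t|) ^ 2 ≤ (B - A) * ∫ t in A..B, u t ^ 2 := by
  set I := ∫ t in A..B, |u t| with hI
  have hδ : 0 < B - A := sub_pos.2 hAB
  have h1 : 0 ≤ ∫ t in A..B, (|u t| - I / (B - A)) ^ 2 :=
    intervalIntegral.integral_nonneg hAB.le fun _ _ => sq_nonneg _
  have h2 : ∫ t in A..B, (|u t| - I / (B - A)) ^ 2 =
      (∫ t in A..B, u t ^ 2) - 2 * (I / (B - A)) * I + (I / (B - A)) ^ 2 * (B - A) := by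
    have e : ∀ t, (|u t| - I / (B - A)) ^ 2 =
        u t ^ 2 - 2 * (I / (B - A)) * |u t| + (I / (B - A)) ^ 2 := fun t => by
      rw [sub_sq, sq_abs]
      ring
    simp only [e]
    rw [intervalIntegral.integral_add (hu2.sub (hu.abs.const_mul _)) intervalIntegrable_const,
      intervalIntegral.integral_sub hu2 (hu.abs.const_mul _), intervalIntegral.integral_const_mul,
      intervalIntegral.integral_const, smul_eq_mul, ← hI]
    ring
  rw [h2] at h1
  have h3 : 2 * (I / (B - A)) * I - (I / (B - A)) ^ 2 * (B - A) = I ^ 2 / (B - A) := by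
    field_simp
    ring
  have h4 : I ^ 2 / (B - A) ≤ ∫ t in A..B, u t ^ 2 := by linarith
  rw [div_le_iff₀ hδ] at h4
  linarith

end Pairing

namespace TraceSplines

variable {p : ℕ} (S : TraceSplines p)

/-! ### Elements and pieces -/

/-- The knots, continued by the last knot. -/
def x : ℕ → ℝ := clamp S.knot (S.n + p)

lemma x_mono : Monotone S.x := S.isOpen.monotone_clamp

lemma x_mem (i : ℕ) : S.x i ∈ Icc (0 : ℝ) 1 := S.isOpen.clamp_mem i

lemma x_of_lt {i : ℕ} (hi : i ≤ S.n + p) : S.x i = S.knot i := clamp_of_le hi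

lemma index_of_lt {k : ℕ} (hk : S.x k < S.x (k + 1)) : p ≤ k ∧ k < S.n := S.isOpen.index_of_lt hk

lemma B_eq {i : ℕ} (hi : i < S.n) : S.B i = bspline S.x p i := S.isOpen.bspline_clamp hi

lemma exists_element {t : ℝ} (ht : t ∈ Ico (0 : ℝ) 1) :
    ∃ b, b + p < S.n ∧ S.x (b + p) ≤ t ∧ t < S.x (b + p + 1) := S.isOpen.exists_element ht

lemma B_eq_zero {i : ℕ} (hi : i < S.n) {t : ℝ} (ht : t ∉ Ico (S.x i) (S.x (i + p + 1))) :
    S.B i t = 0 := by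
  rw [S.B_eq hi]
  rw [mem_Ico, not_and_or, not_le, not_lt] at ht
  rcases ht with h | h
  · exact bspline_eq_zero_of_lt S.x_mono h
  · exact bspline_eq_zero_of_le S.x_mono h

lemma B_nonneg {i : ℕ} (hi : i < S.n) (t : ℝ) : 0 ≤ S.B i t := S.isOpen.bspline_nonneg hi t

lemma B_le_one {i : ℕ} (hi : i < S.n) (t : ℝ) : S.B i t ≤ 1 := by
  by_cases ht : t ∈ Ico (0 : ℝ) 1
  · rw [← S.isOpen.sum_bspline ht]
    exact Finset.single_le_sum (f := fun i => bspline S.knot p i t)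
      (fun j hj => S.B_nonneg (Finset.mem_range.1 hj) t) (Finset.mem_range.2 hi)
  · rw [S.B_eq_zero hi fun h => ht ⟨(S.x_mem i).1.trans h.1, h.2.trans_le (S.x_mem _).2⟩]
    exact zero_le_one

lemma nice_B {i : ℕ} (hi : i < S.n) : Nice (S.B i) :=
  ⟨measurable_bspline _ _ _, 1, fun t _ => by
    rw [abs_of_nonneg (S.B_nonneg hi t)]
    exact S.B_le_one hi t⟩

lemma mem_elements {i e : ℕ} (hi : i < S.n) :
    e ∈ S.elements i ↔ i ≤ e ∧ e ≤ i + p ∧ S.x e < S.x (e + 1) := by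
  simp only [elements, Finset.mem_filter, Finset.mem_Icc, and_assoc]
  refine and_congr_right fun h1 => and_congr_right fun h2 => ?_
  rw [S.x_of_lt (by omega), S.x_of_lt (by omega)]

lemma piece_eq {i e : ℕ} (he : e < S.n) :
    S.piece i e = (Ico (S.x e) (S.x (e + 1))).indicator (S.B i) := by
  rw [piece, S.x_of_lt (by omega), S.x_of_lt (by omega)]

lemma nice_piece {i : ℕ} (hi : i < S.n) (e : ℕ) : Nice (S.piece i e) :=
  (S.nice_B hi).indicator measurableSet_Ico

/-- No knot is repeated more than `p + 1` times, so the support of a B-spline has positive length.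
-/
lemma elements_nonempty {i : ℕ} (hi : i < S.n) : (S.elements i).Nonempty := by
  have h1 : S.x i < S.x (i + p + 1) := by
    rw [S.x_of_lt (by omega), S.x_of_lt (by omega)]
    exact S.isOpen.mult_le i hi
  obtain ⟨b, h2, h3⟩ := DualSpline.exists_element (q := 0) (t := S.x i) (N := i + p + 1)
    (S.x_mono (Nat.zero_le i)) h1 S.x_mono
  rw [add_zero] at h2 h3
  have h4 : i ≤ b := by
    by_contra hc
    exact absurd (S.x_mono (show b + 1 ≤ i by omega)) (not_le.2 h3)
  have h5 : b ≤ i + p := by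
    by_contra hc
    exact absurd (S.x_mono (show i + p + 1 ≤ b by omega)) (not_le.2 (h2.trans_lt h1))
  exact ⟨b, (S.mem_elements hi).2 ⟨h4, h5, h2.trans_lt h3⟩⟩

lemma mem_index {k : ℕ × ℕ} : k ∈ S.index ↔ k.1 < S.n ∧ k.2 < (S.elements k.1).card := by
  simp only [index, Finset.mem_filter, Finset.mem_product, Finset.mem_range]
  refine ⟨fun h => ⟨h.1.1, h.2⟩, fun h => ⟨⟨h.1, h.2.trans_le ?_⟩, h.2⟩⟩
  refine (Finset.card_filter_le _ _).trans ?_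
  simp only [Nat.card_Icc]
  omega

lemma mem_bsp_lt {i : ℕ} (hi : i ∈ S.bsp) : i < S.n :=
  (Finset.mem_Ico.1 hi).2.trans_le S.hi_le

lemma mk_zero_mem_index {i : ℕ} (hi : i < S.n) : (i, 0) ∈ S.index :=
  S.mem_index.2 ⟨hi, (S.elements_nonempty hi).card_pos⟩

/-! ### Broken splines -/

/-- On every element, `v` is a linear combination of the active B-splines. -/
def IsLocalSpline (v : ℝ → ℝ) : Prop :=
  ∀ b, S.x (b + p) < S.x (b + p + 1) → ∃ c : ℕ → ℝ,
    ∀ t ∈ Ico (S.x (b + p)) (S.x (b + p + 1)), v t = activeSum S.x p b c t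

variable {S}

namespace IsLocalSpline

variable {u v : ℝ → ℝ}

lemma add (hu : S.IsLocalSpline u) (hv : S.IsLocalSpline v) : S.IsLocalSpline (u + v) := by
  intro b hb
  obtain ⟨c, hc⟩ := hu b hb
  obtain ⟨d, hd⟩ := hv b hb
  refine ⟨c + d, fun t ht => ?_⟩
  simp only [Pi.add_apply, hc t ht, hd t ht, activeSum, add_mul, Finset.sum_add_distrib]

lemma smul (r : ℝ) (hu : S.IsLocalSpline u) : S.IsLocalSpline (r • u) := by
  intro b hb
  obtain ⟨c, hc⟩ := hu b hb
  refine ⟨r • c, fun t ht => ?_⟩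
  simp only [Pi.smul_apply, hc t ht, activeSum, smul_eq_mul, Finset.mul_sum, mul_assoc]

lemma zero : S.IsLocalSpline 0 := fun b _ => ⟨0, fun t _ => by simp [activeSum]⟩

lemma sum {ι : Type*} {s : Finset ι} {f : ι → ℝ → ℝ} (h : ∀ i ∈ s, S.IsLocalSpline (f i)) :
    S.IsLocalSpline (∑ i ∈ s, f i) :=
  Finset.sum_induction _ S.IsLocalSpline (fun _ _ => add) zero h

lemma eval {P : Polynomial ℝ} (hP : P.natDegree ≤ p) : S.IsLocalSpline fun t => P.eval t := by
  intro b hb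
  obtain ⟨a, ha⟩ := exists_eval_eq_sum_sub_pow (natCast_fin_injective p) hP
  exact ⟨_, fun t ht => by rw [activeSum_dualPoly S.x_mono a ht.1 ht.2]; exact ha t⟩

lemma isBroken (hu : S.IsLocalSpline u) : S.IsBroken u := by
  intro j hj hlt
  rw [← S.x_of_lt (by omega), ← S.x_of_lt (by omega)] at hlt ⊢
  obtain ⟨b, rfl⟩ : ∃ b, j = b + p := ⟨j - p, by have := S.index_of_lt hlt; omega⟩
  obtain ⟨c, hc⟩ := hu b hlt
  obtain ⟨P, hP, hPt⟩ := exists_polynomial_sum_bspline S.x_mono hlt fun i => c (b + i)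
  exact ⟨P, hP, fun t ht => by rw [hc t (Ioo_subset_Ico_self ht)]; exact hPt t ht.1.le ht.2⟩

end IsLocalSpline

lemma disjoint_elements {e e' : ℕ} (h : e ≠ e') {t : ℝ} (ht : t ∈ Ico (S.x e) (S.x (e + 1))) :
    t ∉ Ico (S.x e') (S.x (e' + 1)) := by
  intro ht'
  rcases lt_or_gt_of_ne h with h | h
  · exact absurd (ht.2.trans_le ((S.x_mono (Nat.succ_le_of_lt h)).trans ht'.1)) (lt_irrefl _)
  · exact absurd (ht'.2.trans_le ((S.x_mono (Nat.succ_le_of_lt h)).trans ht.1)) (lt_irrefl _)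

lemma activeSum_eq_sum_B {b : ℕ} (hb : b + p < S.n) (c : ℕ → ℝ) (t : ℝ) :
    activeSum S.x p b c t = ∑ i ∈ Finset.range (p + 1), c (b + i) * S.B (b + i) t :=
  Finset.sum_congr rfl fun i hi => by
    rw [S.B_eq (by have := Finset.mem_range.1 hi; omega)]

lemma piece_isLocalSpline {i e : ℕ} (hi : i < S.n) (he : e ∈ S.elements i) :
    S.IsLocalSpline (S.piece i e) := by
  intro b hb
  have hbn := (S.index_of_lt hb).2
  obtain ⟨h1, h2, h3⟩ := (S.mem_elements hi).1 he
  rw [S.piece_eq (S.index_of_lt h3).2]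
  by_cases hbe : b + p = e
  · subst hbe
    refine ⟨fun m => if m = i then 1 else 0, fun t ht => ?_⟩
    rw [indicator_of_mem ht, activeSum_eq_sum_B hbn,
      Finset.sum_eq_single_of_mem (i - b) (by simp; omega)]
    · rw [Nat.add_sub_cancel' (by omega)]
      simp
    · intro m _ hm
      rw [if_neg (by omega), zero_mul]
  · exact ⟨0, fun t ht => by
      rw [indicator_of_notMem (disjoint_elements hbe ht)]
      simp [activeSum]⟩

/-- The restriction of a spline to an element is a sum of pieces. -/
lemma indicator_eq_sum_piece {b : ℕ} (hb : S.x (b + p) < S.x (b + p + 1)) {u : ℝ → ℝ} {c : ℕ → ℝ}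
    (hc : ∀ t ∈ Ico (S.x (b + p)) (S.x (b + p + 1)), u t = activeSum S.x p b c t) :
    (Ico (S.x (b + p)) (S.x (b + p + 1))).indicator u =
      ∑ i ∈ Finset.range (p + 1), c (b + i) • S.piece (b + i) (b + p) := by
  have hbn := (S.index_of_lt hb).2
  funext t
  simp only [Finset.sum_apply, Pi.smul_apply, smul_eq_mul, S.piece_eq hbn]
  by_cases ht : t ∈ Ico (S.x (b + p)) (S.x (b + p + 1))
  · simp only [indicator_of_mem ht, hc t ht, activeSum_eq_sum_B hbn]
  · simp [indicator_of_notMem ht]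

/-! ### Energy on an element, and uniqueness by testing with the pieces -/

section Weight

variable {a₀ a₁ : ℝ} {ρ : ℝ → ℝ}

/-- The energy of a spline on an element. -/
lemma energy_le (hρ : IsWeight a₀ a₁ ρ) {b : ℕ} (hb : S.x (b + p) < S.x (b + p + 1)) {u : ℝ → ℝ}
    (hu : Nice u) {c : ℕ → ℝ}
    (hc : ∀ t ∈ Ico (S.x (b + p)) (S.x (b + p + 1)), u t = activeSum S.x p b c t) :
    a₀ * ∫ t in S.x (b + p)..S.x (b + p + 1), u t ^ 2 ≤
      ∑ i ∈ Finset.range (p + 1), c (b + i) * pairing ρ (S.piece (b + i) (b + p)) u := by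
  have hbn := (S.index_of_lt hb).2
  set E := Ico (S.x (b + p)) (S.x (b + p + 1)) with hE
  have hi : ∀ i ∈ Finset.range (p + 1), Nice (S.piece (b + i) (b + p)) := fun i hi =>
    S.nice_piece (by have := Finset.mem_range.1 hi; omega) _
  have hEu : Nice (E.indicator u) := hu.indicator measurableSet_Ico
  rw [← pairing_sum_left hρ _ _ hi hu, ← indicator_eq_sum_piece hb hc, pairing_eq,
    ← integral_indicator_unitMeasure (S.x_mem _).1 hb.le (S.x_mem _).2, ← hE,
    ← integral_const_mul]
  have hsq : ∀ t, E.indicator (fun t => u t ^ 2) t = E.indicator u t * u t := fun t => by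
    by_cases ht : t ∈ E
    · simp [ht, sq]
    · simp [ht]
  have hint : Integrable (fun t => E.indicator u t * u t) unitMeasure := by
    obtain ⟨C, hC⟩ := hu.ae_bound
    exact hEu.integrable.mul_bdd (c := C) hu.1.aestronglyMeasurable hC
  rw [integral_congr_ae (Filter.Eventually.of_forall fun t => congrArg (a₀ * ·) (hsq t))]
  refine integral_mono_ae (hint.const_mul a₀) (hρ.integrable_mul hEu.integrable hu) ?_
  filter_upwards [hρ.bounds] with t ht
  rw [mul_comm]
  refine mul_le_mul_of_nonneg_left ht.1 ?_
  rw [← hsq]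
  exact indicator_nonneg (fun t _ => sq_nonneg (u t)) t

lemma integral_abs_sq_le {b : ℕ} (hb : S.x (b + p) < S.x (b + p + 1)) {u : ℝ → ℝ} (hu : Nice u) :
    (∫ t in S.x (b + p)..S.x (b + p + 1), |u t|) ^ 2 ≤
      (S.x (b + p + 1) - S.x (b + p)) * ∫ t in S.x (b + p)..S.x (b + p + 1), u t ^ 2 := by
  obtain ⟨C, hC⟩ := hu.ae_bound
  refine sq_integral_abs_le hb
    (intervalIntegrable_of_unitMeasure hu.integrable (S.x_mem _) (S.x_mem _))
    (intervalIntegrable_of_unitMeasure ?_ (S.x_mem _) (S.x_mem _))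
  simp only [sq]
  exact hu.integrable.mul_bdd (c := C) hu.1.aestronglyMeasurable hC

/-- A broken spline that is orthogonal to all pieces vanishes. -/
lemma IsLocalSpline.eq_zero (hρ : IsWeight a₀ a₁ ρ) {u : ℝ → ℝ} (hs : S.IsLocalSpline u)
    (hu : Nice u) (h : ∀ i < S.n, ∀ e ∈ S.elements i, pairing ρ (S.piece i e) u = 0) :
    ∀ t ∈ Ico (0 : ℝ) 1, u t = 0 := by
  intro t ht
  obtain ⟨b, hbn, hb1, hb2⟩ := S.exists_element ht
  have hb := hb1.trans_lt hb2
  obtain ⟨c, hc⟩ := hs b hb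
  have hen := energy_le hρ hb hu hc
  rw [Finset.sum_eq_zero fun i hi => by
    have hi := Finset.mem_range.1 hi
    rw [h (b + i) (by omega) (b + p) ((S.mem_elements (by omega)).2 ⟨by omega, by omega, hb⟩),
      mul_zero]] at hen
  have h0 : ∫ t in S.x (b + p)..S.x (b + p + 1), u t ^ 2 ≤ 0 := by
    have := hρ.pos
    by_contra hc
    exact absurd hen (not_le.2 (mul_pos this (not_le.1 hc)))
  have hδ : 0 < S.x (b + p + 1) - S.x (b + p) := sub_pos.2 hb
  have h1 := integral_abs_sq_le hb hu
  have h2 : ∫ t in S.x (b + p)..S.x (b + p + 1), |u t| = 0 := by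
    nlinarith [sq_nonneg (∫ t in S.x (b + p)..S.x (b + p + 1), |u t|)]
  -- No uniformity is needed here: all knots lie in `[0, 1]`, so the reciprocal of the element
  -- length is an admissible radius.
  obtain ⟨C, hC, hst⟩ := exists_coeff_le_integral p
    (R := 1 / (S.x (b + p + 1) - S.x (b + p))) (by positivity)
  have h3 := hst S.x S.x_mono b (S.x (b + p)) _ hδ le_rfl (by linarith) (fun k _ _ => by
    rw [one_div_mul_cancel hδ.ne', abs_le]
    have := S.x_mem k
    have := S.x_mem (b + p)
    constructor <;> linarith [this.1, this.2, (S.x_mem k).1, (S.x_mem k).2]) fun i => c (b + i)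
  have h4 : ∫ t in S.x (b + p)..S.x (b + p) + (S.x (b + p + 1) - S.x (b + p)),
      |∑ i ∈ Finset.range (p + 1), c (b + i) * bspline S.x p (b + i) t| = 0 := by
    rw [add_sub_cancel, ← h2]
    simp only [intervalIntegral.integral_of_le hb.le, integral_Ioc_eq_integral_Ioo]
    exact setIntegral_congr_fun measurableSet_Ioo fun s hs => by
      rw [hc s (Ioo_subset_Ico_self hs)]
      rfl
  rw [hc t ⟨hb1, hb2⟩]
  refine Finset.sum_eq_zero fun i hi => ?_
  have h5 := h3 i (Nat.lt_succ_iff.1 (Finset.mem_range.1 hi))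
  rw [h4, mul_zero] at h5
  rw [abs_eq_zero.1 (le_antisymm h5 (abs_nonneg _)), zero_mul]

end Weight

end TraceSplines

/-- Local linear independence of B-splines: by Marsden's identity the spline is a combination of
independent powers, and the element is an infinite set. -/
lemma activeSum_eq_zero {ξ : ℕ → ℝ} (hξ : Monotone ξ) {q b : ℕ} (he : ξ (b + q) < ξ (b + q + 1))
    {c : ℕ → ℝ} (h : ∀ t ∈ Ico (ξ (b + q)) (ξ (b + q + 1)), activeSum ξ q b c t = 0) :
    ∀ i, b ≤ i → i ≤ b + q → c i = 0 := by
  obtain ⟨a, ha⟩ := exists_eq_sum_dualPoly hξ he c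
  have h0 : a = 0 := eq_zero_of_sum_sub_pow_eq_zero (natCast_fin_injective q) (Ico_infinite he)
    fun t ht => by
      rw [← activeSum_dualPoly hξ a ht.1 ht.2, ← activeSum_congr ha]
      exact h t ht
  intro i h1 h2
  rw [ha i h1 h2, h0]
  simp

lemma abs_activeSum_le {ξ : ℕ → ℝ} (hξ : Monotone ξ) {q b : ℕ} {c : ℕ → ℝ} {D : ℝ}
    (hc : ∀ i ≤ q, |c (b + i)| ≤ D) {t : ℝ} (ht : t ∈ Ico (ξ (b + q)) (ξ (b + q + 1))) :
    |activeSum ξ q b c t| ≤ D := by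
  calc |activeSum ξ q b c t| ≤ ∑ i ∈ Finset.range (q + 1), D * bspline ξ q (b + i) t := by
        refine (Finset.abs_sum_le_sum_abs _ _).trans (Finset.sum_le_sum fun i hi => ?_)
        rw [abs_mul, abs_of_nonneg (bspline_nonneg hξ _ _)]
        exact mul_le_mul_of_nonneg_right (hc i (Nat.lt_succ_iff.1 (Finset.mem_range.1 hi)))
          (bspline_nonneg hξ _ _)
    _ = D := by rw [← Finset.mul_sum, sum_bspline_eq_one hξ ht.1 ht.2, mul_one]

/-- `C` is a stability constant for B-splines of degree `p` on intervals inside of an element, if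
the knots nearby are at most `R` times the length of the interval away. -/
def IsStable (p : ℕ) (R C : ℝ) : Prop :=
  0 < C ∧ ∀ ξ : ℕ → ℝ, Monotone ξ → ∀ (b : ℕ) (α δ : ℝ), 0 < δ → ξ (b + p) ≤ α →
    α + δ ≤ ξ (b + p + 1) → (∀ k, b + 1 ≤ k → k ≤ b + 2 * p → |ξ k - α| ≤ R * δ) →
    ∀ (c : ℕ → ℝ), ∀ i ≤ p, |c (b + i)| ≤ C / δ * ∫ t in α..α + δ, |activeSum ξ p b c t|

lemma exists_isStable (p : ℕ) {R : ℝ} (hR : 0 ≤ R) : ∃ C, IsStable p R C := by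
  obtain ⟨C, hC, h⟩ := exists_coeff_le_integral p hR
  exact ⟨C, hC, fun ξ hξ b α δ h1 h2 h3 h4 c i hi =>
    h ξ hξ b α δ h1 h2 h3 h4 (fun i => c (b + i)) i hi⟩

namespace TraceSplines

variable {p : ℕ} {S : TraceSplines p}

/-! ### Mesh size -/

lemma x_succ_sub_le (i : ℕ) : S.x (i + 1) - S.x i ≤ S.h := by
  have hbdd : BddAbove (range fun j : Fin S.n => S.knot (j + 1) - S.knot j) := (finite_range _).bddAbove
  have key : ∀ j : Fin S.n, S.x (j + 1) - S.x j ≤ S.h := fun j => by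
    rw [S.x_of_lt (by have := j.2; omega), S.x_of_lt (by have := j.2; omega)]
    exact le_ciSup hbdd j
  rcases lt_or_ge i S.n with h | h
  · exact key ⟨i, h⟩
  · have h0 : 0 < S.n := (Nat.zero_le p).trans_lt S.isOpen.lt_card
    have h1 := key ⟨0, h0⟩
    have h2 : S.x i = 1 := S.isOpen.clamp_last h
    have h3 : S.x (i + 1) = 1 := S.isOpen.clamp_last (by omega)
    have h4 := S.x_mono (Nat.le_succ 0)
    simp only [Nat.succ_eq_add_one] at h4
    rw [h2, h3, sub_self]
    exact (sub_nonneg.2 h4).trans h1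

lemma x_add_sub_le (i m : ℕ) : S.x (i + m) - S.x i ≤ m * S.h := by
  induction m with
  | zero => simp
  | succ m ih =>
    have := S.x_succ_sub_le (i + m)
    push_cast
    rw [← add_assoc]
    linarith

lemma IsQuasiUniform.h_le {θ : ℝ} (hθ : S.IsQuasiUniform θ) {e : ℕ} (he : S.x e < S.x (e + 1)) :
    S.h ≤ θ * (S.x (e + 1) - S.x e) := by
  have hn := (S.index_of_lt he).2
  rw [S.x_of_lt (by omega), S.x_of_lt (by omega)] at he ⊢
  exact hθ e hn he

lemma h_pos : 0 < S.h := by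
  obtain ⟨b, -, h1, h2⟩ := S.exists_element (t := 0) (by norm_num)
  have := S.x_succ_sub_le (b + p)
  linarith

lemma abs_x_sub_le {b : ℕ} {α : ℝ} (hα : α ∈ Icc (S.x (b + p)) (S.x (b + p + 1))) {k : ℕ}
    (h1 : b + 1 ≤ k) (h2 : k ≤ b + 2 * p) : |S.x k - α| ≤ (p + 1) * S.h := by
  have h3 := S.x_add_sub_le (b + p) p
  have h4 := S.x_add_sub_le b (p + 1)
  push_cast at h4
  have h5 := S.x_mono (show b ≤ k by omega)
  have h6 := S.x_mono (show k ≤ b + p + p by omega)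
  have h7 := S.h_pos
  rw [← add_assoc] at h4
  rw [abs_le]
  constructor <;> nlinarith [hα.1, hα.2]

/-! ### The broken basis -/

lemma card_elements_le (S : TraceSplines p) (i : ℕ) : (S.elements i).card ≤ p + 1 := by
  refine (Finset.card_filter_le _ _).trans ?_
  simp only [Nat.card_Icc]
  omega

namespace IsLocalExtension

variable {κ : ℝ} {φ : ℕ × ℕ → ℝ → ℝ}

lemma nonneg (hφ : S.IsLocalExtension κ φ) : 0 ≤ κ := by
  obtain ⟨-, α, β, h, -⟩ := hφ
  exact (abs_nonneg _).trans (h 0 0 0).1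

lemma nice (hφ : S.IsLocalExtension κ φ) {k : ℕ × ℕ} (hk : k ∈ S.index) : Nice (φ k) := by
  obtain ⟨-, α, -, -, h, -⟩ := hφ
  obtain ⟨h1, h2⟩ := S.mem_index.1 hk
  rw [h k.1 h1 k.2 h2]
  exact Nice.sum fun e _ => (S.nice_piece h1 e).smul _

lemma isLocalSpline (hφ : S.IsLocalExtension κ φ) {k : ℕ × ℕ} (hk : k ∈ S.index) : S.IsLocalSpline (φ k) := by
  obtain ⟨-, α, -, -, h, -⟩ := hφ
  obtain ⟨h1, h2⟩ := S.mem_index.1 hk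
  rw [h k.1 h1 k.2 h2]
  exact IsLocalSpline.sum fun e he => (piece_isLocalSpline h1 he).smul _

lemma abs_le (hφ : S.IsLocalExtension κ φ) {k : ℕ × ℕ} (hk : k ∈ S.index) (t : ℝ) : |φ k t| ≤ (p + 1) * κ := by
  have hκ := hφ.nonneg
  have hcard := S.card_elements_le k.1
  obtain ⟨-, α, β, hα, h, -⟩ := hφ
  obtain ⟨h1, h2⟩ := S.mem_index.1 hk
  rw [h k.1 h1 k.2 h2]
  simp only [Finset.sum_apply, Pi.smul_apply, smul_eq_mul]
  calc _ ≤ ∑ e ∈ S.elements k.1, κ := by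
        refine (Finset.abs_sum_le_sum_abs _ _).trans (Finset.sum_le_sum fun e _ => ?_)
        rw [abs_mul]
        have h3 : |S.piece k.1 e t| ≤ 1 := by
          refine (norm_indicator_le_norm_self (S.B k.1) t).trans ?_
          rw [Real.norm_of_nonneg (S.B_nonneg h1 t)]
          exact S.B_le_one h1 t
        calc _ ≤ κ * 1 := mul_le_mul (hα _ _ _).1 h3 (abs_nonneg _) hκ
          _ = κ := mul_one κ
    _ ≤ _ := by
        rw [Finset.sum_const, nsmul_eq_mul]
        exact mul_le_mul_of_nonneg_right (by exact_mod_cast hcard) hκ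

lemma eq_zero (hφ : S.IsLocalExtension κ φ) {k : ℕ × ℕ} (hk : k ∈ S.index) {t : ℝ}
    (ht : t ∉ Ico (S.x k.1) (S.x (k.1 + p + 1))) : φ k t = 0 := by
  obtain ⟨-, α, -, -, h, -⟩ := hφ
  obtain ⟨h1, h2⟩ := S.mem_index.1 hk
  rw [h k.1 h1 k.2 h2]
  simp only [Finset.sum_apply, Pi.smul_apply, smul_eq_mul]
  refine Finset.sum_eq_zero fun e _ => ?_
  rw [piece, indicator_apply, S.B_eq_zero h1 ht, ite_self, mul_zero]

end IsLocalExtension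

/-- Index set of the pieces. -/
def pieceIndex (S : TraceSplines p) : Finset (ℕ × ℕ) :=
  (Finset.range S.n ×ˢ Finset.range S.n).filter fun k => k.2 ∈ S.elements k.1

lemma mem_pieceIndex {k : ℕ × ℕ} : k ∈ S.pieceIndex ↔ k.1 < S.n ∧ k.2 ∈ S.elements k.1 := by
  simp only [pieceIndex, Finset.mem_filter, Finset.mem_product, Finset.mem_range]
  refine ⟨fun h => ⟨h.1.1, h.2⟩, fun h => ⟨⟨h.1, ?_⟩, h.2⟩⟩
  exact (S.index_of_lt ((S.mem_elements h.1).1 h.2).2.2).2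

/-- For each `i` both families have `n_i` members. -/
lemma card_pieceIndex : S.pieceIndex.card = S.index.card := by
  rw [pieceIndex, index, Finset.card_filter, Finset.card_filter, Finset.sum_product,
    Finset.sum_product]
  refine Finset.sum_congr rfl fun i hi => ?_
  rw [← Finset.card_filter, ← Finset.card_filter]
  have hi := Finset.mem_range.1 hi
  have h1 : (Finset.range S.n).filter (fun e => e ∈ S.elements i) = S.elements i := by
    ext e
    simp only [Finset.mem_filter, Finset.mem_range, and_iff_right_iff_imp]
    exact fun he => (S.index_of_lt ((S.mem_elements hi).1 he).2.2).2
  have h2 : (Finset.range (p + 1)).filter (fun j => j < (S.elements i).card) =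
      Finset.range (S.elements i).card := by
    ext j
    simp only [Finset.mem_filter, Finset.mem_range, and_iff_right_iff_imp]
    refine fun hj => hj.trans_le ((Finset.card_filter_le _ _).trans ?_)
    simp only [Nat.card_Icc]
    omega
  rw [h1, h2, Finset.card_range]

/-- On a fixed element all other pieces vanish, and those that remain are the active B-splines,
which are locally independent. -/
lemma linearIndependent_piece :
    LinearIndependent ℝ fun k : S.pieceIndex => S.piece (k : ℕ × ℕ).1 (k : ℕ × ℕ).2 := by
  refine linearIndepOn_finset_iff (v := fun k : ℕ × ℕ => S.piece k.1 k.2).2 fun g hg k hk => ?_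
  obtain ⟨hk1, hk2⟩ := mem_pieceIndex.1 hk
  obtain ⟨h1, h2, h3⟩ := (S.mem_elements hk1).1 hk2
  have hkn := (S.index_of_lt h3).2
  obtain ⟨b, hb⟩ : ∃ b, k.2 = b + p := ⟨k.2 - p, by have := S.index_of_lt h3; omega⟩
  rw [hb] at h3 hkn
  have := activeSum_eq_zero S.x_mono h3 (c := fun m => g (m, b + p)) (fun t ht => by
    have h4 := congrFun hg t
    simp only [Finset.sum_apply, Pi.smul_apply, smul_eq_mul, Pi.zero_apply] at h4
    rw [activeSum_eq_sum_B hkn, ← h4]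
    refine Finset.sum_bij_ne_zero (fun i _ _ => (b + i, b + p)) (fun i hi _ => ?_)
      (fun i _ _ j _ _ h => ?_) (fun l hl hne => ?_) (fun i hi _ => ?_)
    · have := Finset.mem_range.1 hi
      exact mem_pieceIndex.2 ⟨show b + i < S.n by omega,
        (S.mem_elements (by omega)).2 ⟨by omega, by omega, h3⟩⟩
    · simpa using congrArg Prod.fst h
    · obtain ⟨hl1, hl2⟩ := mem_pieceIndex.1 hl
      obtain ⟨h5, h6, h7⟩ := (S.mem_elements hl1).1 hl2
      have hlb : l.2 = b + p := by
        by_contra hc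
        rw [S.piece_eq (S.index_of_lt h7).2,
          indicator_of_notMem (disjoint_elements (Ne.symm hc) ht), mul_zero] at hne
        exact hne rfl
      rw [S.piece_eq (S.index_of_lt h7).2, hlb, indicator_of_mem ht] at hne
      have hl : l = (b + (l.1 - b), b + p) := Prod.ext (by simp only; omega) hlb
      refine ⟨l.1 - b, Finset.mem_range.2 (by omega), ?_, hl.symm⟩
      rw [Nat.add_sub_cancel' (by omega)]
      convert hne using 2
      rw [← hlb]
    · simp only
      rw [S.piece_eq hkn, indicator_of_mem ht]) k.1 (by omega) (by omega)
  rw [← this, ← hb]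

namespace IsLocalExtension

variable {κ : ℝ} {φ : ℕ × ℕ → ℝ → ℝ}

/-- The `φ_k` span the independent pieces and there are equally many of both. -/
lemma linearIndependent (hφ : S.IsLocalExtension κ φ) : LinearIndependent ℝ fun k : S.index => φ k := by
  rw [linearIndependent_iff_card_le_finrank_span, Set.finrank]
  have h1 := finrank_span_eq_card S.linearIndependent_piece
  rw [Fintype.card_coe, S.card_pieceIndex, ← Fintype.card_coe] at h1
  rw [← h1]
  have : FiniteDimensional ℝ (Submodule.span ℝ (range fun k : S.index => φ k)) :=
    FiniteDimensional.span_of_finite ℝ (finite_range _)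
  refine Submodule.finrank_mono (Submodule.span_le.2 ?_)
  rintro _ ⟨k, rfl⟩
  obtain ⟨-, α, β, -, -, h⟩ := hφ
  obtain ⟨hk1, hk2⟩ := mem_pieceIndex.1 k.2
  simp only [SetLike.mem_coe]
  rw [h _ hk1 _ hk2]
  refine Submodule.sum_mem _ fun j hj => Submodule.smul_mem _ _ (Submodule.subset_span ?_)
  exact ⟨⟨(k.1.1, j), S.mem_index.2 ⟨hk1, Finset.mem_range.1 hj⟩⟩, rfl⟩

/-! ### The mass matrix, the biorthogonal basis and its size -/

section Weight

variable {a₀ a₁ : ℝ} {ρ : ℝ → ℝ}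

lemma eq_zero_of_pairing (hφ : S.IsLocalExtension κ φ) (hρ : IsWeight a₀ a₁ ρ)
    {u : ℝ → ℝ} (hs : S.IsLocalSpline u) (hu : Nice u)
    (h : ∀ k ∈ S.index, pairing ρ (φ k) u = 0) : ∀ t ∈ Ico (0 : ℝ) 1, u t = 0 := by
  refine hs.eq_zero hρ hu fun i hi e he => ?_
  have hnice : ∀ j ∈ Finset.range (S.elements i).card, Nice (φ (i, j)) := fun j hj =>
    hφ.nice (S.mem_index.2 ⟨hi, Finset.mem_range.1 hj⟩)
  obtain ⟨-, α, β, -, -, hβ⟩ := hφ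
  rw [hβ i hi e he, pairing_sum_left hρ _ _ hnice hu]
  exact Finset.sum_eq_zero fun j hj => by
    rw [h (i, j) (S.mem_index.2 ⟨hi, Finset.mem_range.1 hj⟩), mul_zero]

/-- A vector in the kernel gives a broken spline orthogonal to the whole basis, hence zero on `[0,
1)`. It vanishes outside trivially, and linear independence applies. -/
lemma isUnit_gram (hφ : S.IsLocalExtension κ φ) (hρ : IsWeight a₀ a₁ ρ)
    : IsUnit (S.gram ρ φ) := by
  rw [← Matrix.mulVec_injective_iff_isUnit]
  rw [← Matrix.coe_mulVecLin, ← LinearMap.ker_eq_bot, LinearMap.ker_eq_bot']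
  intro d hd
  set u : ℝ → ℝ := ∑ l : S.index, d l • φ l with hu
  have hnice : ∀ l ∈ (Finset.univ : Finset S.index), Nice (φ l) := fun l _ => hφ.nice l.2
  have h0 : ∀ t ∈ Ico (0 : ℝ) 1, u t = 0 := by
    refine hφ.eq_zero_of_pairing hρ (IsLocalSpline.sum fun l _ => (hφ.isLocalSpline l.2).smul _)
      (Nice.sum fun l _ => (hφ.nice l.2).smul _) fun k hk => ?_
    rw [hu, pairing_sum_right hρ _ _ hnice (hφ.nice hk)]
    have := congrFun hd ⟨k, hk⟩
    simp only [Matrix.mulVecLin_apply, Matrix.mulVec, dotProduct, gram, Matrix.of_apply,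
      Pi.zero_apply] at this
    rw [← this]
    exact Finset.sum_congr rfl fun l _ => mul_comm _ _
  have h1 : u = 0 := by
    funext t
    by_cases ht : t ∈ Ico (0 : ℝ) 1
    · exact h0 t ht
    · simp only [hu, Finset.sum_apply, Pi.smul_apply, smul_eq_mul, Pi.zero_apply]
      refine Finset.sum_eq_zero fun l _ => ?_
      rw [hφ.eq_zero l.2 fun h => ht ⟨(S.x_mem _).1.trans h.1, h.2.trans_le (S.x_mem _).2⟩,
        mul_zero]
  funext l
  exact Fintype.linearIndependent_iff.1 hφ.linearIndependent d h1 l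

lemma nice_psiTilde (hφ : S.IsLocalExtension κ φ) (k : ℕ × ℕ) : Nice (S.psiTilde ρ φ k) := by
  unfold psiTilde
  split_ifs with hk
  · exact Nice.sum fun l _ => (hφ.nice l.2).smul _
  · exact Nice.zero

lemma psiTilde_isLocalSpline (hφ : S.IsLocalExtension κ φ) (k : ℕ × ℕ) : S.IsLocalSpline (S.psiTilde ρ φ k) := by
  unfold psiTilde
  split_ifs with hk
  · exact IsLocalSpline.sum fun l _ => (hφ.isLocalSpline l.2).smul _
  · exact IsLocalSpline.zero

lemma pairing_psiTilde (hφ : S.IsLocalExtension κ φ) (hρ : IsWeight a₀ a₁ ρ)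
    {k l : ℕ × ℕ} (hk : k ∈ S.index) (hl : l ∈ S.index) :
    pairing ρ (S.psiTilde ρ φ k) (φ l) = if k = l then 1 else 0 := by
  rw [psiTilde, dif_pos hk, pairing_sum_left hρ _ _ (fun m _ => hφ.nice m.2) (hφ.nice hl)]
  have h1 : (S.gram ρ φ)⁻¹ * S.gram ρ φ = 1 :=
    Matrix.nonsing_inv_mul _ ((Matrix.isUnit_iff_isUnit_det _).1 (hφ.isUnit_gram hρ))
  have h2 := congrFun (congrFun h1 ⟨k, hk⟩) ⟨l, hl⟩
  rw [Matrix.mul_apply, Matrix.one_apply] at h2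
  simp only [gram, Matrix.of_apply, Subtype.mk.injEq] at h2 ⊢
  exact h2

/-- Expansion of a broken spline in the biorthogonal basis. -/
lemma sum_pairing_smul_psiTilde (hφ : S.IsLocalExtension κ φ) (hρ : IsWeight a₀ a₁ ρ)
    {u : ℝ → ℝ} (hs : S.IsLocalSpline u) (hu : Nice u) :
    ∀ t ∈ Ico (0 : ℝ) 1, (∑ k ∈ S.index, pairing ρ u (φ k) • S.psiTilde ρ φ k) t = u t := by
  intro t ht
  set w : ℝ → ℝ := ∑ k ∈ S.index, pairing ρ u (φ k) • S.psiTilde ρ φ k with hw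
  have hwn : Nice w := Nice.sum fun k _ => (hφ.nice_psiTilde k).smul _
  have hws : S.IsLocalSpline w := IsLocalSpline.sum fun k _ => (hφ.psiTilde_isLocalSpline k).smul _
  have h1 := hφ.eq_zero_of_pairing hρ (u := w + (-1 : ℝ) • u) (hws.add (hs.smul _))
    (hwn.add (hu.smul _)) (fun l hl => by
      rw [pairing_comm, show w + (-1 : ℝ) • u = w - u by rw [neg_one_smul, sub_eq_add_neg],
        pairing_sub_left hρ hwn.integrable hu.integrable (hφ.nice hl), hw,
        pairing_sum_left hρ _ _ (fun k _ => hφ.nice_psiTilde k) (hφ.nice hl),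
        Finset.sum_eq_single_of_mem l hl fun k hk hne => by
          rw [hφ.pairing_psiTilde hρ hk hl, if_neg hne, mul_zero],
        hφ.pairing_psiTilde hρ hl hl, if_pos rfl, mul_one, sub_self]) t ht
  simp only [Pi.add_apply, Pi.smul_apply, smul_eq_mul] at h1
  linarith

/-- A piece of `B_i` is a combination of `φ (i, j)` with coefficients at most `κ`, and
biorthogonality picks out at most one of these coefficients. This is where the second
change-of-basis matrix enters. -/
lemma pairing_piece_psiTilde (hφ : S.IsLocalExtension κ φ) (hρ : IsWeight a₀ a₁ ρ)
    {k : ℕ × ℕ} (hk : k ∈ S.index) {i e : ℕ} (hi : i < S.n)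
    (he : e ∈ S.elements i) : (i ≠ k.1 → pairing ρ (S.piece i e) (S.psiTilde ρ φ k) = 0) ∧
      |pairing ρ (S.piece i e) (S.psiTilde ρ φ k)| ≤ κ := by
  have hκ := hφ.nonneg
  have hmem : ∀ j ∈ Finset.range (S.elements i).card, (i, j) ∈ S.index := fun j hj =>
    S.mem_index.2 ⟨hi, Finset.mem_range.1 hj⟩
  have h := hφ
  obtain ⟨-, α, β, hb, -, hβ⟩ := h
  rw [hβ i hi e he, pairing_sum_left hρ _ _ (fun j hj => hφ.nice (hmem j hj))
    (hφ.nice_psiTilde k), Finset.sum_congr rfl fun j hj => by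
      rw [pairing_comm, hφ.pairing_psiTilde hρ hk (hmem j hj)]]
  constructor
  · intro hne
    exact Finset.sum_eq_zero fun j _ => by
      rw [if_neg fun h => hne (by rw [h]), mul_zero]
  · by_cases hki : k.1 = i ∧ k.2 < (S.elements i).card
    · rw [Finset.sum_eq_single_of_mem k.2 (Finset.mem_range.2 hki.2) fun j _ hj => by
        rw [if_neg fun h => hj (by rw [h]), mul_zero], if_pos (show k = (i, k.2) from Prod.ext hki.1 rfl), mul_one]
      exact (hb _ _ _).2
    · rw [Finset.sum_eq_zero fun j hj => by
        rw [if_neg fun h => hki (by rw [h]; exact ⟨rfl, Finset.mem_range.1 hj⟩), mul_zero], abs_zero]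
      exact hκ

/-- The biorthogonal functions are bounded on the elements in the support of the B-spline to which
they belong, and vanish elsewhere. -/
lemma abs_psiTilde_le (hφ : S.IsLocalExtension κ φ) (hρ : IsWeight a₀ a₁ ρ)
    {θ R C : ℝ} (hθ : S.IsQuasiUniform θ) (hC : IsStable p R C)
    (hR : (p + 1) * θ ≤ R) {k : ℕ × ℕ} (hk : k ∈ S.index) {b : ℕ}
    (hb : S.x (b + p) < S.x (b + p + 1)) {t : ℝ}
    (ht : t ∈ Ico (S.x (b + p)) (S.x (b + p + 1))) :
    (¬ (b ≤ k.1 ∧ k.1 ≤ b + p) → S.psiTilde ρ φ k t = 0) ∧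
      |S.psiTilde ρ φ k t| ≤ C ^ 2 * κ / ((S.x (b + p + 1) - S.x (b + p)) * a₀) := by
  have hκ := hφ.nonneg
  have ha₀ := hρ.pos
  have hbn := (S.index_of_lt hb).2
  set δ := S.x (b + p + 1) - S.x (b + p) with hδ
  have hδ0 : 0 < δ := sub_pos.2 hb
  set u := S.psiTilde ρ φ k with hu
  have hun : Nice u := hφ.nice_psiTilde k
  obtain ⟨c, hc⟩ : ∃ c : ℕ → ℝ, ∀ t ∈ Ico (S.x (b + p)) (S.x (b + p + 1)),
      u t = activeSum S.x p b c t := hφ.psiTilde_isLocalSpline k b hb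
  set E := ∫ t in S.x (b + p)..S.x (b + p + 1), u t ^ 2 with hE
  -- The only coefficient that can enter the energy. The value zero on inactive elements treats the
  -- vanishing of `ψ̃_k` there by the same estimate.
  set T : ℝ := if b ≤ k.1 ∧ k.1 ≤ b + p then |c k.1| else 0 with hT
  set D := C ^ 2 * κ / (δ * a₀) with hD
  have hD0 : 0 ≤ D := by positivity
  have hen : a₀ * E ≤ κ * T := by
    refine (energy_le hρ hb hun hc).trans ?_
    have hz : ∀ i ∈ Finset.range (p + 1), b + i ≠ k.1 →
        c (b + i) * pairing ρ (S.piece (b + i) (b + p)) u = 0 := fun i hi hne => by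
      have := Finset.mem_range.1 hi
      rw [(hφ.pairing_piece_psiTilde hρ hk (show b + i < S.n by omega)
        ((S.mem_elements (by omega)).2 ⟨by omega, by omega, hb⟩)).1 hne, mul_zero]
    by_cases hact : b ≤ k.1 ∧ k.1 ≤ b + p
    · rw [hT, if_pos hact, Finset.sum_eq_single_of_mem (k.1 - b) (by simp; omega)
        fun i hi hne => hz i hi (by omega), Nat.add_sub_cancel' hact.1]
      refine (le_abs_self _).trans ?_
      rw [abs_mul, mul_comm κ]
      exact mul_le_mul_of_nonneg_left (hφ.pairing_piece_psiTilde hρ hk (show k.1 < S.n by omega)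
        ((S.mem_elements (by omega)).2 ⟨by omega, by omega, hb⟩)).2 (abs_nonneg _)
    · rw [hT, if_neg hact, mul_zero, Finset.sum_eq_zero fun i hi => hz i hi (by
        have := Finset.mem_range.1 hi
        omega)]
  have hint : ∫ t in S.x (b + p)..S.x (b + p) + δ, |activeSum S.x p b c t| =
      ∫ t in S.x (b + p)..S.x (b + p + 1), |u t| := by
    rw [hδ, add_sub_cancel]
    simp only [intervalIntegral.integral_of_le hb.le, integral_Ioc_eq_integral_Ioo]
    exact setIntegral_congr_fun measurableSet_Ioo fun s hs => by
      rw [hc s (Ioo_subset_Ico_self hs)]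
  have hcs := integral_abs_sq_le hb hun
  -- Stability, Cauchy-Schwarz and the energy bound are combined. The estimate is quadratic on the
  -- left and linear in `T` on the right, so the index `k.1` gives `T ≤ D`, and then every
  -- coefficient is at most `D`.
  have hcoef : ∀ i ≤ p, |c (b + i)| ^ 2 ≤ D * T := by
    intro i hi
    have h1 := hC.2 S.x S.x_mono b (S.x (b + p)) δ hδ0 le_rfl (by linarith) (fun m hm hm' => by
      refine (S.abs_x_sub_le (left_mem_Icc.2 hb.le) hm hm').trans ?_
      have h2 := hθ.h_le hb
      rw [← hδ] at h2
      calc (p + 1) * S.h ≤ (p + 1) * (θ * δ) := by gcongr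
        _ = (p + 1) * θ * δ := by ring
        _ ≤ R * δ := by gcongr) c i hi
    rw [hint] at h1
    have hC0 := hC.1
    calc |c (b + i)| ^ 2 ≤ (C / δ * ∫ t in S.x (b + p)..S.x (b + p + 1), |u t|) ^ 2 :=
          pow_le_pow_left₀ (abs_nonneg _) h1 2
      _ = (C / δ) ^ 2 * (∫ t in S.x (b + p)..S.x (b + p + 1), |u t|) ^ 2 := mul_pow _ _ _
      _ ≤ (C / δ) ^ 2 * (δ * E) := mul_le_mul_of_nonneg_left hcs (sq_nonneg _)
      _ = C ^ 2 / (δ * a₀) * (a₀ * E) := by field_simp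
      _ ≤ C ^ 2 / (δ * a₀) * (κ * T) := mul_le_mul_of_nonneg_left hen (by positivity)
      _ = D * T := by rw [hD]; ring
  by_cases hact : b ≤ k.1 ∧ k.1 ≤ b + p
  · refine ⟨fun h => absurd hact h, ?_⟩
    have hTD : T ≤ D := by
      have h1 := hcoef (k.1 - b) (by omega)
      rw [Nat.add_sub_cancel' hact.1] at h1
      rw [hT, if_pos hact] at h1 ⊢
      by_contra hc
      nlinarith [not_le.1 hc, abs_nonneg (c k.1)]
    rw [hc t ht]
    refine abs_activeSum_le S.x_mono (fun i hi => ?_) ht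
    exact abs_le_of_sq_le_sq (by
      have := hcoef i hi
      rw [sq_abs] at this
      nlinarith) hD0
  · have h0 : u t = 0 := by
      rw [hc t ht]
      refine Finset.sum_eq_zero fun i hi => ?_
      have h1 := hcoef i (Nat.lt_succ_iff.1 (Finset.mem_range.1 hi))
      rw [hT, if_neg hact, mul_zero] at h1
      have h2 : |c (b + i)| = 0 := pow_eq_zero_iff two_ne_zero |>.1 (le_antisymm h1 (sq_nonneg _))
      rw [abs_eq_zero.1 h2, zero_mul]
    refine ⟨fun _ => h0, ?_⟩
    rw [h0, abs_zero]
    exact hD0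

end Weight

end IsLocalExtension

end TraceSplines

lemma IsWeight.abs_pairing_le {a₀ a₁ : ℝ} {ρ : ℝ → ℝ} (hρ : IsWeight a₀ a₁ ρ) {A B M : ℝ}
    {u v : ℝ → ℝ} (hA : 0 ≤ A) (hAB : A ≤ B) (hB : B ≤ 1)
    (h : ∀ᵐ t ∂unitMeasure, t ∈ Ico A B → |u t * v t| ≤ M) (h0 : ∀ t ∉ Ico A B, v t = 0) :
    |pairing ρ u v| ≤ M * a₁ * (B - A) := by
  have h1 : ∫ t, (Ico A B).indicator (fun _ => M * a₁) t ∂unitMeasure = M * a₁ * (B - A) := by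
    rw [integral_indicator_unitMeasure hA hAB hB, intervalIntegral.integral_const, smul_eq_mul,
      mul_comm]
  rw [pairing_eq, ← h1, ← Real.norm_eq_abs]
  refine norm_integral_le_of_norm_le ?_ ?_
  · exact (integrable_const (μ := unitMeasure) (M * a₁)).indicator measurableSet_Ico
  · filter_upwards [h, hρ.bounds, hρ.nonneg_ae] with t h2 h3 h4
    by_cases ht : t ∈ Ico A B
    · rw [indicator_of_mem ht, Real.norm_eq_abs, abs_mul, abs_of_nonneg h4]
      exact mul_le_mul (h2 ht) h3.2 h4 ((abs_nonneg _).trans (h2 ht))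
    · rw [indicator_of_notMem ht, h0 t ht]
      simp

/-! ### Products of linear factors -/

/-- Pigeonhole: take `p + 1` adjacent intervals of length `3 * η`. A point within distance less than
`η` of the middle third lies strictly inside of its interval, so at most `p` middle thirds are
spoiled. -/
lemma exists_interval_far {L : List ℝ} {p : ℕ} (hL : L.length ≤ p) (x : ℝ) {η : ℝ} (hη : 0 < η) :
    ∃ j : ℕ, j ≤ p ∧ ∀ τ ∈ L, ∀ t ∈ Icc (x + (3 * j + 1) * η) (x + (3 * j + 1) * η + η),
      η ≤ |τ - t| := by
  by_contra! h
  have h1 : ∀ j : Fin (p + 1), ∃ τ ∈ L, x + 3 * (j : ℕ) * η < τ ∧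
      τ < x + 3 * ((j : ℕ) + 1) * η := fun j => by
    obtain ⟨τ, hτ, t, ht, hlt⟩ := h j (Nat.lt_succ_iff.1 j.2)
    rw [abs_lt] at hlt
    exact ⟨τ, hτ, by nlinarith [ht.1], by nlinarith [ht.2]⟩
  choose τ hτ h2 h3 using h1
  have hlt : ∀ i j : Fin (p + 1), i < j → τ i < τ j := fun i j hij => by
    refine (h3 i).trans_le (le_trans ?_ (h2 j).le)
    have : ((i : ℕ) : ℝ) + 1 ≤ (j : ℕ) := by exact_mod_cast Nat.succ_le_of_lt hij
    nlinarith
  have hinj : Function.Injective τ := (show StrictMono τ from fun i j => hlt i j).injective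
  have h4 := Finset.card_le_card_of_injOn (s := Finset.univ) (t := L.toFinset) τ
    (fun i _ => by simpa using hτ i) hinj.injOn
  have h5 := L.toFinset_card_le
  simp only [Finset.card_univ, Fintype.card_fin] at h4
  omega

lemma pow_length_le_abs_prod {η t : ℝ} (hη : 0 ≤ η) {L : List ℝ} (h : ∀ τ ∈ L, η ≤ |τ - t|) :
    η ^ L.length ≤ |(L.map fun τ => τ - t).prod| := by
  induction L with
  | nil => simp
  | cons a L ih =>
    simp only [List.length_cons, List.map_cons, List.prod_cons, abs_mul, pow_succ']
    exact mul_le_mul (h a (by simp)) (ih fun τ hτ => h τ (by simp [hτ])) (by positivity)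
      (abs_nonneg _)

lemma abs_prod_le_pow_length {M t : ℝ} {L : List ℝ} (h : ∀ τ ∈ L, |τ - t| ≤ M) :
    |(L.map fun τ => τ - t).prod| ≤ M ^ L.length := by
  induction L with
  | nil => simp
  | cons a L ih =>
    simp only [List.length_cons, List.map_cons, List.prod_cons, abs_mul, pow_succ']
    have h1 := h a (by simp)
    exact mul_le_mul h1 (ih fun τ hτ => h τ (by simp [hτ])) (abs_nonneg _)
      ((abs_nonneg _).trans h1)

lemma exists_polynomial_eval_eq_prod (L : List ℝ) :
    ∃ P : Polynomial ℝ, P.natDegree ≤ L.length ∧ ∀ t, P.eval t = (L.map fun τ => τ - t).prod := by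
  induction L with
  | nil => exact ⟨1, by simp, by simp⟩
  | cons a L ih =>
    obtain ⟨P, hP, h⟩ := ih
    refine ⟨(Polynomial.C a - Polynomial.X) * P, ?_, fun t => by simp [h]⟩
    refine Polynomial.natDegree_mul_le.trans ?_
    have : (Polynomial.C a - Polynomial.X).natDegree ≤ 1 :=
      (Polynomial.natDegree_sub_le _ _).trans (by simp)
    simp only [List.length_cons]
    omega

namespace TraceSplines

variable {p : ℕ} {S : TraceSplines p}

/-! ### The local systems -/

section LocalSystem

variable {ρ : ℝ → ℝ} {φ : ℕ × ℕ → ℝ → ℝ}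
  {q : Module.Basis (Fin (p + 1)) ℝ (Polynomial.degreeLT ℝ (p + 1))}
  {Iloc : ℕ × ℕ → Finset ℕ} {k : ℕ × ℕ}

lemma solvesLocalSystem_iff {z : ℕ → ℝ} : S.SolvesLocalSystem ρ φ q Iloc k z ↔
    (∀ i ∉ Iloc k, z i = 0) ∧ (S.localMatrix ρ q Iloc k).mulVec (fun i => z i) =
      fun l => pairing ρ (fun t => (q l : Polynomial ℝ).eval t) (φ k) := by
  rw [SolvesLocalSystem, funext_iff]
  refine and_congr_right fun _ => forall_congr' fun l => ?_
  rw [← Finset.sum_coe_sort]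
  rfl

/-- Rank `p + 1` is the number of rows, which gives surjectivity; the system is square, so it is
injective as well. -/
lemma bijective_localMatrix (hcard : (Iloc k).card = p + 1)
    (hr : (S.localMatrix ρ q Iloc k).rank = p + 1) :
    Function.Bijective (S.localMatrix ρ q Iloc k).mulVec := by
  have h1 : Function.Surjective (S.localMatrix ρ q Iloc k).mulVecLin := by
    rw [← LinearMap.range_eq_top]
    refine Submodule.eq_top_of_finrank_eq ?_
    rw [Module.finrank_fin_fun]
    exact hr
  have h2 : Function.Injective (S.localMatrix ρ q Iloc k).mulVecLin := by
    refine (LinearMap.injective_iff_surjective_of_finrank_eq_finrank ?_).2 h1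
    rw [Module.finrank_fin_fun, Module.finrank_fintype_fun_eq_card, Fintype.card_coe, hcard]
  exact ⟨h2, h1⟩

lemma solvesLocalSystem_zCoeff (hcard : (Iloc k).card = p + 1)
    (hr : (S.localMatrix ρ q Iloc k).rank = p + 1) :
    S.SolvesLocalSystem ρ φ q Iloc k (S.zCoeff ρ φ q Iloc k) := by
  classical
  have h : ∃ z, S.SolvesLocalSystem ρ φ q Iloc k z := by
    obtain ⟨y, hy⟩ := (bijective_localMatrix hcard hr).2
      fun l => pairing ρ (fun t => (q l : Polynomial ℝ).eval t) (φ k)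
    refine ⟨fun i => if hi : i ∈ Iloc k then y ⟨i, hi⟩ else 0,
      solvesLocalSystem_iff.2 ⟨fun i hi => dif_neg hi, ?_⟩⟩
    rw [← hy]
    congr 1
    funext i
    simp
  rw [zCoeff, dif_pos h]
  exact h.choose_spec

lemma solvesLocalSystem_iff_eq_zCoeff (hcard : (Iloc k).card = p + 1)
    (hr : (S.localMatrix ρ q Iloc k).rank = p + 1) {z : ℕ → ℝ} :
    S.SolvesLocalSystem ρ φ q Iloc k z ↔ z = S.zCoeff ρ φ q Iloc k := by
  have h0 := solvesLocalSystem_zCoeff (φ := φ) hcard hr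
  refine ⟨fun h => ?_, fun h => h ▸ h0⟩
  obtain ⟨h1, h2⟩ := solvesLocalSystem_iff.1 h
  obtain ⟨h3, h4⟩ := solvesLocalSystem_iff.1 h0
  have h5 := (bijective_localMatrix hcard hr).1 (h2.trans h4.symm)
  funext i
  by_cases hi : i ∈ Iloc k
  · exact congrFun h5 ⟨i, hi⟩
  · rw [h1 i hi, h3 i hi]

lemma pairing_polynomial {a₀ a₁ : ℝ} (hρ : IsWeight a₀ a₁ ρ) {P : Polynomial ℝ}
    (hP : P.natDegree ≤ p)
    (q : Module.Basis (Fin (p + 1)) ℝ (Polynomial.degreeLT ℝ (p + 1))) :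
    ∃ d : Fin (p + 1) → ℝ, ∀ v : ℝ → ℝ, Nice v → pairing ρ (fun t => P.eval t) v =
      ∑ l, d l * pairing ρ (fun t => (q l : Polynomial ℝ).eval t) v := by
  have hPm : P ∈ Polynomial.degreeLT ℝ (p + 1) := by
    rw [Polynomial.mem_degreeLT]
    exact (Polynomial.degree_le_natDegree).trans_lt (by exact_mod_cast Nat.lt_succ_of_le hP)
  refine ⟨q.repr ⟨P, hPm⟩, fun v hv => ?_⟩
  rw [← pairing_sum_left hρ _ _ (fun l _ => Nice.eval _) hv]
  congr 1
  funext t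
  have h1 := congrArg (fun Q : Polynomial.degreeLT ℝ (p + 1) => (Q : Polynomial ℝ).eval t)
    (q.sum_repr ⟨P, hPm⟩)
  simp only [Submodule.coe_sum, Submodule.coe_smul, Polynomial.eval_finsetSum,
    Polynomial.eval_smul] at h1
  rw [← h1]
  simp

/-- By linearity the moments agree for all polynomials of degree at most `p`. The basis `q` thus
disappears from the estimates, and any test polynomial may be chosen. -/
lemma SolvesLocalSystem.sum_pairing_mul {a₀ a₁ : ℝ} (hρ : IsWeight a₀ a₁ ρ) {z : ℕ → ℝ}
    (hz : S.SolvesLocalSystem ρ φ q Iloc k z) (hI : Iloc k ⊆ S.bsp) (hφ : Nice (φ k))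
    {P : Polynomial ℝ} (hP : P.natDegree ≤ p) :
    ∑ i ∈ Iloc k, pairing ρ (fun t => P.eval t) (S.B i) * z i =
      pairing ρ (fun t => P.eval t) (φ k) := by
  obtain ⟨d, hd⟩ := pairing_polynomial hρ hP q
  rw [hd _ hφ, Finset.sum_congr rfl fun i hi => by
    rw [hd _ (S.nice_B (S.mem_bsp_lt (hI hi))), Finset.sum_mul], Finset.sum_comm]
  refine Finset.sum_congr rfl fun l _ => ?_
  rw [← hz.2 l, Finset.mul_sum]
  exact Finset.sum_congr rfl fun i _ => mul_assoc _ _ _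

end LocalSystem

/-! ### Bound for the coefficients -/

lemma represents_sum {T : Finset ℕ} (hT : ∀ i ∈ T, i < S.n) {z : ℕ → ℝ} (hz : ∀ i ∉ T, z i = 0) :
    Represents S.x p z (S.x p) 1 fun t => ∑ i ∈ T, z i * S.B i t := by
  intro b t _ _ h1 h2
  have hb := (S.index_of_lt (h1.trans_lt h2)).2
  rw [← sum_range_eq_activeSum S.x_mono hb h1 h2 z]
  have h3 : ∀ i ∈ Finset.range S.n, z i * bspline S.x p i t = z i * S.B i t := fun i hi => by
    rw [S.B_eq (Finset.mem_range.1 hi)]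
  rw [Finset.sum_congr rfl h3]
  refine (Finset.sum_subset (fun i hi => Finset.mem_range.2 (hT i hi)) fun i _ hi => ?_).symm
  rw [hz i hi, zero_mul]

/-- The bound for the solutions of the local systems. -/
def zBound (p r : ℕ) (a₀ a₁ θ κ C : ℝ) : ℝ :=
  C * a₁ * ((p + 1) * κ) / a₀ * (3 * (p + 1) * (2 * r + p + 1) * θ) ^ (p + 1)

/-- A spline with `p + 1` coefficients is controlled by its moments of degree at most `p`, if these
are the moments of a broken basis function with a support nearby. -/
lemma abs_le_zBound {a₀ a₁ θ κ C : ℝ} {r : ℕ} {ρ : ℝ → ℝ} {φ : ℕ × ℕ → ℝ → ℝ}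
    (hρ : IsWeight a₀ a₁ ρ) (hφ : S.IsLocalExtension κ φ) (hθ : S.IsQuasiUniform θ)
    (hC : IsStable p (3 * (p + 1) ^ 2 * θ) C) {k : ℕ × ℕ} (hk : k ∈ S.index) {T : Finset ℕ}
    (hT : ∀ i ∈ T, i < S.n) (hcard : T.card ≤ p + 1) (hloc : ∀ i ∈ T, i ≤ k.1 + r ∧ k.1 ≤ i + r)
    {z : ℕ → ℝ} (hz : ∀ i ∉ T, z i = 0)
    (hmom : ∀ P : Polynomial ℝ, P.natDegree ≤ p →
      ∑ i ∈ T, pairing ρ (fun t => P.eval t) (S.B i) * z i = pairing ρ (fun t => P.eval t) (φ k))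
    (i : ℕ) (hi : i ∈ T) : |z i| ≤ zBound p r a₀ a₁ θ κ C := by
  have hκ := hφ.nonneg
  have ha₀ := hρ.pos
  have ha₁ := hρ.pos'
  have hC0 := hC.1
  have hh := S.h_pos
  have hin := hT i hi
  set s : ℝ → ℝ := fun t => ∑ i ∈ T, z i * S.B i t with hs
  -- The interval `[A, B]` contains the supports of `φ_k` and of all `B_i`, `i ∈ T`. The truncated
  -- subtraction is harmless because indices start at zero.
  set A := S.x (k.1 - r) with hA
  set B := S.x (k.1 + r + p + 1) with hB
  have hAB : A ≤ B := S.x_mono (by omega)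
  have hA0 : 0 ≤ A := (S.x_mem _).1
  have hB1 : B ≤ 1 := (S.x_mem _).2
  -- The test polynomial has the same sign pattern as `s`, so no cancellation occurs in its product
  -- with `s`.
  obtain ⟨σ, L, hσ, hL, hLm, hsign⟩ := Represents.exists_roots (N := S.n) (A := A) (B := B)
    S.x_mono (S.isOpen.clamp_last le_rfl).ge
    (represents_sum hT hz) hz hcard (by
      rw [show S.x p = 0 from S.isOpen.clamp_first le_rfl]
      exact hA0) hB1
  obtain ⟨P, hPd, hP⟩ := exists_polynomial_eval_eq_prod L
  have hsupp : ∀ t ∉ Ico A B, s t = 0 := fun t ht => Finset.sum_eq_zero fun j hj => by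
    rw [S.B_eq_zero (hT j hj) fun h => ht ⟨le_trans (S.x_mono (by have := hloc j hj; omega)) h.1,
      h.2.trans_le (S.x_mono (by have := hloc j hj; omega))⟩, mul_zero]
  have hsn : Nice s := by
    have : s = ∑ j ∈ T, z j • S.B j := by
      funext t
      simp [hs]
    rw [this]
    exact Nice.sum fun j hj => (S.nice_B (hT j hj)).smul _
  have hmoms : pairing ρ (fun t => P.eval t) s = pairing ρ (fun t => P.eval t) (φ k) := by
    have : s = ∑ j ∈ T, z j • S.B j := by
      funext t
      simp [hs]
    rw [← hmom P (hPd.trans hL), this,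
      pairing_sum_right hρ _ _ (fun j hj => S.nice_B (hT j hj)) (Nice.eval P)]
    exact Finset.sum_congr rfl fun j _ => mul_comm _ _
  -- upper bound
  have hup : |pairing ρ (fun t => P.eval t) (φ k)| ≤
      (B - A) ^ L.length * ((p + 1) * κ) * a₁ * (B - A) := by
    refine hρ.abs_pairing_le hA0 hAB hB1 (Filter.Eventually.of_forall fun t ht => ?_) fun t ht =>
      hφ.eq_zero hk fun h => ht ⟨le_trans (S.x_mono (by omega)) h.1,
        h.2.trans_le (S.x_mono (by omega))⟩
    rw [abs_mul, hP]
    refine mul_le_mul (abs_prod_le_pow_length fun τ hτ => ?_) (hφ.abs_le hk t) (abs_nonneg _)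
      (pow_nonneg (sub_nonneg.2 hAB) _)
    have := hLm τ hτ
    rw [abs_le]
    constructor <;> linarith [ht.1, ht.2]
  -- an element in the support of `B_i` and an interval in it without roots
  obtain ⟨e, he⟩ := S.elements_nonempty hin
  obtain ⟨he1, he2, he3⟩ := (S.mem_elements hin).1 he
  have hpe := S.index_of_lt he3
  obtain ⟨b, rfl⟩ : ∃ b, e = b + p := ⟨e - p, by omega⟩
  set δ := S.x (b + p + 1) - S.x (b + p) with hδ
  have hδ0 : 0 < δ := sub_pos.2 he3
  -- The element holds exactly `p + 1` intervals of length `3 * η`, one more than there are roots.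
  set η := δ / (3 * (p + 1)) with hη
  have hη0 : 0 < η := by positivity
  have hδη : δ = 3 * (p + 1) * η := by rw [hη]; field_simp
  obtain ⟨j, hj, hfar⟩ := exists_interval_far hL (S.x (b + p)) hη0
  set α := S.x (b + p) + (3 * j + 1) * η with hα
  have hjp : (j : ℝ) ≤ p := by exact_mod_cast hj
  have hα1 : S.x (b + p) ≤ α := by
    rw [hα]
    have : 0 ≤ (3 * j + 1) * η := by positivity
    linarith
  have hα2 : α + η ≤ S.x (b + p + 1) := by
    have : S.x (b + p + 1) = S.x (b + p) + 3 * (p + 1) * η := by rw [← hδη, hδ]; ring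
    rw [this, hα]
    nlinarith
  have hAα : A ≤ S.x (b + p) := S.x_mono (by have := hloc i hi; omega)
  have hBα : S.x (b + p + 1) ≤ B := S.x_mono (by have := hloc i hi; omega)
  have hθ1 := hθ.h_le he3
  rw [← hδ] at hθ1
  have hθ0 : 0 < θ := pos_of_mul_pos_left (hh.trans_le hθ1) hδ0.le
  -- lower bound
  have hlow : a₀ * η ^ L.length * ∫ t in α..α + η, |s t| ≤ σ * pairing ρ (fun t => P.eval t) s := by
    rw [← integral_indicator_unitMeasure (by linarith) (by linarith) (by linarith),
      ← integral_const_mul, pairing_eq, ← integral_const_mul]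
    refine integral_mono_ae ?_ ((hρ.integrable_mul (Nice.eval P).integrable hsn).const_mul σ) ?_
    · exact (hsn.integrable.abs.indicator measurableSet_Ico).const_mul _
    · filter_upwards [hρ.bounds, hρ.nonneg_ae,
        compl_mem_ae_iff.2 (measure_singleton (μ := unitMeasure) A)] with t h1 h2 h3
      by_cases ht : t ∈ Ioo A B
      · have h4 := hsign t ht
        rw [← hP] at h4
        have h5 : σ * s t * P.eval t = |s t| * |P.eval t| := by
          rw [← abs_of_nonneg h4, abs_mul, abs_mul, hσ, one_mul]
        by_cases htJ : t ∈ Ico α (α + η)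
        · have h6 : η ^ L.length ≤ |P.eval t| := by
            rw [hP]
            exact pow_length_le_abs_prod hη0.le fun τ hτ => hfar τ hτ t (Ico_subset_Icc_self htJ)
          rw [indicator_of_mem htJ]
          calc a₀ * η ^ L.length * |s t| ≤ ρ t * |P.eval t| * |s t| :=
                mul_le_mul_of_nonneg_right (mul_le_mul h1.1 h6 (by positivity) h2) (abs_nonneg _)
            _ = |s t| * |P.eval t| * ρ t := by ring
            _ = _ := by rw [← h5]; ring
        · rw [indicator_of_notMem htJ, mul_zero]
          calc 0 ≤ σ * s t * P.eval t * ρ t := mul_nonneg h4 h2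
            _ = _ := by ring
      · have h4 : s t = 0 := hsupp t fun h =>
          ht ⟨lt_of_le_of_ne h.1 fun h' => h3 h'.symm, h.2⟩
        simp [indicator, h4]
  -- This is the source of the radius `3 * (p + 1) ^ 2 * θ`: the relevant knots are within `(p + 1)
  -- * h` of `α`, and `h ≤ θ * δ = 3 * (p + 1) * θ * η`.
  have hst := hC.2 S.x S.x_mono b α η hη0 hα1 hα2 (fun m hm hm' => by
    refine (S.abs_x_sub_le ⟨hα1, by linarith⟩ hm hm').trans ?_
    calc (p + 1) * S.h ≤ (p + 1) * (θ * δ) := by gcongr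
      _ = 3 * (p + 1) ^ 2 * θ * η := by rw [hδη]; ring) z (i - b) (by omega)
  rw [Nat.add_sub_cancel' (by omega)] at hst
  have hact : ∫ t in α..α + η, |activeSum S.x p b z t| = ∫ t in α..α + η, |s t| := by
    simp only [intervalIntegral.integral_of_le (le_add_of_nonneg_right hη0.le),
      integral_Ioc_eq_integral_Ioo]
    refine setIntegral_congr_fun measurableSet_Ioo fun t ht => ?_
    have h1 : t < S.x (b + p + 1) := ht.2.trans_le hα2
    have h2 : S.x (b + p) ≤ t := hα1.trans ht.1.le
    rw [represents_sum hT hz b t ((S.x_mono (Nat.le_add_left p b)).trans h2)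
      (h1.trans_le (S.x_mem _).2) h2 h1]
  rw [hact] at hst
  set W := 3 * (p + 1) * (2 * r + p + 1) * θ with hW
  have hBA : B - A ≤ W * η := by
    have h1 := S.x_add_sub_le (k.1 - r) (2 * r + p + 1)
    have h2 : B ≤ S.x (k.1 - r + (2 * r + p + 1)) := S.x_mono (by omega)
    push_cast at h1
    calc B - A ≤ (2 * r + p + 1) * S.h := by linarith
      _ ≤ (2 * r + p + 1) * (θ * δ) := by gcongr
      _ = W * η := by rw [hδη, hW]; ring
  -- Needed to replace the number of roots by its upper bound `p` in the exponent.
  have hW1 : 1 ≤ W := by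
    have h1 : 1 * η ≤ W * η := by linarith
    exact le_of_mul_le_mul_right h1 hη0
  have hI : a₀ * η ^ L.length * ∫ t in α..α + η, |s t| ≤
      (W * η) ^ L.length * ((p + 1) * κ) * a₁ * (W * η) := by
    refine hlow.trans ((le_abs_self _).trans ?_)
    rw [abs_mul, hσ, one_mul, hmoms]
    refine hup.trans ?_
    have := sub_nonneg.2 hAB
    gcongr
  -- The same power of `η` stands on both sides of the preceding estimate; the one factor left over
  -- cancels against `C / η` from the stability estimate, so the bound does not see the mesh.
  have hI2 : ∫ t in α..α + η, |s t| ≤ W ^ (L.length + 1) * ((p + 1) * κ) * a₁ * η / a₀ := by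
    rw [le_div_iff₀ ha₀]
    refine le_of_mul_le_mul_left ?_ (pow_pos hη0 L.length)
    calc _ = a₀ * η ^ L.length * ∫ t in α..α + η, |s t| := by ring
      _ ≤ _ := hI
      _ = _ := by rw [mul_pow, pow_succ]; ring
  calc |z i| ≤ C / η * ∫ t in α..α + η, |s t| := hst
    _ ≤ C / η * (W ^ (L.length + 1) * ((p + 1) * κ) * a₁ * η / a₀) := by gcongr
    _ = C * a₁ * ((p + 1) * κ) / a₀ * W ^ (L.length + 1) := by field_simp
    _ ≤ C * a₁ * ((p + 1) * κ) / a₀ * W ^ (p + 1) := by gcongr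

end TraceSplines

/-- Finite overlap: the double-counted increments split into `N` telescoping sums, each of which is
at most one total increment. -/
lemma sum_range_add_sub_le {W : ℕ → ℝ} {c : ℝ} (h : ∀ i j, W i - W j ≤ c) (M N : ℕ) :
    ∑ b ∈ Finset.range M, (W (b + N) - W b) ≤ N * c := by
  induction N with
  | zero => simp
  | succ N ih =>
    have h1 := Finset.sum_range_sub (fun b => W (b + N)) M
    have h2 : ∀ b, W (b + (N + 1)) - W b = (W (b + 1 + N) - W (b + N)) + (W (b + N) - W b) :=
      fun b => by rw [show b + (N + 1) = b + 1 + N by omega]; ring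
    rw [Finset.sum_congr rfl fun b _ => h2 b, Finset.sum_add_distrib, h1]
    push_cast
    have := h (M + N) (0 + N)
    linarith

lemma sobolevNorm_nonneg (a : ℝ → ℝ) (m : ℕ) (f : ℝ → ℝ) : 0 ≤ sobolevNorm a m f := by
  rw [sobolevNorm]
  split
  · exact Real.sqrt_nonneg _
  · exact le_rfl

/-! ### The quasi-interpolant: biorthogonality, reproduction, local stability and error -/

namespace TraceSplines

variable {p : ℕ} {S : TraceSplines p}

/-- The data of the construction of the functions `ψ̂_i`. -/
structure IsLocalConstruction (S : TraceSplines p) (ρ : ℝ → ℝ) (φ : ℕ × ℕ → ℝ → ℝ)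
    (q : Module.Basis (Fin (p + 1)) ℝ (Polynomial.degreeLT ℝ (p + 1)))
    (Iloc : ℕ × ℕ → Finset ℕ) (a₀ a₁ θ κ : ℝ) (r : ℕ) : Prop where
  weight : IsWeight a₀ a₁ ρ
  quasiUniform : S.IsQuasiUniform θ
  extension : S.IsLocalExtension κ φ
  loc : ∀ k ∈ S.extra, Iloc k ⊆ S.bsp ∧ (Iloc k).card = p + 1 ∧
    ∀ i ∈ Iloc k, i ≤ k.1 + r ∧ k.1 ≤ i + r
  rank : ∀ k ∈ S.extra, (S.localMatrix ρ q Iloc k).rank = p + 1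

lemma extra_subset : S.extra ⊆ S.index := Finset.sdiff_subset

lemma mk_zero_notMem_extra {i : ℕ} (hi : i ∈ S.bsp) : (i, 0) ∉ S.extra := fun h =>
  (Finset.mem_sdiff.1 h).2 (Finset.mem_image.2 ⟨i, hi, rfl⟩)

lemma eq_mk_zero_of_notMem_extra {k : ℕ × ℕ} (hk : k ∈ S.index) (h : k ∉ S.extra) :
    k.1 ∈ S.bsp ∧ k = (k.1, 0) := by
  have : k ∈ S.bsp.image fun i => (i, 0) := by
    by_contra hc
    exact h (Finset.mem_sdiff.2 ⟨hk, hc⟩)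
  obtain ⟨i, hi, rfl⟩ := Finset.mem_image.1 this
  exact ⟨hi, rfl⟩

lemma sum_index {E : Type*} [AddCommMonoid E] (f : ℕ × ℕ → E) :
    ∑ k ∈ S.index, f k = ∑ k ∈ S.extra, f k + ∑ i ∈ S.bsp, f (i, 0) := by
  have h : S.bsp.image (fun i => (i, 0)) ⊆ S.index := fun k hk => by
    obtain ⟨i, hi, rfl⟩ := Finset.mem_image.1 hk
    exact S.mk_zero_mem_index (S.mem_bsp_lt hi)
  rw [extra, ← Finset.sum_sdiff h, Finset.sum_image fun i _ j _ h => congrArg Prod.fst h]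

/-- The coefficients of the quasi-interpolant in the basis `ψ̃_k`. -/
def interpCoeff (S : TraceSplines p) (ρ : ℝ → ℝ) (φ : ℕ × ℕ → ℝ → ℝ)
    (q : Module.Basis (Fin (p + 1)) ℝ (Polynomial.degreeLT ℝ (p + 1)))
    (Iloc : ℕ × ℕ → Finset ℕ) (f : ℝ → ℝ) (k : ℕ × ℕ) : ℝ :=
  if k ∈ S.extra then ∑ i ∈ Iloc k, pairing ρ f (S.B i) * S.zCoeff ρ φ q Iloc k i
  else pairing ρ f (S.B k.1)

/-- The bound for `Qf` on an element in terms of the bound for `f` in the vicinity. -/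
def interpBound (p r : ℕ) (a₀ a₁ θ κ C : ℝ) : ℝ :=
  (p + 1) ^ 3 * a₁ * (1 + (p + 1) * zBound p r a₀ a₁ θ κ C) * (C ^ 2 * κ) * θ / a₀

namespace IsLocalConstruction

variable {ρ : ℝ → ℝ} {φ : ℕ × ℕ → ℝ → ℝ}
  {q : Module.Basis (Fin (p + 1)) ℝ (Polynomial.degreeLT ℝ (p + 1))}
  {Iloc : ℕ × ℕ → Finset ℕ} {a₀ a₁ θ κ : ℝ} {r : ℕ}

lemma solves (H : S.IsLocalConstruction ρ φ q Iloc a₀ a₁ θ κ r) {k : ℕ × ℕ} (hk : k ∈ S.extra) :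
    S.SolvesLocalSystem ρ φ q Iloc k (S.zCoeff ρ φ q Iloc k) :=
  solvesLocalSystem_zCoeff (H.loc k hk).2.1 (H.rank k hk)

lemma nice_psiHat (H : S.IsLocalConstruction ρ φ q Iloc a₀ a₁ θ κ r) (i : ℕ) :
    Nice (S.psiHat ρ φ q Iloc i) :=
  (H.extension.nice_psiTilde _).add (Nice.sum fun k _ => (H.extension.nice_psiTilde k).smul _)

lemma nice_quasiInterp (H : S.IsLocalConstruction ρ φ q Iloc a₀ a₁ θ κ r) (f : ℝ → ℝ) :
    Nice (S.quasiInterp ρ φ q Iloc f) :=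
  Nice.sum fun i _ => (H.nice_psiHat i).smul _

/-- Biorthogonality. -/
lemma pairing_psiHat (H : S.IsLocalConstruction ρ φ q Iloc a₀ a₁ θ κ r) {i j : ℕ} (hi : i ∈ S.bsp)
    (hj : j ∈ S.bsp) :
    pairing ρ (S.B i) (S.psiHat ρ φ q Iloc j) = if i = j then 1 else 0 := by
  have hB : S.B i = φ (i, 0) := (H.extension.1 i (S.mem_bsp_lt hi)).symm
  have hi' := S.mk_zero_mem_index (S.mem_bsp_lt hi)
  have hj' := S.mk_zero_mem_index (S.mem_bsp_lt hj)
  have h1 : S.psiHat ρ φ q Iloc j =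
      ∑ k ∈ S.index, (if k ∈ S.extra then S.zCoeff ρ φ q Iloc k j else if k = (j, 0) then 1 else 0) •
        S.psiTilde ρ φ k := by
    rw [sum_index, psiHat, add_comm]
    congr 1
    · exact Finset.sum_congr rfl fun k hk => by rw [if_pos hk]
    · rw [Finset.sum_eq_single_of_mem j hj fun m hm hne => by
        rw [if_neg (mk_zero_notMem_extra hm), if_neg fun h => hne (congrArg Prod.fst h), zero_smul],
        if_neg (mk_zero_notMem_extra hj), if_pos rfl, one_smul]
  rw [h1, hB, pairing_sum_right H.weight _ _ (fun k _ => H.extension.nice_psiTilde k)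
    (H.extension.nice hi'), Finset.sum_eq_single_of_mem (i, 0) hi' fun k hk hne => by
      rw [pairing_comm, H.extension.pairing_psiTilde H.weight hk hi', if_neg hne, mul_zero],
    pairing_comm, H.extension.pairing_psiTilde H.weight hi' hi', if_pos rfl, mul_one,
    if_neg (mk_zero_notMem_extra hi)]
  simp

/-- Interchanging the sums over `i` and `k` moves the `z_{ki}` from the functions to the
functionals. In this form the local systems give reproduction, and the bounds for `z_{ki}` and
`ψ̃_k` give stability. -/
lemma quasiInterp_eq (H : S.IsLocalConstruction ρ φ q Iloc a₀ a₁ θ κ r) (f : ℝ → ℝ) :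
    S.quasiInterp ρ φ q Iloc f =
      ∑ k ∈ S.index, S.interpCoeff ρ φ q Iloc f k • S.psiTilde ρ φ k := by
  rw [sum_index, quasiInterp]
  simp only [psiHat, smul_add, Finset.sum_add_distrib, Finset.smul_sum]
  rw [add_comm, Finset.sum_comm]
  congr 1
  · refine Finset.sum_congr rfl fun k hk => ?_
    simp only [smul_smul]
    rw [← Finset.sum_smul, interpCoeff, if_pos hk]
    congr 1
    refine (Finset.sum_subset (H.loc k hk).1 fun i _ hi => ?_).symm
    rw [(H.solves hk).1 i hi, mul_zero]
  · exact Finset.sum_congr rfl fun i hi => by rw [interpCoeff, if_neg (mk_zero_notMem_extra hi)]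

/-- Reproduction of polynomials. -/
lemma quasiInterp_polynomial (H : S.IsLocalConstruction ρ φ q Iloc a₀ a₁ θ κ r)
    {P : Polynomial ℝ} (hP : P.natDegree ≤ p) {t : ℝ} (ht : t ∈ Ico (0 : ℝ) 1) :
    S.quasiInterp ρ φ q Iloc (fun s => P.eval s) t = P.eval t := by
  rw [H.quasiInterp_eq, ← H.extension.sum_pairing_smul_psiTilde H.weight (IsLocalSpline.eval hP)
    (Nice.eval P) t ht]
  refine congrFun (Finset.sum_congr rfl fun k hk => ?_) t
  congr 1
  -- For an extra index the local system says that the coefficient is `(P, φ_k)`; for the others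
  -- `φ_k` is the trace B-spline.
  by_cases hke : k ∈ S.extra
  · rw [interpCoeff, if_pos hke]
    exact (H.solves hke).sum_pairing_mul H.weight (H.loc k hke).1 (H.extension.nice hk) hP
  · obtain ⟨h1, h2⟩ := eq_mk_zero_of_notMem_extra hk hke
    rw [interpCoeff, if_neg hke, h2, H.extension.1 _ (S.mem_bsp_lt h1)]

lemma quasiInterp_sub (H : S.IsLocalConstruction ρ φ q Iloc a₀ a₁ θ κ r) {f g : ℝ → ℝ}
    (hf : Integrable f unitMeasure) (hg : Integrable g unitMeasure) :
    S.quasiInterp ρ φ q Iloc (f - g) = S.quasiInterp ρ φ q Iloc f - S.quasiInterp ρ φ q Iloc g := by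
  simp only [quasiInterp]
  rw [← Finset.sum_sub_distrib]
  exact Finset.sum_congr rfl fun i hi => by
    rw [pairing_sub_left H.weight hf hg (S.nice_B (S.mem_bsp_lt hi)), sub_smul]

lemma abs_zCoeff_le (H : S.IsLocalConstruction ρ φ q Iloc a₀ a₁ θ κ r) {C : ℝ}
    (hC : IsStable p (3 * (p + 1) ^ 2 * θ) C) {k : ℕ × ℕ} (hk : k ∈ S.extra) {i : ℕ}
    (hi : i ∈ Iloc k) : |S.zCoeff ρ φ q Iloc k i| ≤ zBound p r a₀ a₁ θ κ C := by
  obtain ⟨h1, h2, h3⟩ := H.loc k hk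
  have hki := extra_subset hk
  exact abs_le_zBound H.weight H.extension H.quasiUniform hC hki
    (fun i hi => S.mem_bsp_lt (h1 hi)) h2.le h3 (H.solves hk).1
    (fun P hP => (H.solves hk).sum_pairing_mul H.weight h1 (H.extension.nice hki) hP) i hi

lemma theta_nonneg (H : S.IsLocalConstruction ρ φ q Iloc a₀ a₁ θ κ r) : 0 ≤ θ := by
  obtain ⟨b, -, h1, h2⟩ := S.exists_element (t := 0) (by norm_num)
  have h3 := h1.trans_lt h2
  exact (pos_of_mul_pos_left (S.h_pos.trans_le (H.quasiUniform.h_le h3)) (sub_pos.2 h3).le).le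

lemma zBound_nonneg (H : S.IsLocalConstruction ρ φ q Iloc a₀ a₁ θ κ r) {C : ℝ} (hC : 0 < C) :
    0 ≤ zBound p r a₀ a₁ θ κ C := by
  have := H.weight.pos
  have := H.weight.pos'
  have := H.extension.nonneg
  have := H.theta_nonneg
  unfold zBound
  positivity

/-- On an element, the quasi-interpolant is bounded by the function in the vicinity. -/
lemma abs_quasiInterp_le (H : S.IsLocalConstruction ρ φ q Iloc a₀ a₁ θ κ r) {C : ℝ}
    (hC : IsStable p (3 * (p + 1) ^ 2 * θ) C) {b : ℕ} (hb : S.x (b + p) < S.x (b + p + 1))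
    {g : ℝ → ℝ} {D : ℝ} (hD : 0 ≤ D)
    (hg : ∀ᵐ t, t ∈ Ioo (S.x (b - r)) (S.x (b + 2 * p + r + 1)) → |g t| ≤ D) {t : ℝ}
    (ht : t ∈ Ico (S.x (b + p)) (S.x (b + p + 1))) :
    |S.quasiInterp ρ φ q Iloc g t| ≤ interpBound p r a₀ a₁ θ κ C * D := by
  have ha₀ := H.weight.pos
  have ha₁ := H.weight.pos'
  have hκ := H.extension.nonneg
  have hθ0 := H.theta_nonneg
  have hh := S.h_pos
  have hC0 := hC.1
  have hZ := H.zBound_nonneg hC.1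
  set Z := zBound p r a₀ a₁ θ κ C with hZdef
  set δ := S.x (b + p + 1) - S.x (b + p) with hδ
  have hδ0 : 0 < δ := sub_pos.2 hb
  -- The indices `k` active on the element have `b ≤ k.1 ≤ b + p`, the local sets add `r` on both
  -- sides, and the support of `B_i` reaches `p + 1` knots further. This gives the vicinity from `b
  -- - r` to `b + 2 * p + r + 1`.
  have hmom : ∀ i, b ≤ i + r → i ≤ b + p + r → i < S.n →
      |pairing ρ g (S.B i)| ≤ D * a₁ * ((p + 1) * S.h) := by
    intro i h1 h2 hin
    have h3 := S.x_add_sub_le i (p + 1)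
    push_cast at h3
    refine (H.weight.abs_pairing_le (M := D) (S.x_mem _).1 (S.x_mono (show i ≤ i + p + 1 by omega))
      (S.x_mem _).2 ?_ fun t ht => S.B_eq_zero hin ht).trans
      (mul_le_mul_of_nonneg_left h3 (by positivity))
    filter_upwards [ae_restrict_of_ae hg,
      compl_mem_ae_iff.2 (measure_singleton (μ := unitMeasure) (S.x i))] with t h4 h5 ht
    have hti : S.x i < t := lt_of_le_of_ne ht.1 fun h' => h5 h'.symm
    have h6 := h4 ⟨(S.x_mono (by omega)).trans_lt hti, ht.2.trans_le (S.x_mono (by omega))⟩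
    rw [abs_mul, abs_of_nonneg (S.B_nonneg hin t)]
    calc |g t| * S.B i t ≤ D * 1 := mul_le_mul h6 (S.B_le_one hin t) (S.B_nonneg hin t) hD
      _ = D := mul_one D
  have hmom0 : 0 ≤ D * a₁ * ((p + 1) * S.h) := by positivity
  have hcoef : ∀ k ∈ S.index, b ≤ k.1 → k.1 ≤ b + p →
      |S.interpCoeff ρ φ q Iloc g k| ≤ D * a₁ * ((p + 1) * S.h) * (1 + (p + 1) * Z) := by
    intro k hk h1 h2
    by_cases hke : k ∈ S.extra
    · obtain ⟨h3, h4, h5⟩ := H.loc k hke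
      rw [interpCoeff, if_pos hke]
      calc _ ≤ ∑ i ∈ Iloc k, D * a₁ * ((p + 1) * S.h) * Z := by
            refine (Finset.abs_sum_le_sum_abs _ _).trans (Finset.sum_le_sum fun i hi => ?_)
            rw [abs_mul]
            have h6 := h5 i hi
            exact mul_le_mul (hmom i (by omega) (by omega) (S.mem_bsp_lt (h3 hi)))
              (H.abs_zCoeff_le hC hke hi) (abs_nonneg _) hmom0
        _ = D * a₁ * ((p + 1) * S.h) * ((p + 1) * Z) := by
            rw [Finset.sum_const, h4, nsmul_eq_mul]
            push_cast
            ring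
        _ ≤ _ := mul_le_mul_of_nonneg_left (by linarith) hmom0
    · rw [interpCoeff, if_neg hke]
      refine (hmom k.1 (by omega) (by omega) (S.mem_index.1 hk).1).trans
        (le_mul_of_one_le_right hmom0 ?_)
      have : 0 ≤ (p + 1) * Z := by positivity
      linarith
  have hpsi := fun k hk => H.extension.abs_psiTilde_le H.weight H.quasiUniform hC (by
    have : (0 : ℝ) ≤ (p + 1) * θ := by positivity
    have : (0 : ℝ) ≤ p := Nat.cast_nonneg p
    nlinarith [mul_nonneg this this]) (k := k) hk hb ht
  set U := D * a₁ * ((p + 1) * S.h) * (1 + (p + 1) * Z) * (C ^ 2 * κ / (δ * a₀)) with hU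
  have hU0 : 0 ≤ U := by positivity
  -- At most `p + 1` B-splines are active, with at most `p + 1` basis functions each.
  have hcard : (S.index.filter fun k => b ≤ k.1 ∧ k.1 ≤ b + p).card ≤ (p + 1) * (p + 1) := by
    have hsub : (S.index.filter fun k => b ≤ k.1 ∧ k.1 ≤ b + p) ⊆
        Finset.Icc b (b + p) ×ˢ Finset.range (p + 1) := fun k hk => by
      obtain ⟨h1, h2⟩ := Finset.mem_filter.1 hk
      have h3 := (S.mem_index.1 h1).2.trans_le (S.card_elements_le k.1)
      exact Finset.mem_product.2 ⟨Finset.mem_Icc.2 h2, Finset.mem_range.2 h3⟩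
    refine (Finset.card_le_card hsub).trans ?_
    rw [Finset.card_product, Nat.card_Icc, Finset.card_range]
    exact Nat.mul_le_mul_right _ (by omega)
  have hδh := H.quasiUniform.h_le hb
  rw [← hδ] at hδh
  rw [H.quasiInterp_eq]
  simp only [Finset.sum_apply, Pi.smul_apply, smul_eq_mul]
  calc _ ≤ ∑ k ∈ S.index, |S.interpCoeff ρ φ q Iloc g k * S.psiTilde ρ φ k t| :=
        Finset.abs_sum_le_sum_abs _ _
    _ = ∑ k ∈ S.index.filter fun k => b ≤ k.1 ∧ k.1 ≤ b + p,
          |S.interpCoeff ρ φ q Iloc g k * S.psiTilde ρ φ k t| := by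
        refine (Finset.sum_subset (Finset.filter_subset _ _) fun k hk hk' => ?_).symm
        rw [(hpsi k hk).1 fun h => hk' (Finset.mem_filter.2 ⟨hk, h⟩), mul_zero, abs_zero]
    _ ≤ ∑ k ∈ S.index.filter fun k => b ≤ k.1 ∧ k.1 ≤ b + p, U := by
        refine Finset.sum_le_sum fun k hk => ?_
        obtain ⟨h1, h2, h3⟩ := Finset.mem_filter.1 hk
        rw [abs_mul]
        exact mul_le_mul (hcoef k h1 h2 h3) (hpsi k h1).2 (abs_nonneg _) (by positivity)
    _ ≤ ((p + 1) * (p + 1)) * U := by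
        rw [Finset.sum_const, nsmul_eq_mul]
        exact mul_le_mul_of_nonneg_right (by exact_mod_cast hcard) hU0
    -- The moments contribute a factor `h` and the biorthogonal functions a factor `1 / δ`;
    -- quasi-uniformity bounds the quotient.
    _ = (p + 1) ^ 3 * a₁ * (1 + (p + 1) * Z) * (C ^ 2 * κ) / a₀ * D * (S.h / δ) := by
        rw [hU]
        field_simp
    _ ≤ (p + 1) ^ 3 * a₁ * (1 + (p + 1) * Z) * (C ^ 2 * κ) / a₀ * D * θ := by
        refine mul_le_mul_of_nonneg_left ?_ (by positivity)
        rwa [div_le_iff₀ hδ0]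
    _ = _ := by
        rw [interpBound, ← hZdef]
        ring

/-- The local error estimate. -/
lemma abs_quasiInterp_sub_le (H : S.IsLocalConstruction ρ φ q Iloc a₀ a₁ θ κ r) {C : ℝ}
    (hC : IsStable p (3 * (p + 1) ^ 2 * θ) C) {b : ℕ} (hb : S.x (b + p) < S.x (b + p + 1))
    {f : ℝ → ℝ} (hf : Integrable f unitMeasure) {D : ℝ} (hD : 0 ≤ D) {P : Polynomial ℝ}
    (hP : P.natDegree ≤ p)
    (hfP : ∀ᵐ t, t ∈ Ioo (S.x (b - r)) (S.x (b + 2 * p + r + 1)) → |f t - P.eval t| ≤ D) :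
    ∀ᵐ t, t ∈ Ioo (S.x (b + p)) (S.x (b + p + 1)) →
      |S.quasiInterp ρ φ q Iloc f t - f t| ≤ (interpBound p r a₀ a₁ θ κ C + 1) * D := by
  filter_upwards [hfP] with t h1 ht
  have h2 := h1 ⟨(S.x_mono (by omega)).trans_lt ht.1, ht.2.trans_le (S.x_mono (by omega))⟩
  have h3 := H.abs_quasiInterp_le hC hb (g := f - fun t => P.eval t) hD hfP
    (Ioo_subset_Ico_self ht)
  rw [H.quasiInterp_sub hf (Nice.eval P).integrable, Pi.sub_apply,
    H.quasiInterp_polynomial hP ⟨(S.x_mem _).1.trans ht.1.le, ht.2.trans_le (S.x_mem _).2⟩] at h3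
  calc |S.quasiInterp ρ φ q Iloc f t - f t| =
        |(S.quasiInterp ρ φ q Iloc f t - P.eval t) - (f t - P.eval t)| := by
        congr 1
        ring
    _ ≤ _ := (abs_sub _ _).trans (by linarith)

/-- The global error estimate. -/
lemma integral_sq_quasiInterp_sub_le (H : S.IsLocalConstruction ρ φ q Iloc a₀ a₁ θ κ r) {C : ℝ}
    (hC : IsStable p (3 * (p + 1) ^ 2 * θ) C) {f v w : ℝ → ℝ} (hf : MemLp f 2 unitMeasure)
    (hv : MemLp v 2 unitMeasure) {K : ℝ} (hK : 0 ≤ K) (hwm : Measurable w)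
    (hw : ∀ᵐ t ∂unitMeasure, 0 ≤ w t ∧ w t ≤ K)
    (happ : ∀ A B : ℝ, 0 ≤ A → A < B → B ≤ 1 → ∃ P : Polynomial ℝ, P.natDegree ≤ p ∧
      ∀ᵐ t, t ∈ Ioo A B → |f t - P.eval t| ≤ (B - A) ^ p * ∫ x in A..B, |v x|) :
    ∫ t in (0 : ℝ)..1, (S.quasiInterp ρ φ q Iloc f t - f t) ^ 2 * w t ≤
      K * (interpBound p r a₀ a₁ θ κ C + 1) ^ 2 * (2 * p + 2 * r + 1) ^ (2 * p + 2) *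
        S.h ^ (2 * p + 2) * ∫ t, v t ^ 2 ∂unitMeasure := by
  set G := interpBound p r a₀ a₁ θ κ C + 1 with hG
  set N : ℕ := 2 * p + 2 * r + 1 with hN
  set F : ℝ → ℝ := fun t => (S.quasiInterp ρ φ q Iloc f t - f t) ^ 2 * w t with hF
  have hh := S.h_pos
  have hv2 : Integrable (fun t => v t ^ 2) unitMeasure := hv.integrable_sq
  have hFi : Integrable F unitMeasure := by
    obtain ⟨c, hc⟩ := (H.nice_quasiInterp f).ae_bound
    have h1 : MemLp (S.quasiInterp ρ φ q Iloc f) 2 unitMeasure :=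
      MemLp.of_bound (H.nice_quasiInterp f).1.aestronglyMeasurable c hc
    refine (h1.sub hf).integrable_sq.mul_bdd (c := K) hwm.aestronglyMeasurable ?_
    filter_upwards [hw] with t ht
    rw [Real.norm_of_nonneg ht.1]
    exact ht.2
  have hvi : ∀ {s t : ℝ}, s ∈ Icc (0 : ℝ) 1 → t ∈ Icc (0 : ℝ) 1 →
      IntervalIntegrable (fun t => v t ^ 2) volume s t := fun hs ht =>
    intervalIntegrable_of_unitMeasure hv2 hs ht
  have h01 : (0 : ℝ) ∈ Icc (0 : ℝ) 1 := by norm_num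
  have h11 : (1 : ℝ) ∈ Icc (0 : ℝ) 1 := by norm_num
  -- The increment of `W` from `b` to `b + N` is the energy of `v` in the vicinity of the element,
  -- since `b + N - r = b + 2 * p + r + 1`. In this form the sum over the elements telescopes.
  set W : ℕ → ℝ := fun b => ∫ t in (0 : ℝ)..S.x (b - r), v t ^ 2 with hW
  have hWsub : ∀ i j, W i - W j = ∫ t in S.x (j - r)..S.x (i - r), v t ^ 2 := fun i j =>
    intervalIntegral.integral_interval_sub_left (hvi h01 (S.x_mem _)) (hvi h01 (S.x_mem _))
  have hWle : ∀ i j, W i - W j ≤ ∫ t, v t ^ 2 ∂unitMeasure := fun i j => by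
    have h1 : 0 ≤ W j := intervalIntegral.integral_nonneg (S.x_mem _).1 fun _ _ => sq_nonneg _
    have h2 : 0 ≤ ∫ t in S.x (i - r)..1, v t ^ 2 :=
      intervalIntegral.integral_nonneg (S.x_mem _).2 fun _ _ => sq_nonneg _
    rw [← intervalIntegral.integral_interval_sub_left (hvi h01 h11) (hvi h01 (S.x_mem _)),
      intervalIntegral_eq_unitMeasure] at h2
    linarith
  set Q := K * G ^ 2 * (N : ℝ) ^ (2 * p + 1) * S.h ^ (2 * p + 2) with hQ
  have hQ0 : 0 ≤ Q := by positivity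
  have hel : ∀ b ∈ Finset.range (S.n - p), ∫ t in S.x (b + p)..S.x (b + 1 + p), F t ≤
      Q * (W (b + N) - W b) := by
    intro b _
    rw [hWsub, show b + N - r = b + 2 * p + r + 1 by omega, Nat.add_right_comm b 1 p]
    set A := S.x (b - r) with hA
    set B := S.x (b + 2 * p + r + 1) with hB
    rcases (S.x_mono (Nat.le_succ (b + p))).eq_or_lt with hb | hb
    · rw [Nat.succ_eq_add_one] at hb
      rw [← hb, intervalIntegral.integral_same]
      exact mul_nonneg hQ0 (intervalIntegral.integral_nonneg (S.x_mono (by omega))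
        fun _ _ => sq_nonneg _)
    · rw [Nat.succ_eq_add_one] at hb
      have hAB : A < B := (S.x_mono (by omega)).trans_lt (hb.trans_le (S.x_mono (by omega)))
      obtain ⟨P, hP, hfP⟩ := happ A B (S.x_mem _).1 hAB (S.x_mem _).2
      set D := (B - A) ^ p * ∫ t in A..B, |v t| with hD
      have hD0 : 0 ≤ D := mul_nonneg (pow_nonneg (sub_nonneg.2 hAB.le) _)
        (intervalIntegral.integral_nonneg hAB.le fun _ _ => abs_nonneg _)
      -- Cauchy-Schwarz yields one further factor `B - A`. Together with the element length from the
      -- integration, the exponent becomes `2 * p + 2`.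
      have hD2 : D ^ 2 ≤ (B - A) ^ (2 * p + 1) * ∫ t in A..B, v t ^ 2 := by
        rw [hD, mul_pow, ← pow_mul, mul_comm p 2, pow_succ (B - A) (2 * p), mul_assoc]
        exact mul_le_mul_of_nonneg_left (sq_integral_abs_le hAB
          (intervalIntegrable_of_unitMeasure (MemLp.integrable_unit hv) (S.x_mem _) (S.x_mem _))
          (hvi (S.x_mem _) (S.x_mem _))) (pow_nonneg (sub_nonneg.2 hAB.le) _)
      have hBA : B - A ≤ N * S.h :=
        (sub_le_sub_right (S.x_mono (by omega)) _).trans (S.x_add_sub_le (b - r) N)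
      have hloc := H.abs_quasiInterp_sub_le hC hb (MemLp.integrable_unit hf) hD0 hP hfP
      have hbound : ∀ᵐ t, t ∈ uIoc (S.x (b + p)) (S.x (b + p + 1)) → ‖F t‖ ≤ (G * D) ^ 2 * K := by
        filter_upwards [hloc, (ae_restrict_iff' measurableSet_Ioo).1 hw,
          compl_mem_ae_iff.2 (measure_singleton (μ := volume) (S.x (b + p + 1)))] with t h1 h2 h3 ht
        rw [uIoc_of_le hb.le] at ht
        have ht' : t ∈ Ioo (S.x (b + p)) (S.x (b + p + 1)) := ⟨ht.1, lt_of_le_of_ne ht.2 h3⟩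
        have h4 := h2 ⟨(S.x_mem _).1.trans_lt ht'.1, ht'.2.trans_le (S.x_mem _).2⟩
        rw [hF, Real.norm_of_nonneg (mul_nonneg (sq_nonneg _) h4.1), ← sq_abs]
        exact mul_le_mul (pow_le_pow_left₀ (abs_nonneg _) (h1 ht') 2) h4.2 h4.1 (sq_nonneg _)
      have hint := intervalIntegral.norm_integral_le_of_norm_le_const_ae hbound
      have hI0 : 0 ≤ ∫ t in A..B, v t ^ 2 :=
        intervalIntegral.integral_nonneg hAB.le fun _ _ => sq_nonneg _
      rw [abs_of_pos (sub_pos.2 hb)] at hint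
      calc _ ≤ (G * D) ^ 2 * K * (S.x (b + p + 1) - S.x (b + p)) := (le_abs_self _).trans hint
        _ ≤ (G * D) ^ 2 * K * S.h :=
          mul_le_mul_of_nonneg_left (S.x_succ_sub_le _) (by positivity)
        _ = K * G ^ 2 * S.h * D ^ 2 := by ring
        _ ≤ K * G ^ 2 * S.h * ((N * S.h) ^ (2 * p + 1) * ∫ t in A..B, v t ^ 2) := by
          refine mul_le_mul_of_nonneg_left (hD2.trans (mul_le_mul_of_nonneg_right
            (pow_le_pow_left₀ (sub_nonneg.2 hAB.le) hBA _) hI0)) (by positivity)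
        _ = _ := by rw [hQ, mul_pow]; ring
  have hsum := intervalIntegral.sum_integral_adjacent_intervals (f := F) (μ := volume)
    (a := fun b => S.x (b + p)) (n := S.n - p)
    fun b _ => intervalIntegrable_of_unitMeasure hFi (S.x_mem _) (S.x_mem _)
  have hx0 : S.x (0 + p) = 0 := S.isOpen.clamp_first (by omega)
  have hx1 : S.x (S.n - p + p) = 1 := S.isOpen.clamp_last (by omega)
  rw [hx0, hx1] at hsum
  rw [← hsum]
  calc _ ≤ ∑ b ∈ Finset.range (S.n - p), Q * (W (b + N) - W b) := Finset.sum_le_sum hel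
    _ = Q * ∑ b ∈ Finset.range (S.n - p), (W (b + N) - W b) := (Finset.mul_sum _ _ _).symm
    _ ≤ Q * (N * ∫ t, v t ^ 2 ∂unitMeasure) :=
      mul_le_mul_of_nonneg_left (sum_range_add_sub_le hWle _ _) hQ0
    _ = _ := by
      rw [hQ, hN]
      push_cast
      ring

end IsLocalConstruction

/-- By injectivity of `γ`, the pull-back of the multiplier with the coefficients of `Qf` is `Qf`,
and this multiplier competes in the infimum. -/
lemma iInf_curveL2Norm_le {ρ : ℝ → ℝ} {φ : ℕ × ℕ → ℝ → ℝ}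
    {q : Module.Basis (Fin (p + 1)) ℝ (Polynomial.degreeLT ℝ (p + 1))}
    {Iloc : ℕ × ℕ → Finset ℕ} {γ : ℝ → Plane} (hγ : InjOn γ (Ioo 0 1)) (lam : Plane → ℝ) :
    (⨅ μ : S.multiplierSpace ρ φ q Iloc γ, curveL2Norm γ (fun x => (μ : Plane → ℝ) x - lam x)) ≤
      √(∫ t in (0 : ℝ)..1,
        (S.quasiInterp ρ φ q Iloc (fun t => lam (γ t)) t - lam (γ t)) ^ 2 * speed γ t) := by
  set f : ℝ → ℝ := fun t => lam (γ t) with hf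
  set μ : Plane → ℝ := ∑ i ∈ S.bsp, pairing ρ f (S.B i) • pushToCurve γ (S.psiHat ρ φ q Iloc i)
    with hμ
  have hmem : μ ∈ S.multiplierSpace ρ φ q Iloc γ := Submodule.sum_mem _ fun i hi =>
    Submodule.smul_mem _ _ (Submodule.subset_span ⟨i, hi, rfl⟩)
  refine (ciInf_le ⟨0, ?_⟩ ⟨μ, hmem⟩).trans (le_of_eq ?_)
  · rintro _ ⟨_, rfl⟩
    exact Real.sqrt_nonneg _
  · rw [curveL2Norm, intervalIntegral_eq_unitMeasure, intervalIntegral_eq_unitMeasure]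
    congr 1
    refine setIntegral_congr_fun measurableSet_Ioo fun t ht => ?_
    have h1 : μ (γ t) = S.quasiInterp ρ φ q Iloc f t := by
      simp only [hμ, quasiInterp, Finset.sum_apply, Pi.smul_apply, pushToCurve,
        hγ.leftInvOn_invFunOn ht]
    simp only [h1, hf]

/-- The stability constant requires a nonnegative radius and is chosen before any mesh is given; the
sign of `θ` is not known at that point. -/
lemma IsQuasiUniform.abs {θ : ℝ} (h : S.IsQuasiUniform θ) : S.IsQuasiUniform |θ| :=
  fun j hj hlt => (h j hj hlt).trans
    (mul_le_mul_of_nonneg_right (le_abs_self θ) (sub_nonneg.2 hlt.le))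

lemma IsLocalExtension.abs {κ : ℝ} {φ : ℕ × ℕ → ℝ → ℝ} (h : S.IsLocalExtension κ φ) :
    S.IsLocalExtension |κ| φ := by
  obtain ⟨h1, α, β, h2, h3⟩ := h
  exact ⟨h1, α, β, fun i j e => ⟨(h2 i j e).1.trans (le_abs_self κ),
    (h2 i j e).2.trans (le_abs_self κ)⟩, h3⟩

/-- The approximation property of the multiplier spaces, uniformly with respect to the mesh. -/
theorem exists_iInf_curveL2Norm_le {F : NurbsMap p} (hF : F.IsBiLipschitz) {ρ : ℝ → ℝ}
    {a₀ a₁ : ℝ} (θ κ : ℝ) (r : ℕ) {s : Set ℝ} (hs : s.Countable) {a : ℝ → ℝ}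
    (ha : BddSmooth s p a) {m : ℝ} (hm : 0 < m) (ham : ∀ᵐ t ∂unitMeasure, m ≤ a t) :
    ∃ c, 0 ≤ c ∧ ∀ (S : TraceSplines p) (φ : ℕ × ℕ → ℝ → ℝ)
      (q : Module.Basis (Fin (p + 1)) ℝ (Polynomial.degreeLT ℝ (p + 1)))
      (Iloc : ℕ × ℕ → Finset ℕ), S.IsLocalConstruction ρ φ q Iloc a₀ a₁ |θ| |κ| r →
      ∀ lam : Plane → ℝ, MemSobolev a (p + 1) (fun t => lam (F.trace t)) →
        (⨅ μ : S.multiplierSpace ρ φ q Iloc F.trace,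
          curveL2Norm F.trace (fun x => (μ : Plane → ℝ) x - lam x)) ≤
            c * S.h ^ (p + 1) * sobolevNorm a (p + 1) (fun t => lam (F.trace t)) := by
  obtain ⟨K, hK, hspeed⟩ := hF.ae_speed_bounds
  obtain ⟨C, hC⟩ := exists_isStable p (R := 3 * (p + 1) ^ 2 * |θ|) (by positivity)
  obtain ⟨M, hM, happ⟩ := exists_polynomial_approx hs ha hm ham
  set G := K * (interpBound p r a₀ a₁ |θ| |κ| C + 1) ^ 2 * (2 * p + 2 * r + 1) ^ (2 * p + 2) with hG
  have hG0 : 0 ≤ G := by positivity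
  refine ⟨√(G * M), Real.sqrt_nonneg _, fun S φ q Iloc H lam hlam => ?_⟩
  have hh := S.h_pos
  set f : ℝ → ℝ := fun t => lam (F.trace t) with hf
  have hnorm := sobolevNorm_nonneg a (p + 1) f
  obtain ⟨hfL, v, hv, hvM, hP⟩ := happ f hlam
  refine (iInf_curveL2Norm_le hF.injOn_trace lam).trans ?_
  refine (Real.sqrt_le_sqrt ((H.integral_sq_quasiInterp_sub_le hC hfL hv hK.le F.measurable_speed
    (hspeed.mono fun t ht => ⟨norm_nonneg _, ht.2⟩) hP).trans ?_)).trans_eq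
      (Real.sqrt_sq (by positivity))
  rw [mul_pow, mul_pow, Real.sq_sqrt (by positivity), ← pow_mul,
    show (p + 1) * 2 = 2 * p + 2 by ring, ← hG]
  calc G * S.h ^ (2 * p + 2) * ∫ t, v t ^ 2 ∂unitMeasure ≤
        G * S.h ^ (2 * p + 2) * (M * sobolevNorm a (p + 1) f ^ 2) :=
        mul_le_mul_of_nonneg_left hvM (by positivity)
    _ = _ := by ring

end TraceSplines

end DualSpline

end

/-! ### The theorem -/

open DualSpline

theorem mainTheorem1
    (p : ℕ) (F : NurbsMap p) (hF : F.IsBiLipschitz)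
    (ρ : Plane → ℝ) (hρ_meas : Measurable ρ) (ρ₀ ρ₁ : ℝ) (hρ₀ : 0 < ρ₀)
    (hρ : ∀ t ∈ Set.Ioo (0 : ℝ) 1, ρ₀ ≤ ρ (F.trace t) ∧ ρ (F.trace t) ≤ ρ₁)
    (θ κ : ℝ) (r : ℕ) :
    ∃ c : ℝ, 0 < c ∧
      ∀ (S : TraceSplines p) (φ : ℕ × ℕ → ℝ → ℝ)
        (q : Module.Basis (Fin (p + 1)) ℝ (Polynomial.degreeLT ℝ (p + 1)))
        (Iloc : ℕ × ℕ → Finset ℕ),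
        S.IsQuasiUniform θ →
        S.IsLocalExtension κ φ →
        (∀ k ∈ S.extra, Iloc k ⊆ S.bsp ∧ (Iloc k).card = p + 1 ∧
          ∀ i ∈ Iloc k, i ≤ k.1 + r ∧ k.1 ≤ i + r) →
        (∀ k ∈ S.extra, (S.localMatrix (F.rhoHat ρ) q Iloc k).rank = p + 1) →
        -- the element-wise construction is well defined
        (∀ k ∈ S.index, S.IsBroken (S.psiTilde (F.rhoHat ρ) φ k) ∧
          ∀ l ∈ S.index, pairing (F.rhoHat ρ) (S.psiTilde (F.rhoHat ρ) φ k) (φ l) =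
            if k = l then 1 else 0) ∧
        (∀ k ∈ S.extra, ∀ z : ℕ → ℝ, S.SolvesLocalSystem (F.rhoHat ρ) φ q Iloc k z ↔
          z = S.zCoeff (F.rhoHat ρ) φ q Iloc k) ∧
        -- biorthogonality
        (∀ i ∈ S.bsp, ∀ j ∈ S.bsp,
          pairing (F.rhoHat ρ) (S.B i) (S.psiHat (F.rhoHat ρ) φ q Iloc j) =
            if i = j then 1 else 0) ∧
        -- polynomial reproduction
        (∀ P : Polynomial ℝ, P.natDegree ≤ p → ∀ t ∈ Set.Ioo (0 : ℝ) 1,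
          S.quasiInterp (F.rhoHat ρ) φ q Iloc (fun s => P.eval s) t = P.eval t) ∧
        -- optimal approximation, in terms of the pull-back to the parametric interface
        (∀ lam : Plane → ℝ, MemSobolev (fun _ => 1) (p + 1) (fun t => lam (F.trace t)) →
          (⨅ μ : S.multiplierSpace (F.rhoHat ρ) φ q Iloc F.trace,
              curveL2Norm F.trace (fun x => (μ : Plane → ℝ) x - lam x)) ≤
            c * S.h ^ (p + 1) *
              sobolevNorm (fun _ => 1) (p + 1) (fun t => lam (F.trace t))) ∧
        -- optimal approximation, intrinsically on the interface
        (ContDiffOn ℝ p F.trace (Set.Ioo (0 : ℝ) 1) →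
          ∀ lam : Plane → ℝ, CurveMemSobolev F.trace (p + 1) lam →
            (⨅ μ : S.multiplierSpace (F.rhoHat ρ) φ q Iloc F.trace,
                curveL2Norm F.trace (fun x => (μ : Plane → ℝ) x - lam x)) ≤
              c * S.h ^ (p + 1) * curveSobolevNorm F.trace (p + 1) lam) := by
  obtain ⟨a₀, a₁, ha₀, ha₁, hb⟩ := hF.ae_rhoHat_bounds hρ₀ hρ
  have hw : IsWeight a₀ a₁ (F.rhoHat ρ) := ⟨ha₀, ha₁, F.measurable_rhoHat hρ_meas, hb⟩
  obtain ⟨K, hK, hspeed⟩ := hF.ae_speed_bounds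
  obtain ⟨c₁, hc₁, h₁⟩ := TraceSplines.exists_iInf_curveL2Norm_le hF (ρ := F.rhoHat ρ) (a₀ := a₀)
    (a₁ := a₁) θ κ r Set.countable_empty (BddSmooth.const 1 p) one_pos
    (Filter.Eventually.of_forall fun _ => le_rfl)
  obtain ⟨c₂, hc₂, h₂⟩ : ∃ c, 0 ≤ c ∧ (ContDiffOn ℝ p F.trace (Set.Ioo (0 : ℝ) 1) →
      ∀ (S : TraceSplines p) (φ : ℕ × ℕ → ℝ → ℝ)
        (q : Module.Basis (Fin (p + 1)) ℝ (Polynomial.degreeLT ℝ (p + 1)))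
        (Iloc : ℕ × ℕ → Finset ℕ),
        S.IsLocalConstruction (F.rhoHat ρ) φ q Iloc a₀ a₁ |θ| |κ| r →
        ∀ lam : Plane → ℝ, CurveMemSobolev F.trace (p + 1) lam →
          (⨅ μ : S.multiplierSpace (F.rhoHat ρ) φ q Iloc F.trace,
            curveL2Norm F.trace (fun x => (μ : Plane → ℝ) x - lam x)) ≤
              c * S.h ^ (p + 1) * curveSobolevNorm F.trace (p + 1) lam) := by
    -- The constant is chosen before the smoothness of the curve is assumed, so both cases must
    -- supply one; without smoothness any constant serves.
    by_cases hc : ContDiffOn ℝ p F.trace (Set.Ioo (0 : ℝ) 1)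
    · obtain ⟨c, hc0, h⟩ := TraceSplines.exists_iInf_curveL2Norm_le hF (ρ := F.rhoHat ρ)
        (a₀ := a₀) (a₁ := a₁) θ κ r F.countable_knots (hF.bddSmooth_speed hc) (inv_pos.2 hK)
        (hspeed.mono fun _ ht => ht.1)
      exact ⟨c, hc0, fun _ => h⟩
    · exact ⟨0, le_rfl, fun h => absurd h hc⟩
  -- The sum dominates the constants of both estimates, and the summand one makes it positive.
  refine ⟨c₁ + c₂ + 1, by positivity, fun S φ q Iloc hθ hφ hloc hrank => ?_⟩
  have H : S.IsLocalConstruction (F.rhoHat ρ) φ q Iloc a₀ a₁ |θ| |κ| r :=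
    ⟨hw, hθ.abs, hφ.abs, hloc, hrank⟩
  have hh := S.h_pos
  refine ⟨fun k hk => ⟨(hφ.psiTilde_isLocalSpline k).isBroken,
      fun l hl => hφ.pairing_psiTilde hw hk hl⟩,
    fun k hk z => TraceSplines.solvesLocalSystem_iff_eq_zCoeff (hloc k hk).2.1 (hrank k hk),
    fun i hi j hj => H.pairing_psiHat hi hj,
    fun P hP t ht => H.quasiInterp_polynomial hP (Set.Ioo_subset_Ico_self ht),
    fun lam hlam => (h₁ S φ q Iloc H lam hlam).trans ?_,
    fun hγ lam hlam => (h₂ hγ S φ q Iloc H lam hlam).trans ?_⟩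
  · have := sobolevNorm_nonneg (fun _ => 1) (p + 1) fun t => lam (F.trace t)
    gcongr
    linarith
  · have : 0 ≤ curveSobolevNorm F.trace (p + 1) lam := sobolevNorm_nonneg _ _ _
    gcongr
    linarith
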